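/- Let $f\in\mathbb{Z}[x]$ be a polynomial of degree greater than $1$, and define its iterates by $f^0(x)=x$ and $f^{n+1}(x)=f(f^n(x))$. The series $\sum_{n=0}^\infty \frac{1}{f^n(x)}$ converges in the field $\mathbb{Q}((1/x))$ of formal Laurent series in $1/x$ (with its $(1/x)$-adic topology). Say that $\alpha\in\mathbb{Q}((1/x))$ has a \emph{specializable continued fraction} if $\alpha$ is the value of a finite continued fraction $[a_0,a_1,\dots,a_n]$ or of an infinite continued fraction $[a_0,a_1,a_2,\dots]$ all of whose partial quotients $a_i$ lie in $\mathbb{Z}[x]$. Here constant partial quotients, including $0$, are allowed. With $p_0=a_0$, $q_0=1$, $p_1=a_0a_1+1$, $q_1=a_1$, and $p_n=a_np_{n-1}+p_{n-2}$, $q_n=a_nq_{n-1}+q_{n-2}$ for $n\ge 2$, the value of $[a_0,\dots,a_n]$ is $p_n/q_n$ (with $q_n\neq 0$), and the value of $[a_0,a_1,\dots]$ is $\lim_{n\to\infty}p_n/q_n$ (where $q_n\ne0$ for all sufficiently large $n$ and the limit exists in the $(1/x)$-adic topology). Then $\sum_{n=0}^\infty \frac{1}{f^n(x)}$ has a specializable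 continued fraction if and only if $f$ satisfies at least one of the following congruences in $\mathbb{Z}[x]$: 1. $f(x)\equiv 0 \pmod{x^2}$; 2. $f(x)\equiv -x \pmod{x^2}$; 3. $f(x)\equiv 1 \pmod{x^2(x-1)}$; 4. $f(x)\equiv -1 \pmod{x^2(x+1)}$; 5. $f(x)\equiv x^3-x^2-x+1 \pmod{x^2(x-1)^2}$; 6. $f(x)\equiv -x^3+2x^2-x+1 \pmod{x^2(x-1)^2}$; 7. $f(x)\equiv -x^3+3x^2-2x+1 \pmod{x^2(x-1)^2}$; 8. $f(x)\equiv x^3+x^2-x-1 \pmod{x^2(x+1)^2}$; 9. $f(x)\equiv -x^3-2x^2-x-1 \pmod{x^2(x+1)^2}$; 10. $f(x)\equiv -x^3-3x^2-2x-1 \pmod{x^2(x+1)^2}$; 11. $f(x)\equiv x^2-x+1 \pmod{x^2(x-1)^2}$; 12. $f(x)\equiv x^2-2x+1 \pmod{x^2(x-1)^2}$; 13. $f(x)\equiv -x^2-x-1 \pmod{x^2(x+1)^2}$; 14. $f(x)\equiv -x^2-2x-1 \pmod{x^2(x+1)^2}$. -/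

import Mathlib

open Polynomial Filter Topology

/-- The embedding of `ℤ[x]` into the field `ℚ((1/x))` of formal Laurent series in `1/x`.
The Laurent series field is written here with uniformizer `T = 1/x`, so that `x` goes
to `T⁻¹ = HahnSeries.single (-1) 1`. -/
noncomputable def toLaurentInv : ℤ[X] →+* LaurentSeries ℚ :=
  (Polynomial.aeval (HahnSeries.single (-1 : ℤ) (1 : ℚ) : LaurentSeries ℚ)).toRingHom

/-- The `n`-th iterate of the polynomial `f` under composition: `f⁰(x) = x` and
`fⁿ⁺¹(x) = f(fⁿ(x))`. -/
noncomputable def polyIterate (f : ℤ[X]) : ℕ → ℤ[X]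
  | 0 => X
  | n + 1 => f.comp (polyIterate f n)

/-- Numerator `p_n` of the continued fraction `[a₀, a₁, …, a_n]`. -/
noncomputable def cfNum (a : ℕ → ℤ[X]) : ℕ → ℤ[X]
  | 0 => a 0
  | 1 => a 0 * a 1 + 1
  | n + 2 => a (n + 2) * cfNum a (n + 1) + cfNum a n

/-- Denominator `q_n` of the continued fraction `[a₀, a₁, …, a_n]`. -/
noncomputable def cfDen (a : ℕ → ℤ[X]) : ℕ → ℤ[X]
  | 0 => 1
  | 1 => a 1
  | n + 2 => a (n + 2) * cfDen a (n + 1) + cfDen a n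

/-- The `n`-th convergent `p_n / q_n`, as a formal Laurent series in `1/x`
(meaningful when `q_n ≠ 0`). -/
noncomputable def cfConv (a : ℕ → ℤ[X]) (n : ℕ) : LaurentSeries ℚ :=
  toLaurentInv (cfNum a n) / toLaurentInv (cfDen a n)

/-- `α` is the value of the finite continued fraction `[a₀, …, a_n]`. -/
def IsFiniteCF (a : ℕ → ℤ[X]) (n : ℕ) (α : LaurentSeries ℚ) : Prop :=
  cfDen a n ≠ 0 ∧ cfConv a n = α

/-- `α` is the value of the infinite continued fraction `[a₀, a₁, a₂, …]`: all but finitely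
many convergents are defined, and they converge to `α` in the `(1/x)`-adic topology. -/
def IsInfiniteCF (a : ℕ → ℤ[X]) (α : LaurentSeries ℚ) : Prop :=
  (∀ᶠ n in atTop, cfDen a n ≠ 0) ∧ Tendsto (cfConv a) atTop (𝓝 α)

/-- `α` has a specializable continued fraction: it is the value of a finite or infinite
continued fraction all of whose partial quotients lie in `ℤ[x]`. Constant partial
quotients, including `0`, are allowed. -/
def HasSpecializableCF (α : LaurentSeries ℚ) : Prop :=
  ∃ a : ℕ → ℤ[X], (∃ n, IsFiniteCF a n α) ∨ IsInfiniteCF a α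

/-- The fourteen congruences. Congruence `f ≡ r (mod m)` in `ℤ[x]` is `m ∣ f - r`. -/
def FourteenCongruences (f : ℤ[X]) : Prop :=
  X ^ 2 ∣ f - 0 ∨
  X ^ 2 ∣ f - (-X) ∨
  X ^ 2 * (X - 1) ∣ f - 1 ∨
  X ^ 2 * (X + 1) ∣ f - (-1) ∨
  X ^ 2 * (X - 1) ^ 2 ∣ f - (X ^ 3 - X ^ 2 - X + 1) ∨
  X ^ 2 * (X - 1) ^ 2 ∣ f - (-X ^ 3 + 2 * X ^ 2 - X + 1) ∨
  X ^ 2 * (X - 1) ^ 2 ∣ f - (-X ^ 3 + 3 * X ^ 2 - 2 * X + 1) ∨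
  X ^ 2 * (X + 1) ^ 2 ∣ f - (X ^ 3 + X ^ 2 - X - 1) ∨
  X ^ 2 * (X + 1) ^ 2 ∣ f - (-X ^ 3 - 2 * X ^ 2 - X - 1) ∨
  X ^ 2 * (X + 1) ^ 2 ∣ f - (-X ^ 3 - 3 * X ^ 2 - 2 * X - 1) ∨
  X ^ 2 * (X - 1) ^ 2 ∣ f - (X ^ 2 - X + 1) ∨
  X ^ 2 * (X - 1) ^ 2 ∣ f - (X ^ 2 - 2 * X + 1) ∨
  X ^ 2 * (X + 1) ^ 2 ∣ f - (-X ^ 2 - X - 1) ∨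
  X ^ 2 * (X + 1) ^ 2 ∣ f - (-X ^ 2 - 2 * X - 1)

/-!
Two integer polynomials `p`, `q` form a *column* (`Uni p q`) if `(p, q)` is the first column of a
product of matrices `!![a, 1; 1, 0]` with `a ∈ ℤ[x]`. Quotients of columns are the values of finite
continued fractions over `ℤ[x]`, and a Laurent series has a specializable continued fraction if and
only if it lies in the closure of the set `cfValues` of these quotients. One direction is clear; for
the other, a canonical algorithm takes as partial quotient the polynomial part of the remainder with
its constant term rounded down. It stays in `ℤ[x]` because columns have a normal form (`Uni.red`),
from which a limit of quotients of columns has an integral polynomial part, up to the constant term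
(`exists_degLE_sub`). Its convergents converge because a run of constant partial quotients is the
continued fraction of a rational number and therefore ends. The advantage of the closure is that it
is stable under the passage to tails: if `Uni p q` and `p s - q t = 1`, then a column `(P, Q)` is
turned into the column `(s P - t Q, p Q - q P)`, and conversely (`Uni.tail_iff`). The substitution
`f(x) ↦ -f(-x)` exchanges six of the congruences with six others, so that only `f(0) ≥ 0` matters.

*Sufficiency.* It is enough that all partial sums `1/x + 1/f + ⋯ + 1/fⁿ⁻¹ = p/q` are quotients of
columns. The main tools are the folding lemma (`p/q + 1/(c q²)` is the quotient of a column if `p/q`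
is) and reversal (`s/q` with `p s ≡ 1 (mod q)`). In most cases `fⁿ` is, modulo the square of the
denominator `q` of the preceding partial sum, of a shape that makes the tail of the next partial sum
relative to `p/q` a folded reversal. The two classes with `f(1) = 0` and a double zero at `1` need an
induction that involves several consecutive partial sums and some auxiliary columns (`TwoStep`).

*Necessity.* Write `f = c + (k - 1) x + x² g`. The tails of the series relative to its partial sums
are close to simple rational functions with denominator `x²`. A limit of quotients of columns that is
close to `(c + k x)/x²` has `c, k ∈ {0, 1, -1}`, since its first partial quotients have to be integral
(`Approx.small_coeffs`). If `deg f ≥ 3`, this applies to the tail relative to `1/x` and limits `f`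
modulo `x²`; for `c = 1`, the tail relative to `1/x + 1/f` is close to `(A + B x)/x²`, where `A` and
`B` encode the class of `g` modulo `(x - 1)²`, and further tails exclude all values of `A` and `B`
but those that belong to the congruences. If `deg f = 2`, there is less room, and a similar bound
leaves finitely many polynomials up to those that satisfy a congruence; each of them is excluded by
an explicit partial quotient that is not integral. The case `f ≡ -2x (mod x²)`, in all degrees, leads
to a tail close to `3/x`.
-/

local notation "K" => LaurentSeries ℚ
local notation "ι" => toLaurentInv

/-! ### Degrees of Laurent series in `1/x` -/

/-- `DegLE β n` says that the Laurent series `β` in `1/x` has degree at most `n` in `x`. -/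
def DegLE (β : LaurentSeries ℚ) (n : ℤ) : Prop :=
  (Valued.v β : WithZero (Multiplicative ℤ)) ≤ WithZero.exp n

/-- `DegEq β n` says that the Laurent series `β` in `1/x` is nonzero, of degree `n` in `x`. -/
def DegEq (β : LaurentSeries ℚ) (n : ℤ) : Prop :=
  (Valued.v β : WithZero (Multiplicative ℤ)) = WithZero.exp n

theorem DegLE.mono {β : K} {m n : ℤ} (h : DegLE β m) (hmn : m ≤ n) : DegLE β n :=
  le_trans h (WithZero.exp_le_exp.2 hmn)

theorem DegEq.le {β : K} {m n : ℤ} (h : DegEq β m) (hmn : m ≤ n) : DegLE β n :=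
  le_trans (le_of_eq h) (WithZero.exp_le_exp.2 hmn)

theorem DegEq.cast {β : K} {m n : ℤ} (h : DegEq β m) (hmn : m = n) : DegEq β n := hmn ▸ h

theorem degLE_zero (n : ℤ) : DegLE 0 n := by simp [DegLE]

theorem DegEq.ne_zero {β : K} {n : ℤ} (h : DegEq β n) : β ≠ 0 := by
  rintro rfl
  simp [DegEq] at h
  exact WithZero.exp_ne_zero h.symm

theorem DegLE.add {β γ : K} {n : ℤ} (h : DegLE β n) (h' : DegLE γ n) : DegLE (β + γ) n :=
  Valuation.map_add_le _ h h'

theorem DegLE.neg {β : K} {n : ℤ} (h : DegLE β n) : DegLE (-β) n := by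
  unfold DegLE; rwa [Valuation.map_neg]

theorem DegEq.neg {β : K} {n : ℤ} (h : DegEq β n) : DegEq (-β) n := by
  unfold DegEq; rwa [Valuation.map_neg]

theorem DegLE.sub {β γ : K} {n : ℤ} (h : DegLE β n) (h' : DegLE γ n) : DegLE (β - γ) n := by
  rw [sub_eq_add_neg]; exact h.add h'.neg

theorem DegLE.mul {β γ : K} {m n : ℤ} (h : DegLE β m) (h' : DegLE γ n) :
    DegLE (β * γ) (m + n) := by
  unfold DegLE at *; rw [map_mul, WithZero.exp_add]; exact mul_le_mul' h h'

theorem DegEq.mul {β γ : K} {m n : ℤ} (h : DegEq β m) (h' : DegEq γ n) :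
    DegEq (β * γ) (m + n) := by
  unfold DegEq at *; rw [map_mul, WithZero.exp_add, h, h']

theorem DegEq.inv {β : K} {m : ℤ} (h : DegEq β m) : DegEq β⁻¹ (-m) := by
  unfold DegEq at *; rw [map_inv₀, WithZero.exp_neg, h]

theorem DegEq.div {β γ : K} {m n : ℤ} (h : DegEq β m) (h' : DegEq γ n) :
    DegEq (β / γ) (m - n) := by
  rw [div_eq_mul_inv]; exact (h.mul h'.inv).cast (by ring)

theorem DegLE.div {β γ : K} {m n : ℤ} (h : DegLE β m) (h' : DegEq γ n) :
    DegLE (β / γ) (m - n) := by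
  rw [div_eq_mul_inv]; exact (h.mul (h'.inv.le le_rfl)).mono (by omega)

theorem DegEq.pow {β : K} {m : ℤ} (h : DegEq β m) (k : ℕ) : DegEq (β ^ k) (k * m) := by
  induction k with
  | zero => simp [DegEq]
  | succ k ih => rw [pow_succ]; exact (ih.mul h).cast (by push_cast; ring)

theorem DegEq.add_right {β γ : K} {m n : ℤ} (h : DegEq β m) (h' : DegLE γ n) (hmn : n < m) :
    DegEq (β + γ) m := by
  unfold DegEq DegLE at *
  rw [Valuation.map_add_eq_of_lt_left, h]
  exact lt_of_le_of_lt h' (h ▸ WithZero.exp_lt_exp.2 hmn)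

theorem DegEq.sub_right {β γ : K} {m n : ℤ} (h : DegEq β m) (h' : DegLE γ n) (hmn : n < m) :
    DegEq (β - γ) m := by
  rw [sub_eq_add_neg]; exact h.add_right h'.neg hmn

theorem DegEq.le_of_degLE {β : K} {m n : ℤ} (h : DegEq β m) (h' : DegLE β n) : m ≤ n := by
  unfold DegEq DegLE at *
  rw [h] at h'
  exact WithZero.exp_le_exp.1 h'

theorem exists_degEq {β : K} (h : β ≠ 0) : ∃ n, DegEq β n :=
  ⟨WithZero.log (Valued.v β), (WithZero.exp_log ((Valuation.ne_zero_iff _).2 h)).symm⟩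

theorem DegEq.unique {β : K} {m n : ℤ} (h : DegEq β m) (h' : DegEq β n) : m = n :=
  le_antisymm (h.le_of_degLE (h'.le le_rfl)) (h'.le_of_degLE (h.le le_rfl))

theorem degEq_intCast {k : ℤ} (hk : k ≠ 0) : DegEq (k : K) 0 := by
  have h : (k : K) = HahnSeries.C (k : ℚ) := by simp
  have h1 : DegLE (k : K) 0 := by
    have := (LaurentSeries.valuation_le_iff_coeff_lt_eq_zero ℚ (D := 0) (f := (k : K))).2 (by
      intro n hn
      rw [h, HahnSeries.C_apply, HahnSeries.coeff_single_of_ne hn.ne])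
    simpa [DegLE] using this
  by_contra hne
  have hlt : DegLE (k : K) (-1) := by
    obtain ⟨m, hm⟩ := exists_degEq (β := (k : K)) (by
      rw [h]
      exact fun h0 => hk (by exact_mod_cast HahnSeries.C_injective (h0.trans (map_zero _).symm)))
    have h2 := hm.le_of_degLE h1
    refine hm.le ?_
    by_contra h3
    have : m = 0 := by omega
    exact hne (this ▸ hm)
  have := (LaurentSeries.valuation_le_iff_coeff_lt_eq_zero ℚ (D := 1) (f := (k : K))).1 hlt 0
    one_pos
  rw [h, HahnSeries.C_apply, HahnSeries.coeff_single_same] at this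
  exact hk (by exact_mod_cast this)

theorem degLE_intCast (k : ℤ) : DegLE (k : K) 0 := by
  by_cases h : k = 0
  · subst h; simpa using degLE_zero 0
  · exact (degEq_intCast h).le le_rfl

theorem degEq_one : DegEq (1 : K) 0 := by simp [DegEq]

theorem degEq_X : DegEq (ι X) 1 := by
  have : ι X = HahnSeries.single (-1 : ℤ) (1 : ℚ) := by simp [toLaurentInv]
  rw [this]
  exact (LaurentSeries.valuation_single_zpow ℚ (-1)).trans (by simp)

instance valuation_isTrivialOn_int :
    (Valued.v : Valuation (LaurentSeries ℚ) (WithZero (Multiplicative ℤ))).IsTrivialOn ℤ where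
  eq_one k hk := by
    have := degEq_intCast hk
    simpa [DegEq] using this

theorem degEq_toLaurentInv {p : ℤ[X]} (hp : p ≠ 0) : DegEq (ι p) p.natDegree := by
  have hX := degEq_X
  have hX' : ι X = HahnSeries.single (-1 : ℤ) (1 : ℚ) := by simp [toLaurentInv]
  unfold DegEq at *
  rw [hX'] at hX
  have := valuation_aeval_eq_valuation_X_pow_natDegree_of_one_lt_valuation_X
    (v := (Valued.v : Valuation K (WithZero (Multiplicative ℤ))))
    (HahnSeries.single (-1 : ℤ) (1 : ℚ) : K)
    (by rw [hX, ← WithZero.exp_zero, WithZero.exp_lt_exp]; norm_num) hp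
  rw [hX, ← WithZero.exp_nsmul] at this
  simpa [toLaurentInv] using this

theorem toLaurentInv_ne_zero {p : ℤ[X]} (hp : p ≠ 0) : ι p ≠ 0 := (degEq_toLaurentInv hp).ne_zero

theorem degLE_toLaurentInv {p : ℤ[X]} {n : ℤ} (hp : (p.natDegree : ℤ) ≤ n) : DegLE (ι p) n := by
  by_cases h : p = 0
  · subst h; simpa using degLE_zero n
  · exact (degEq_toLaurentInv h).le hp

theorem natDegree_le_of_degLE {p : ℤ[X]} {n : ℕ} (h : DegLE (ι p) n) : p.natDegree ≤ n := by
  by_cases hp : p = 0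
  · subst hp; simp
  · exact_mod_cast (degEq_toLaurentInv hp).le_of_degLE h

/-- A polynomial `a` with integer coefficients that agrees with `L / k` up to terms of degree
at most `0` forces `k` to divide the non-constant coefficients of `L`. -/
theorem dvd_coeff_of_degLE {a L : ℤ[X]} {k : ℤ} (h : DegLE ((k : K) * ι a - ι L) 0) {i : ℕ}
    (hi : i ≠ 0) : k ∣ L.coeff i := by
  have h1 : (C k * a - L).natDegree ≤ 0 := by
    apply natDegree_le_of_degLE (n := 0)
    simpa using h
  have h2 : (C k * a - L).coeff i = 0 := coeff_eq_zero_of_natDegree_lt (by omega)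
  rw [coeff_sub, coeff_C_mul, sub_eq_zero] at h2
  exact ⟨_, h2.symm⟩

/-! ### The topology of `ℚ((1/x))` -/

theorem mem_nhds_iff_degLE {s : Set (LaurentSeries ℚ)} {β : LaurentSeries ℚ} :
    s ∈ 𝓝 β ↔ ∃ n : ℤ, ∀ γ, DegLE (γ - β) n → γ ∈ s := by
  rw [Valued.mem_nhds]
  constructor
  · rintro ⟨g, hg⟩
    set e := MonoidWithZeroHom.ValueGroup₀.embedding (g : MonoidWithZeroHom.ValueGroup₀
      (MonoidWithZeroHom.ofClass (Valued.v : Valuation K (WithZero (Multiplicative ℤ)))))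
    have he : e ≠ 0 := by
      rw [Ne, map_eq_zero]; exact g.ne_zero
    refine ⟨WithZero.log e - 1, fun γ hγ => hg ?_⟩
    refine (Valuation.restrict_lt_iff_lt_embedding _).2 ?_
    exact lt_of_le_of_lt hγ
      (lt_of_lt_of_eq (WithZero.exp_lt_exp.2 (sub_one_lt (WithZero.log e))) (WithZero.exp_log he))
  · rintro ⟨n, hn⟩
    have hX : DegEq (HahnSeries.single (-n) (1 : ℚ) : K) n := by
      have := LaurentSeries.valuation_single_zpow ℚ (-n)
      simpa [DegEq] using this
    have h0 : (Valued.v.restrict (HahnSeries.single (-n) (1 : ℚ) : K)) ≠ 0 := by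
      rw [Valuation.ne_zero_iff]; exact hX.ne_zero
    refine ⟨Units.mk0 _ h0, fun γ hγ => hn γ ?_⟩
    have h1 : Valued.v.restrict (γ - β) < Valued.v.restrict (HahnSeries.single (-n) (1 : ℚ) : K) :=
      hγ
    rw [Valuation.restrict_lt_iff, hX] at h1
    exact h1.le

theorem mem_closure_iff_degLE {s : Set (LaurentSeries ℚ)} {β : LaurentSeries ℚ} :
    β ∈ closure s ↔ ∀ n : ℤ, ∃ γ ∈ s, DegLE (γ - β) n := by
  rw [mem_closure_iff_nhds]
  constructor
  · intro h n
    obtain ⟨γ, h1, h2⟩ := h {γ | DegLE (γ - β) n} (mem_nhds_iff_degLE.2 ⟨n, fun γ h => h⟩)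
    exact ⟨γ, h2, h1⟩
  · intro h t ht
    obtain ⟨n, hn⟩ := mem_nhds_iff_degLE.1 ht
    obtain ⟨γ, h1, h2⟩ := h n
    exact ⟨γ, hn γ h2, h1⟩

theorem tendsto_iff_degLE {κ : Type*} {l : Filter κ} {u : κ → LaurentSeries ℚ}
    {β : LaurentSeries ℚ} :
    Tendsto u l (𝓝 β) ↔ ∀ n : ℤ, ∀ᶠ i in l, DegLE (u i - β) n := by
  constructor
  · intro h n
    exact h (mem_nhds_iff_degLE.2 ⟨n, fun γ h => h⟩)
  · intro h t ht
    obtain ⟨n, hn⟩ := mem_nhds_iff_degLE.1 ht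
    exact (h n).mono fun i hi => hn _ hi

theorem nonarchimedeanAddGroup_laurentSeries : NonarchimedeanAddGroup (LaurentSeries ℚ) where
  is_nonarchimedean U hU := by
    obtain ⟨n, hn⟩ := mem_nhds_iff_degLE.1 hU
    let S : AddSubgroup (LaurentSeries ℚ) :=
      { carrier := {γ | DegLE γ n}
        add_mem' := fun h h' => h.add h'
        zero_mem' := degLE_zero n
        neg_mem' := fun h => h.neg }
    refine ⟨⟨S, AddSubgroup.isOpen_of_mem_nhds (g := 0) S
      (mem_nhds_iff_degLE.2 ⟨n, fun γ h => by rwa [sub_zero] at h⟩)⟩, fun γ hγ => hn γ ?_⟩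
    have : DegLE γ n := hγ
    rwa [sub_zero]

theorem summable_of_degLE {u : ℕ → LaurentSeries ℚ} (h : ∀ i, DegLE (u i) (-i)) : Summable u := by
  have := nonarchimedeanAddGroup_laurentSeries
  apply NonarchimedeanAddGroup.summable_of_tendsto_cofinite_zero
  rw [Nat.cofinite_eq_atTop, tendsto_iff_degLE]
  intro n
  filter_upwards [eventually_ge_atTop (-n).toNat] with i hi
  rw [sub_zero]
  exact (h i).mono (by omega)

/-! ### Columns of products of continued fraction matrices -/

/-- `Uni p q` says that `(p, q)` is the first column of a product of matrices
`!![a, 1; 1, 0]` with `a ∈ ℤ[x]`; if `q ≠ 0` this says that `p / q` is, without cancellation,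
the value of a finite continued fraction with partial quotients in `ℤ[x]`. -/
inductive Uni : ℤ[X] → ℤ[X] → Prop
  | base : Uni 1 0
  | step (a : ℤ[X]) {p q : ℤ[X]} (h : Uni p q) : Uni (a * p + q) p

namespace Uni

variable {p q s t u v : ℤ[X]}

theorem swap (h : Uni p q) : Uni q p := by
  simpa using h.step 0

theorem add_mul (h : Uni p q) (c : ℤ[X]) : Uni (p + c * q) q := by
  cases h with
  | base => simpa using base
  | @step a p q h =>
    have := h.step (a + c)
    convert this using 1
    ring

theorem add_mul' (h : Uni p q) (c : ℤ[X]) : Uni p (q + c * p) := (h.swap.add_mul c).swap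

/-- The column `(-1, 0)` is reached from `(1, 0)` by the partial quotients `1, -2, 1`; from there
both sign changes propagate through a product. -/
theorem neg_aux (h : Uni p q) : Uni p (-q) ∧ Uni (-p) q := by
  induction h with
  | base =>
    refine ⟨by simpa using base, ?_⟩
    have h1 := ((base.add_mul' 1).add_mul (-2)).add_mul' 1
    norm_num at h1
    exact h1
  | @step a p q h ih =>
    refine ⟨?_, ?_⟩
    · have := ih.2.step (-a)
      convert this using 1
      ring
    · have := ih.1.step (-a)
      convert this using 1
      ring

theorem neg_right (h : Uni p q) : Uni p (-q) := h.neg_aux.1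

theorem neg_left (h : Uni p q) : Uni (-p) q := h.neg_aux.2

theorem zero_one : Uni 0 1 := base.swap

theorem one_right (p : ℤ[X]) : Uni p 1 := by
  simpa using zero_one.add_mul p

theorem one_left (q : ℤ[X]) : Uni 1 q := (one_right q).swap

/-- Both signs of the determinant are needed, since each partial quotient changes the sign. -/
theorem key_aux (h : Uni p q) : ∀ s t, (p * s - q * t = 1 ∨ p * s - q * t = -1) → ∀ u v,
    (Uni u v ↔ Uni (p * u + t * v) (q * u + s * v)) := by
  induction h with
  | base =>
    intro s t hst u v
    have hs : s = 1 ∨ s = -1 := by simpa using hst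
    rcases hs with rfl | rfl
    · constructor
      · intro h
        have := h.add_mul t
        convert this using 1 <;> ring
      · intro h
        have := h.add_mul (-t)
        convert this using 1 <;> ring
    · constructor
      · intro h
        have := (h.add_mul t).neg_right
        convert this using 1 <;> ring
      · intro h
        have := (h.add_mul t).neg_right
        convert this using 1 <;> ring
  | @step a p q h ih =>
    intro s t hst u v
    rw [ih (t - a * s) s (by
      rcases hst with h1 | h1
      · right; linear_combination -h1
      · left; linear_combination -h1) u v]
    constructor
    · intro h
      have := h.step a
      convert this using 1
      ring
    · intro h
      have := (h.add_mul (-a)).swap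
      convert this using 1
      ring

/-- A matrix of determinant `1` whose first column is a `Uni` column preserves `Uni` columns. -/
theorem mul_iff (h : Uni p q) (hst : p * s - q * t = 1) :
    Uni u v ↔ Uni (p * u + t * v) (q * u + s * v) :=
  h.key_aux s t (Or.inl hst) u v

/-- Passing from `P / Q` to the complete quotient that follows the convergent `p / q`. -/
theorem tail_iff (h : Uni p q) (hst : p * s - q * t = 1) (P Q : ℤ[X]) :
    Uni P Q ↔ Uni (s * P - t * Q) (p * Q - q * P) := by
  rw [h.mul_iff hst (u := s * P - t * Q)]
  have e1 : p * (s * P - t * Q) + t * (p * Q - q * P) = P := by linear_combination P * hst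
  have e2 : q * (s * P - t * Q) + s * (p * Q - q * P) = Q := by linear_combination Q * hst
  rw [e1, e2]

/-- The reversed continued fraction: if `s` is inverse to `p` modulo `q`, then `s / q` is
obtained from `p / q` by reversing the partial quotients. -/
theorem reverse (h : Uni p q) (hst : p * s - q * t = 1) : Uni s q := by
  have h1 : Uni s (-q) := by
    rw [h.mul_iff hst]
    have e1 : p * s + t * (-q) = 1 := by linear_combination hst
    have e2 : q * s + s * (-q) = 0 := by ring
    rw [e1, e2]
    exact base
  simpa using h1.neg_right

theorem exists_inverse (h : Uni p q) : ∃ s t, p * s - q * t = 1 := by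
  induction h with
  | base => exact ⟨1, 0, by ring⟩
  | @step a p q h ih =>
    obtain ⟨s, t, hst⟩ := ih
    exact ⟨-t, -s - a * t, by linear_combination hst⟩

/-- The folding lemma: `p / q + 1 / (c q²)` is again the value of a continued fraction. -/
theorem fold (h : Uni p q) (c : ℤ[X]) : Uni (1 + c * p * q) (c * q ^ 2) := by
  obtain ⟨s, t, hst⟩ := h.exists_inverse
  rw [h.tail_iff hst]
  have e1 : s * (1 + c * p * q) - t * (c * q ^ 2) = s + (-c) * (-q) := by
    linear_combination c * q * hst
  have e2 : p * (c * q ^ 2) - q * (1 + c * p * q) = -q := by ring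
  rw [e1, e2]
  exact (h.reverse hst).neg_right.add_mul _

theorem comp (h : Uni p q) (r : ℤ[X]) : Uni (p.comp r) (q.comp r) := by
  induction h with
  | base => simpa using base
  | @step a p q h ih => simpa using ih.step (a.comp r)

end Uni

theorem cfNum_cfDen_shift (a : ℕ → ℤ[X]) (n : ℕ) :
    (cfNum a (n + 1) = a 0 * cfNum (fun i => a (i + 1)) n + cfDen (fun i => a (i + 1)) n ∧
      cfDen a (n + 1) = cfNum (fun i => a (i + 1)) n) := by
  induction n using Nat.twoStepInduction with
  | zero => simp [cfNum, cfDen]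
  | one => simp [cfNum, cfDen]; refine ⟨?_, ?_⟩ <;> ring
  | more n ih1 ih2 =>
    have e1 : cfNum a (n + 2 + 1) = a (n + 3) * cfNum a (n + 1 + 1) + cfNum a (n + 1) := rfl
    have e2 : cfDen a (n + 2 + 1) = a (n + 3) * cfDen a (n + 1 + 1) + cfDen a (n + 1) := rfl
    rw [e1, e2, ih1.1, ih1.2, ih2.1, ih2.2, cfNum, cfDen]
    exact ⟨by ring, rfl⟩

theorem uni_cfNum_cfDen (n : ℕ) : ∀ a : ℕ → ℤ[X], Uni (cfNum a n) (cfDen a n) := by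
  induction n with
  | zero => intro a; exact Uni.one_right _
  | succ n ih =>
    intro a
    rw [(cfNum_cfDen_shift a n).1, (cfNum_cfDen_shift a n).2]
    exact (ih _).step _

/-! ### The normal form of a column and integrality of the polynomial part -/

/-- Normal form of `Uni` columns: constant columns, and the columns obtained from
`(p + e q, q)`, with `e` nonconstant and `deg p ≤ deg q`, by a matrix in `GL₂(ℤ)`. It reflects
the decomposition of a word into nonconstant partial quotients and blocks of constants. -/
inductive Red : ℤ[X] → ℤ[X] → Prop
  | const (a c : ℤ) (h : IsCoprime a c) : Red (C a) (C c)
  | tr (a b c d : ℤ) (h : IsUnit (a * d - b * c)) (e p q : ℤ[X]) (he : 0 < e.natDegree)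
      (hq : q ≠ 0) (hpq : p.natDegree ≤ q.natDegree) (hr : Red p q) :
      Red (C a * (p + e * q) + C b * q) (C c * (p + e * q) + C d * q)

namespace Red

variable {p q : ℤ[X]}

/-- Stability of the normal form under `GL₂(ℤ)`. -/
theorem lin (h : Red p q) (a b c d : ℤ) (hu : IsUnit (a * d - b * c)) :
    Red (C a * p + C b * q) (C c * p + C d * q) := by
  cases h with
  | const a' c' h' =>
    have h1 : IsCoprime (a * a' + b * c') (c * a' + d * c') := by
      obtain ⟨m, n, hmn⟩ := h'
      rcases Int.isUnit_iff.1 hu with hu | hu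
      · exact ⟨m * d - n * c, n * a - m * b, by linear_combination hmn + (m * a' + n * c') * hu⟩
      · exact ⟨-(m * d - n * c), -(n * a - m * b),
          by linear_combination hmn - (m * a' + n * c') * hu⟩
    have := Red.const _ _ h1
    simpa using this
  | tr a' b' c' d' h' e p q he hq hpq hr =>
    have := Red.tr (a * a' + b * c') (a * b' + b * d') (c * a' + d * c') (c * b' + d * d')
      (by
        have := hu.mul h'
        convert this using 1
        ring) e p q he hq hpq hr
    convert this using 1 <;> simp <;> ring

theorem natDegree_add_mul {e p q : ℤ[X]} (he : 0 < e.natDegree) (hq : q ≠ 0)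
    (hpq : p.natDegree ≤ q.natDegree) (a b : ℤ) (ha : a ≠ 0) :
    (C a * (p + e * q) + C b * q).natDegree = e.natDegree + q.natDegree := by
  have he0 : e ≠ 0 := by rintro rfl; simp at he
  have h1 : (C a * (e * q)).natDegree = e.natDegree + q.natDegree := by
    rw [natDegree_C_mul ha, natDegree_mul he0 hq]
  have h2 : (C a * p + C b * q).natDegree < (C a * (e * q)).natDegree := by
    rw [h1]
    refine lt_of_le_of_lt (natDegree_add_le_of_degree_le (n := q.natDegree) ?_ ?_) (by omega)
    · exact (natDegree_C_mul_le _ _).trans hpq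
    · exact natDegree_C_mul_le _ _
  have : C a * (p + e * q) + C b * q = (C a * p + C b * q) + C a * (e * q) := by ring
  rw [this, natDegree_add_eq_right_of_natDegree_lt h2, h1]

theorem add_mul (h : Red p q) (f : ℤ[X]) : Red (p + f * q) q := by
  by_cases hf : f.natDegree = 0
  · obtain ⟨k, rfl⟩ := natDegree_eq_zero.1 hf
    have := h.lin 1 k 0 1 (by simp)
    simpa using this
  have key : q ≠ 0 → p.natDegree ≤ q.natDegree → Red (p + f * q) q := by
    intro h1 h2
    have := Red.tr 1 0 0 1 (by simp) f p q (by omega) h1 h2 h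
    simpa using this
  cases h with
  | const a c hac =>
    by_cases hc : c = 0
    · subst hc
      simpa using Red.const a 0 hac
    · exact key (by simpa using hc) (by simp)
  | tr a b c d hu e p q he hq hpq hr =>
    by_cases hc : c = 0
    · subst hc
      have had : IsUnit a ∧ IsUnit d := by
        have : IsUnit (a * d) := by simpa using hu
        exact IsUnit.mul_iff.1 this
      have haa : a * a = 1 := Int.isUnit_mul_self had.1
      have haa' : (C a : ℤ[X]) * C a = 1 := by rw [← C_mul, haa, C_1]
      have e1 : C a * (p + e * q) + C b * q + f * (C 0 * (p + e * q) + C d * q) =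
          C a * (p + (e + C (a * d) * f) * q) + C b * q := by
        rw [C_mul, C_0]
        linear_combination (-(C d * f * q)) * haa'
      have e2 : C 0 * (p + e * q) + C d * q =
          C 0 * (p + (e + C (a * d) * f) * q) + C d * q := by simp
      rw [e1, e2]
      by_cases hz : (e + C (a * d) * f).natDegree = 0
      · obtain ⟨k, hk⟩ := natDegree_eq_zero.1 hz
        rw [← hk]
        have := (hr.lin 1 k 0 1 (by simp)).lin a b 0 d hu
        simpa using this
      · exact Red.tr a b 0 d hu _ p q (by omega) hq hpq hr
    · have h2 := natDegree_add_mul he hq hpq c d hc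
      refine key ?_ ?_
      · intro h0
        rw [h0] at h2
        simp at h2
        omega
      · rw [h2]
        by_cases ha : a = 0
        · subst ha
          simp only [C_0, zero_mul, zero_add]
          exact (natDegree_C_mul_le _ _).trans (by omega)
        · rw [natDegree_add_mul he hq hpq a b ha]

/-- The polynomial part of `p / q` is integral up to its constant term. -/
theorem exists_natDegree_sub_le (h : Red p q) (hq0 : q ≠ 0) :
    ∃ a : ℤ[X], (p - a * q).natDegree ≤ q.natDegree := by
  cases h with
  | const a c hac => exact ⟨0, by simp⟩
  | tr a b c d hu e p q he hq hpq hr =>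
    by_cases hc : c = 0
    · subst hc
      have had : IsUnit a ∧ IsUnit d := by
        have : IsUnit (a * d) := by simpa using hu
        exact IsUnit.mul_iff.1 this
      have hd : (C d : ℤ[X]) * C d = 1 := by rw [← C_mul, Int.isUnit_mul_self had.2, C_1]
      have hd0 : d ≠ 0 := had.2.ne_zero
      refine ⟨C (a * d) * e + C (b * d), ?_⟩
      have e1 : C a * (p + e * q) + C b * q -
          (C (a * d) * e + C (b * d)) * (C 0 * (p + e * q) + C d * q) = C a * p := by
        rw [C_mul, C_mul, C_0]
        linear_combination (-(C a * e * q + C b * q)) * hd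
      rw [e1]
      simp only [C_0, zero_mul, zero_add]
      rw [natDegree_C_mul hd0]
      exact (natDegree_C_mul_le _ _).trans hpq
    · refine ⟨0, ?_⟩
      rw [zero_mul, sub_zero, natDegree_add_mul he hq hpq c d hc]
      by_cases ha : a = 0
      · subst ha
        simp only [C_0, zero_mul, zero_add]
        exact (natDegree_C_mul_le _ _).trans (by omega)
      · rw [natDegree_add_mul he hq hpq a b ha]

end Red

theorem Uni.red {p q : ℤ[X]} (h : Uni p q) : Red p q := by
  induction h with
  | base => simpa using Red.const 1 0 isCoprime_one_left
  | @step a p q h ih =>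
    have := (ih.lin 0 1 1 0 (by simp)).add_mul a
    simp only [C_0, C_1, zero_mul, one_mul, zero_add, add_zero] at this
    rwa [add_comm]

/-! ### The closure of the set of values of finite continued fractions -/

/-- The values of finite continued fractions with partial quotients in `ℤ[x]`. -/
def cfValues : Set (LaurentSeries ℚ) :=
  {β | ∃ p q, Uni p q ∧ q ≠ 0 ∧ β = toLaurentInv p / toLaurentInv q}

theorem mem_closure_of_hasSpecializableCF {α : K} (h : HasSpecializableCF α) :
    α ∈ closure cfValues := by
  obtain ⟨a, ⟨n, hn, hα⟩ | ⟨h0, hα⟩⟩ := h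
  · exact subset_closure ⟨_, _, uni_cfNum_cfDen n a, hn, hα.symm⟩
  · exact mem_closure_of_tendsto hα (h0.mono fun n hn => ⟨_, _, uni_cfNum_cfDen n a, hn, rfl⟩)

theorem continuousAt_of_cfValues {φ : K → K} {β : K} (h : β ∈ closure cfValues)
    (hc : ContinuousAt φ β) (hm : ∀ᶠ γ in 𝓝 β, γ ∈ cfValues → φ γ ∈ cfValues) :
    φ β ∈ closure cfValues := by
  rw [mem_closure_iff_frequently] at h ⊢
  exact hc.frequently ((h.and_eventually hm).mono fun γ hγ => hγ.2 hγ.1)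

/-- Stability under the passage to a tail: up to sign, the new element is the complete quotient of
`β` after the convergent `p / q`. -/
theorem cf_mobius_mem {β : K} (h : β ∈ closure cfValues) {p q s t : ℤ[X]} (hu : Uni p q)
    (hst : p * s - q * t = 1) (hβ : ι p - ι q * β ≠ 0) :
    (ι s * β - ι t) / (ι p - ι q * β) ∈ closure cfValues := by
  have hc : ContinuousAt (fun γ : K => ι p - ι q * γ) β := by fun_prop
  refine continuousAt_of_cfValues (φ := fun γ => (ι s * γ - ι t) / (ι p - ι q * γ)) h ?_ ?_
  · exact ContinuousAt.div₀ (by fun_prop) hc hβ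
  · filter_upwards [hc.eventually_ne hβ] with γ hγ
    rintro ⟨P, Q, hU, hQ, rfl⟩
    have hQ' := toLaurentInv_ne_zero hQ
    have e : ι (p * Q - q * P) = (ι p - ι q * (ι P / ι Q)) * ι Q := by
      simp only [map_sub, map_mul]; field_simp
    have h0 : ι (p * Q - q * P) ≠ 0 := by
      rw [e]; exact mul_ne_zero hγ hQ'
    refine ⟨_, _, (hu.tail_iff hst P Q).1 hU, fun h0' => h0 (by rw [h0', map_zero]), ?_⟩
    rw [e]
    simp only [map_sub, map_mul]
    field_simp

theorem cf_add_mem {β : K} (h : β ∈ closure cfValues) (a : ℤ[X]) : β + ι a ∈ closure cfValues := by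
  have := cf_mobius_mem h (p := 1) (q := 0) (s := 1) (t := -a) Uni.base (by ring) (by simp)
  simpa using this

theorem cf_sub_mem {β : K} (h : β ∈ closure cfValues) (a : ℤ[X]) : β - ι a ∈ closure cfValues := by
  simpa [sub_eq_add_neg] using cf_add_mem h (-a)

theorem cf_neg_mem {β : K} (h : β ∈ closure cfValues) : -β ∈ closure cfValues := by
  refine continuousAt_of_cfValues (φ := fun γ => -γ) h (by fun_prop) (Eventually.of_forall ?_)
  rintro γ ⟨P, Q, hU, hQ, rfl⟩
  exact ⟨-P, Q, hU.neg_left, hQ, by rw [map_neg]; ring⟩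

theorem cf_inv_mem {β : K} (h : β ∈ closure cfValues) : β⁻¹ ∈ closure cfValues := by
  by_cases h0 : β = 0
  · subst h0; simpa using h
  · have := cf_neg_mem (cf_mobius_mem h (p := 0) (q := 1) (s := 0) (t := -1) Uni.zero_one (by ring)
      (by simpa using h0))
    convert this using 1
    simp only [map_zero, map_one, map_neg]
    field_simp
    ring

/-- A limit of values of finite continued fractions over `ℤ[x]` agrees with a polynomial in
`ℤ[x]` up to terms of degree at most `0`. -/
theorem exists_degLE_sub {β : K} (h : β ∈ closure cfValues) : ∃ a : ℤ[X], DegLE (β - ι a) 0 := by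
  obtain ⟨γ, ⟨p, q, hU, hq, rfl⟩, hγ⟩ := mem_closure_iff_degLE.1 h 0
  obtain ⟨a, ha⟩ := hU.red.exists_natDegree_sub_le hq
  refine ⟨a, ?_⟩
  have hq' := toLaurentInv_ne_zero hq
  have e : β - ι a = ι (p - a * q) / ι q - (ι p / ι q - β) := by
    rw [map_sub, map_mul]; field_simp; ring
  rw [e]
  refine DegLE.sub ?_ hγ
  exact ((degLE_toLaurentInv (n := q.natDegree) (by exact_mod_cast ha)).div
    (degEq_toLaurentInv hq)).mono (by omega)

/-- The integrality test: if `k β` agrees with `L` up to terms of degree at most `0`, then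
`k` divides the nonconstant coefficients of `L`. -/
theorem dvd_coeff_of_mem {β : K} (h : β ∈ closure cfValues) {k : ℤ} {L : ℤ[X]}
    (hL : DegLE (k * β - ι L) 0) {i : ℕ} (hi : i ≠ 0) : k ∣ L.coeff i := by
  obtain ⟨a, ha⟩ := exists_degLE_sub h
  refine dvd_coeff_of_degLE (a := a) ?_ hi
  have e : (k : K) * ι a - ι L = k * β - ι L - k * (β - ι a) := by ring
  rw [e]
  exact hL.sub (((degLE_intCast k).mul ha).mono (by omega))

/-! ### The canonical continued fraction -/

theorem degLE_C (r : ℚ) : DegLE (HahnSeries.C r) 0 := by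
  have := (LaurentSeries.valuation_le_iff_coeff_lt_eq_zero ℚ (D := 0)
    (f := (HahnSeries.C r : K))).2 (by
      intro n hn
      rw [HahnSeries.C_apply, HahnSeries.coeff_single_of_ne hn.ne])
  simpa [DegLE] using this

theorem eq_zero_of_degLE_C {r : ℚ} (h : DegLE (HahnSeries.C r) (-1)) : r = 0 := by
  have := (LaurentSeries.valuation_le_iff_coeff_lt_eq_zero ℚ (D := 1)
    (f := (HahnSeries.C r : K))).1 h 0 one_pos
  rwa [HahnSeries.C_apply, HahnSeries.coeff_single_same] at this

theorem degEq_C {r : ℚ} (h : r ≠ 0) : DegEq (HahnSeries.C r) 0 := by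
  have h0 : (HahnSeries.C r : K) ≠ 0 := by
    rw [Ne, map_eq_zero]; exact h
  obtain ⟨m, hm⟩ := exists_degEq h0
  have h2 := hm.le_of_degLE (degLE_C r)
  by_cases h3 : m = 0
  · exact h3 ▸ hm
  · exact absurd (eq_zero_of_degLE_C (hm.le (by omega))) h

theorem degLE_sub_C {β : K} (h : DegLE β 0) : ∃ r : ℚ, DegLE (β - HahnSeries.C r) (-1) := by
  refine ⟨β.coeff 0, ?_⟩
  refine (LaurentSeries.valuation_le_iff_coeff_lt_eq_zero ℚ (D := 1)
    (f := (β - HahnSeries.C (β.coeff 0) : K))).2 ?_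
  intro n hn
  rw [HahnSeries.coeff_sub, HahnSeries.C_apply]
  rcases (show n < 0 ∨ n = 0 by omega) with h1 | rfl
  · rw [HahnSeries.coeff_single_of_ne h1.ne, sub_zero]
    have h' : (Valued.v β : WithZero (Multiplicative ℤ)) ≤ WithZero.exp (-0) := by
      simpa [DegLE] using h
    exact (LaurentSeries.valuation_le_iff_coeff_lt_eq_zero ℚ (D := 0)).1 h' n h1
  · rw [HahnSeries.coeff_single_same, sub_self]

theorem intCast_eq_C (k : ℤ) : (k : K) = HahnSeries.C (k : ℚ) := by simp

/-- One step of the canonical continued fraction: the integral partial quotient, chosen so that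
the constant term of the remainder lies in `[0, 1)`. -/
theorem exists_canonical_step {β : K} (h : β ∈ closure cfValues) :
    ∃ (a : ℤ[X]) (r : ℚ), 0 ≤ r ∧ r < 1 ∧ DegLE (β - ι a - HahnSeries.C r) (-1) := by
  obtain ⟨a, ha⟩ := exists_degLE_sub h
  obtain ⟨r, hr⟩ := degLE_sub_C ha
  refine ⟨a + C ⌊r⌋, Int.fract r, Int.fract_nonneg r, Int.fract_lt_one r, ?_⟩
  have e : β - ι (a + C ⌊r⌋) - HahnSeries.C (Int.fract r) = β - ι a - HahnSeries.C r := by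
    have h1 : ι (C ⌊r⌋) = HahnSeries.C (⌊r⌋ : ℚ) := by
      rw [← intCast_eq_C]; simp
    have h2 : (HahnSeries.C r : K) = HahnSeries.C (⌊r⌋ : ℚ) + HahnSeries.C (Int.fract r) := by
      rw [← map_add, Int.floor_add_fract]
    rw [map_add, h1, h2]
    ring
  rwa [e]

/-- Laurent series of positive degree, or of degree `0` with positive leading coefficient. -/
def IsBig (β : LaurentSeries ℚ) : Prop :=
  (∃ m : ℤ, 1 ≤ m ∧ DegEq β m) ∨ ∃ r : ℚ, 0 < r ∧ DegLE (β - HahnSeries.C r) (-1)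

/-- Laurent series of degree at most `0` whose constant term is nonnegative. -/
def IsSmall (β : LaurentSeries ℚ) : Prop :=
  ∃ r : ℚ, 0 ≤ r ∧ DegLE (β - HahnSeries.C r) (-1)

theorem degEq_zero_of_sub_C {β : K} {r : ℚ} (hr : r ≠ 0) (h : DegLE (β - HahnSeries.C r) (-1)) :
    DegEq β 0 := by
  have := (degEq_C hr).add_right h (by omega)
  simpa using this

theorem inv_sub_C {β : K} {r : ℚ} (hr : r ≠ 0) (h : DegLE (β - HahnSeries.C r) (-1)) :
    DegLE (β⁻¹ - HahnSeries.C r⁻¹) (-1) := by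
  have h0 := degEq_zero_of_sub_C hr h
  have h1 := degEq_C hr
  have e : β⁻¹ - HahnSeries.C r⁻¹ = -(β - HahnSeries.C r) / (β * HahnSeries.C r) := by
    rw [map_inv₀]
    have := h0.ne_zero
    have := h1.ne_zero
    field_simp
    ring
  rw [e]
  exact (h.neg.div (h0.mul h1)).mono (by omega)

theorem IsBig.exists_degEq {β : K} (h : IsBig β) : ∃ m : ℤ, 0 ≤ m ∧ DegEq β m := by
  rcases h with ⟨m, hm, h⟩ | ⟨r, hr, h⟩
  · exact ⟨m, by omega, h⟩
  · exact ⟨0, le_rfl, degEq_zero_of_sub_C hr.ne' h⟩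

theorem IsBig.inv {β : K} (h : IsBig β) : IsSmall β⁻¹ := by
  rcases h with ⟨m, hm, h⟩ | ⟨r, hr, h⟩
  · exact ⟨0, le_rfl, by simpa using h.inv.le (by omega)⟩
  · exact ⟨r⁻¹, by positivity, inv_sub_C hr.ne' h⟩

theorem IsSmall.degLE {β : K} (h : IsSmall β) : DegLE β 0 := by
  obtain ⟨r, hr, h⟩ := h
  have := (h.mono (by omega)).add (degLE_C r)
  simpa using this

theorem IsBig.add {β γ : K} (h : IsBig β) (h' : IsSmall γ) : IsBig (β + γ) := by
  rcases h with ⟨m, hm, h⟩ | ⟨r, hr, h⟩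
  · exact Or.inl ⟨m, hm, h.add_right h'.degLE (by omega)⟩
  · obtain ⟨r', hr', h'⟩ := h'
    refine Or.inr ⟨r + r', by positivity, ?_⟩
    have e : β + γ - HahnSeries.C (r + r') = (β - HahnSeries.C r) + (γ - HahnSeries.C r') := by
      rw [map_add]; ring
    rw [e]
    exact h.add h'

/-- In a run of constant partial quotients the constant terms of the remainders have decreasing
denominators. -/
theorem den_inv_sub_lt {r : ℚ} (h0 : 0 < r) (h1 : r < 1) (c : ℤ) : (r⁻¹ - c).den < r.den := by
  have hden : (r⁻¹ - c).den = (r⁻¹).den := by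
    have := Rat.add_intCast_den r⁻¹ (-c)
    simpa [sub_eq_add_neg] using this
  rw [hden, Rat.den_inv_of_ne_zero h0.ne']
  have h2 := Rat.num_pos.2 h0
  have h3 : r.num < r.den := Rat.num_lt_denom_iff.2 h1
  omega

theorem exists_canonical_seq {α : K} (h : α ∈ closure cfValues) :
    ∃ (b : ℕ → LaurentSeries ℚ) (a : ℕ → ℤ[X]) (r : ℕ → ℚ), b 0 = α ∧ ∀ n,
      b (n + 1) = (b n - ι (a n))⁻¹ ∧ 0 ≤ r n ∧ r n < 1 ∧
      DegLE (b n - ι (a n) - HahnSeries.C (r n)) (-1) := by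
  have step : ∀ β : closure cfValues, ∃ (a : ℤ[X]) (r : ℚ), 0 ≤ r ∧ r < 1 ∧
    DegLE ((β : K) - ι a - HahnSeries.C r) (-1) := fun β => exists_canonical_step β.2
  choose a r h0 h1 h2 using step
  obtain ⟨g, hg⟩ : ∃ g : closure cfValues → closure cfValues, ∀ β, (g β : K) = ((β : K) - ι (a β))⁻¹ :=
    ⟨fun β => ⟨((β : K) - ι (a β))⁻¹, cf_inv_mem (cf_sub_mem β.2 _)⟩, fun _ => rfl⟩
  refine ⟨fun n => (g^[n] ⟨α, h⟩ : closure cfValues), fun n => a (g^[n] ⟨α, h⟩),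
    fun n => r (g^[n] ⟨α, h⟩), rfl, fun n => ⟨?_, h0 _, h1 _, h2 _⟩⟩
  simp only [Function.iterate_succ_apply', hg]

section CanonicalSeq

variable {b : ℕ → LaurentSeries ℚ} {a : ℕ → ℤ[X]} {r : ℕ → ℚ}

/-- A complete quotient after the first one has positive degree, or degree `0` with constant
term greater than `1`, according to whether the preceding remainder has constant term `0`. -/
theorem canonical_succ (hb : ∀ n, b (n + 1) = (b n - ι (a n))⁻¹ ∧ 0 ≤ r n ∧ r n < 1 ∧
      DegLE (b n - ι (a n) - HahnSeries.C (r n)) (-1)) {n : ℕ} (hn : b n ≠ ι (a n)) :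
    (r n = 0 ∧ ∃ m : ℤ, 1 ≤ m ∧ DegEq (b (n + 1)) m) ∨
      (0 < r n ∧ DegLE (b (n + 1) - HahnSeries.C (r n)⁻¹) (-1)) := by
  obtain ⟨h1, h2, h3, h4⟩ := hb n
  rcases h2.eq_or_lt with h0 | h0
  · left
    refine ⟨h0.symm, ?_⟩
    rw [← h0, map_zero, sub_zero] at h4
    obtain ⟨m, hm⟩ := exists_degEq (sub_ne_zero.2 hn)
    have := hm.le_of_degLE h4
    exact ⟨-m, by omega, by rw [h1]; exact hm.inv⟩
  · right
    refine ⟨h0, ?_⟩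
    rw [h1]
    exact inv_sub_C h0.ne' h4

theorem canonical_isBig (hb : ∀ n, b (n + 1) = (b n - ι (a n))⁻¹ ∧ 0 ≤ r n ∧ r n < 1 ∧
      DegLE (b n - ι (a n) - HahnSeries.C (r n)) (-1)) {n : ℕ} (hn : b n ≠ ι (a n)) :
    IsBig (b (n + 1)) := by
  rcases canonical_succ hb hn with ⟨-, h⟩ | ⟨h, h'⟩
  · exact Or.inl h
  · exact Or.inr ⟨_, inv_pos.2 h, h'⟩

theorem canonical_partialQuotient (hb : ∀ n, b (n + 1) = (b n - ι (a n))⁻¹ ∧ 0 ≤ r n ∧ r n < 1 ∧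
      DegLE (b n - ι (a n) - HahnSeries.C (r n)) (-1)) {n : ℕ} (hn : b n ≠ ι (a n)) :
    (r n = 0 ∧ ∃ m : ℤ, 1 ≤ m ∧ DegEq (ι (a (n + 1))) m) ∨
      (0 < r n ∧ ∃ c : ℤ, 0 < c ∧ a (n + 1) = C c ∧ r (n + 1) = (r n)⁻¹ - c) := by
  obtain ⟨h1, h2, h3, h4⟩ := hb (n + 1)
  have hR : DegLE (b (n + 1) - ι (a (n + 1))) 0 := by
    have := (h4.mono (by omega)).add (degLE_C (r (n + 1)))
    simpa using this
  rcases canonical_succ hb hn with ⟨h, m, hm, h'⟩ | ⟨h, h'⟩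
  · left
    refine ⟨h, m, hm, ?_⟩
    have := h'.sub_right hR (by omega)
    simpa using this
  · right
    refine ⟨h, ?_⟩
    have e : HahnSeries.C ((r n)⁻¹ - r (n + 1)) - ι (a (n + 1)) =
        (b (n + 1) - ι (a (n + 1)) - HahnSeries.C (r (n + 1))) -
          (b (n + 1) - HahnSeries.C (r n)⁻¹) := by
      rw [map_sub]; ring
    have h5 : DegLE (HahnSeries.C ((r n)⁻¹ - r (n + 1)) - ι (a (n + 1))) (-1) := by
      rw [e]; exact h4.sub h'
    have h6 : DegLE (ι (a (n + 1))) (0 : ℕ) := by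
      have := (degLE_C ((r n)⁻¹ - r (n + 1))).sub (h5.mono (by omega))
      simpa using this
    obtain ⟨c, hc⟩ := natDegree_eq_zero.1 (Nat.le_zero.1 (natDegree_le_of_degLE h6))
    have h7 : ι (a (n + 1)) = HahnSeries.C (c : ℚ) := by
      rw [← hc, ← intCast_eq_C]; simp
    rw [h7, ← map_sub] at h5
    have h8 := eq_zero_of_degLE_C h5
    have h9 : 1 < (r n)⁻¹ := (one_lt_inv₀ h).2 (hb n).2.2.1
    have h10 : (0 : ℚ) < c := by linarith
    exact ⟨c, by exact_mod_cast h10, hc.symm, by linarith⟩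

theorem canonical_partialQuotient_isBig (hb : ∀ n, b (n + 1) = (b n - ι (a n))⁻¹ ∧ 0 ≤ r n ∧
      r n < 1 ∧ DegLE (b n - ι (a n) - HahnSeries.C (r n)) (-1)) {n : ℕ} (hn : b n ≠ ι (a n)) :
    IsBig (ι (a (n + 1))) := by
  rcases canonical_partialQuotient hb hn with ⟨-, h⟩ | ⟨-, c, hc, h, -⟩
  · exact Or.inl h
  · refine Or.inr ⟨c, by exact_mod_cast hc, ?_⟩
    have h7 : ι (a (n + 1)) = HahnSeries.C (c : ℚ) := by
      rw [h, ← intCast_eq_C]; simp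
    rw [h7, sub_self]
    exact degLE_zero _

theorem canonical_cfDen (hb : ∀ n, b (n + 1) = (b n - ι (a n))⁻¹ ∧ 0 ≤ r n ∧
      r n < 1 ∧ DegLE (b n - ι (a n) - HahnSeries.C (r n)) (-1)) (n : ℕ)
      (hn : ∀ i ≤ n, b i ≠ ι (a i)) :
    cfDen a n ≠ 0 ∧ cfDen a (n + 1) ≠ 0 ∧ IsBig (ι (cfDen a (n + 1)) / ι (cfDen a n)) := by
  induction n with
  | zero =>
    have := canonical_partialQuotient_isBig hb (hn 0 le_rfl)
    refine ⟨by simp [cfDen], ?_, by simpa [cfDen] using this⟩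
    obtain ⟨m, -, hm⟩ := this.exists_degEq
    intro h0
    exact hm.ne_zero (by simp only [cfDen] at h0; rw [zero_add, h0, map_zero])
  | succ n ih =>
    obtain ⟨h1, h2, h3⟩ := ih fun i hi => hn i (by omega)
    have h4 := (canonical_partialQuotient_isBig hb (hn (n + 1) le_rfl)).add h3.inv
    have h1' := toLaurentInv_ne_zero h1
    have h2' := toLaurentInv_ne_zero h2
    have e : ι (a (n + 1 + 1)) + (ι (cfDen a (n + 1)) / ι (cfDen a n))⁻¹ =
        ι (cfDen a (n + 1 + 1)) / ι (cfDen a (n + 1)) := by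
      rw [show cfDen a (n + 1 + 1) = a (n + 2) * cfDen a (n + 1) + cfDen a n from rfl, map_add,
        map_mul]
      field_simp
    rw [e] at h4
    refine ⟨h2, ?_, h4⟩
    intro h0
    obtain ⟨m, -, hm⟩ := h4.exists_degEq
    exact hm.ne_zero (by rw [h0, map_zero, zero_div])

theorem canonical_mul_succ (hb : ∀ n, b (n + 1) = (b n - ι (a n))⁻¹) {n : ℕ}
    (hn : b n ≠ ι (a n)) : b n * b (n + 1) = ι (a n) * b (n + 1) + 1 := by
  have := sub_ne_zero.2 hn
  rw [hb n]
  field_simp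
  ring

theorem canonical_value (hb : ∀ n, b (n + 1) = (b n - ι (a n))⁻¹) (n : ℕ)
    (hn : ∀ i ≤ n + 1, b i ≠ ι (a i)) :
    b 0 * (ι (cfDen a (n + 1)) * b (n + 2) + ι (cfDen a n)) =
      ι (cfNum a (n + 1)) * b (n + 2) + ι (cfNum a n) := by
  induction n with
  | zero =>
    have h0 := canonical_mul_succ hb (hn 0 (by omega))
    have h1 := canonical_mul_succ hb (hn 1 (by omega))
    simp only [cfDen, cfNum, zero_add, map_mul, map_one, map_add] at *
    have hb1 : b 1 ≠ 0 := by
      rw [hb 0]; exact inv_ne_zero (sub_ne_zero.2 (hn 0 (by omega)))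
    have key : b 1 * (b 0 * (ι (a 1) * b 2 + 1) - ((ι (a 0) * ι (a 1) + 1) * b 2 + ι (a 0))) = 0 := by
      linear_combination (ι (a 1) * b 2 + 1) * h0 - h1
    rcases mul_eq_zero.1 key with h | h
    · exact absurd h hb1
    · linear_combination h
  | succ n ih =>
    have h1 := ih fun i hi => hn i (by omega)
    have h2 := canonical_mul_succ hb (hn (n + 2) (by omega))
    have hb1 : b (n + 2) ≠ 0 := by
      rw [hb (n + 1)]; exact inv_ne_zero (sub_ne_zero.2 (hn (n + 1) (by omega)))
    rw [show cfDen a (n + 1 + 1) = a (n + 2) * cfDen a (n + 1) + cfDen a n from rfl,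
      show cfNum a (n + 1 + 1) = a (n + 2) * cfNum a (n + 1) + cfNum a n from rfl]
    simp only [map_add, map_mul]
    linear_combination b (n + 3) * h1 - (b 0 * ι (cfDen a (n + 1)) - ι (cfNum a (n + 1))) * h2

theorem cfNum_mul_cfDen_sub (a : ℕ → ℤ[X]) (n : ℕ) :
    cfNum a (n + 1) * cfDen a n - cfNum a n * cfDen a (n + 1) = (-1) ^ n := by
  induction n with
  | zero => simp [cfNum, cfDen]
  | succ n ih =>
    rw [show cfDen a (n + 1 + 1) = a (n + 2) * cfDen a (n + 1) + cfDen a n from rfl,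
      show cfNum a (n + 1 + 1) = a (n + 2) * cfNum a (n + 1) + cfNum a n from rfl, pow_succ]
    linear_combination -ih

/-- Along a run of constant partial quotients the denominators of the remainders decrease, so
some later remainder has constant term `0`. -/
theorem canonical_exists_eq_zero (hb : ∀ n, b (n + 1) = (b n - ι (a n))⁻¹ ∧ 0 ≤ r n ∧
      r n < 1 ∧ DegLE (b n - ι (a n) - HahnSeries.C (r n)) (-1)) (hn : ∀ i, b i ≠ ι (a i)) :
    ∀ d n, (r n).den ≤ d → ∃ m, n ≤ m ∧ r m = 0 := by
  intro d
  induction d with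
  | zero => intro n h; exact absurd h (by have := (r n).den_pos; omega)
  | succ d ih =>
    intro n h
    rcases canonical_partialQuotient hb (hn n) with ⟨h0, -⟩ | ⟨h0, c, -, -, h1⟩
    · exact ⟨n, le_rfl, h0⟩
    · have := den_inv_sub_lt h0 (hb n).2.2.1 c
      rw [← h1] at this
      obtain ⟨m, hm, hm'⟩ := ih (n + 1) (by omega)
      exact ⟨m, by omega, hm'⟩

theorem canonical_natDegree_le (hb : ∀ n, b (n + 1) = (b n - ι (a n))⁻¹ ∧ 0 ≤ r n ∧
      r n < 1 ∧ DegLE (b n - ι (a n) - HahnSeries.C (r n)) (-1)) (hn : ∀ i, b i ≠ ι (a i)) :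
    Monotone fun n => (cfDen a n).natDegree := by
  refine monotone_nat_of_le_succ fun n => ?_
  obtain ⟨h1, h2, h3⟩ := canonical_cfDen hb n fun i _ => hn i
  obtain ⟨m, hm, h4⟩ := h3.exists_degEq
  have := h4.unique ((degEq_toLaurentInv h2).div (degEq_toLaurentInv h1))
  omega

theorem canonical_natDegree_unbounded (hb : ∀ n, b (n + 1) = (b n - ι (a n))⁻¹ ∧ 0 ≤ r n ∧
      r n < 1 ∧ DegLE (b n - ι (a n) - HahnSeries.C (r n)) (-1)) (hn : ∀ i, b i ≠ ι (a i))
      (N : ℕ) : ∃ n, N ≤ (cfDen a n).natDegree := by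
  induction N with
  | zero => exact ⟨0, Nat.zero_le _⟩
  | succ N ih =>
    obtain ⟨n, h⟩ := ih
    obtain ⟨m, hm, h0⟩ := canonical_exists_eq_zero hb hn _ (n + 1) le_rfl
    obtain ⟨m, rfl⟩ : ∃ k, m = k + 1 := ⟨m - 1, by omega⟩
    have h1 := (canonical_natDegree_le hb hn hm).trans' (canonical_natDegree_le hb hn (by omega : n ≤ n + 1))
    simp only at h1
    refine ⟨m + 2, ?_⟩
    rcases canonical_partialQuotient hb (hn (m + 1)) with ⟨-, k, hk, h2⟩ | ⟨h2, -⟩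
    swap
    · exact absurd h0 h2.ne'
    obtain ⟨h3, h4, h5⟩ := canonical_cfDen hb m fun i _ => hn i
    obtain ⟨-, h6, -⟩ := canonical_cfDen hb (m + 1) fun i _ => hn i
    have h7 := h2.add_right h5.inv.degLE (by omega)
    have h3' := toLaurentInv_ne_zero h3
    have h4' := toLaurentInv_ne_zero h4
    have e : ι (a (m + 1 + 1)) + (ι (cfDen a (m + 1)) / ι (cfDen a m))⁻¹ =
        ι (cfDen a (m + 1 + 1)) / ι (cfDen a (m + 1)) := by
      rw [show cfDen a (m + 1 + 1) = a (m + 2) * cfDen a (m + 1) + cfDen a m from rfl, map_add,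
        map_mul]
      field_simp
    rw [e] at h7
    have := h7.unique ((degEq_toLaurentInv h6).div (degEq_toLaurentInv h4))
    rw [show m + 2 = m + 1 + 1 from rfl]
    omega

theorem canonical_degLE (hb : ∀ n, b (n + 1) = (b n - ι (a n))⁻¹ ∧ 0 ≤ r n ∧
      r n < 1 ∧ DegLE (b n - ι (a n) - HahnSeries.C (r n)) (-1)) (hn : ∀ i, b i ≠ ι (a i))
      (n : ℕ) : DegLE (cfConv a (n + 1) - b 0) (-(cfDen a (n + 1)).natDegree) := by
  obtain ⟨h1, h2, h3⟩ := canonical_cfDen hb n fun i _ => hn i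
  obtain ⟨k, hk, h4⟩ := ((canonical_isBig hb (hn (n + 1))).add h3.inv).exists_degEq
  have hv := canonical_value (fun n => (hb n).1) n fun i _ => hn i
  have hd := congrArg toLaurentInv (cfNum_mul_cfDen_sub a n)
  simp only [map_sub, map_mul, map_pow, map_neg, map_one] at hd
  have hq := degEq_toLaurentInv h2
  have h1' := toLaurentInv_ne_zero h1
  have h2' := toLaurentInv_ne_zero h2
  have h0 := h4.ne_zero
  have e : cfConv a (n + 1) - b 0 = (-1) ^ n /
      (ι (cfDen a (n + 1)) * (ι (cfDen a (n + 1)) *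
        (b (n + 1 + 1) + (ι (cfDen a (n + 1)) / ι (cfDen a n))⁻¹))) := by
    rw [eq_div_iff (mul_ne_zero h2' (mul_ne_zero h2' h0)), cfConv]
    field_simp
    linear_combination hd - ι (cfDen a (n + 1)) * hv
  rw [e]
  have h5 : DegEq ((-1 : K) ^ n) 0 := (degEq_one.neg.pow n).cast (by ring)
  exact (h5.div (hq.mul (hq.mul h4))).le (by omega)

end CanonicalSeq

/-- Limits of values of finite continued fractions over `ℤ[x]` are themselves values of finite or
infinite continued fractions over `ℤ[x]`, by the canonical algorithm. -/
theorem hasSpecializableCF_of_mem_closure {α : K} (h : α ∈ closure cfValues) :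
    HasSpecializableCF α := by
  obtain ⟨b, a, r, rfl, hb⟩ := exists_canonical_seq h
  refine ⟨a, ?_⟩
  by_cases hn : ∀ i, b i ≠ ι (a i)
  · right
    refine ⟨Eventually.of_forall fun n => (canonical_cfDen hb n fun i _ => hn i).1, ?_⟩
    rw [← tendsto_add_atTop_iff_nat 1, tendsto_iff_degLE]
    intro N
    obtain ⟨m, hm⟩ := canonical_natDegree_unbounded hb hn (-N).toNat
    filter_upwards [eventually_ge_atTop m] with n hmn
    refine (canonical_degLE hb hn n).mono ?_
    have := canonical_natDegree_le hb hn (show m ≤ n + 1 by omega)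
    simp only at this
    omega
  · left
    push Not at hn
    classical
    have hmin := fun i hi => Nat.find_min hn (m := i) hi
    have hspec := Nat.find_spec hn
    set n := Nat.find hn
    refine ⟨n, ?_⟩
    clear_value n
    match n, hmin, hspec with
    | 0, hmin, hspec =>
      exact ⟨by simp [cfDen], by simp [cfConv, cfNum, cfDen, hspec]⟩
    | 1, hmin, hspec =>
      have h0 := hmin 0 one_pos
      obtain ⟨-, h2, -⟩ := canonical_cfDen hb 0 fun i hi => hmin i (by omega)
      refine ⟨h2, ?_⟩
      have h3 := canonical_mul_succ (fun n => (hb n).1) h0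
      have h2' := toLaurentInv_ne_zero h2
      rw [cfConv, div_eq_iff h2']
      simp only [zero_add, cfDen, cfNum, map_add, map_mul, map_one] at *
      rw [hspec] at h3
      exact h3.symm
    | n + 2, hmin, hspec =>
      obtain ⟨-, h2, -⟩ := canonical_cfDen hb (n + 1) fun i hi => hmin i (by omega)
      refine ⟨h2, ?_⟩
      have h3 := canonical_value (fun n => (hb n).1) n fun i hi => hmin i (by omega)
      have h2' := toLaurentInv_ne_zero h2
      rw [cfConv, div_eq_iff h2']
      rw [hspec] at h3
      rw [show cfDen a (n + 2) = a (n + 2) * cfDen a (n + 1) + cfDen a n from rfl,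
        show cfNum a (n + 2) = a (n + 2) * cfNum a (n + 1) + cfNum a n from rfl]
      simp only [map_add, map_mul]
      linear_combination -h3

/-! ### The series of reciprocals of the iterates -/

theorem polyIterate_succ' (f : ℤ[X]) (n : ℕ) : polyIterate f (n + 1) = f.comp (polyIterate f n) :=
  rfl

theorem natDegree_polyIterate (f : ℤ[X]) (n : ℕ) :
    (polyIterate f n).natDegree = f.natDegree ^ n := by
  induction n with
  | zero => simp [polyIterate]
  | succ n ih => rw [polyIterate_succ', natDegree_comp, ih, pow_succ, mul_comm]

theorem polyIterate_ne_zero {f : ℤ[X]} (hf : 1 < f.natDegree) (n : ℕ) : polyIterate f n ≠ 0 := by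
  intro h
  have := natDegree_polyIterate f n
  rw [h, natDegree_zero] at this
  exact (pow_pos (by omega : 0 < f.natDegree) n).ne this

theorem degEq_polyIterate {f : ℤ[X]} (hf : 1 < f.natDegree) (n : ℕ) :
    DegEq (ι (polyIterate f n)) ((f.natDegree : ℤ) ^ n) := by
  have := degEq_toLaurentInv (polyIterate_ne_zero hf n)
  rw [natDegree_polyIterate] at this
  exact_mod_cast this

theorem summable_inv_polyIterate {f : ℤ[X]} (hf : 1 < f.natDegree) :
    Summable fun n => (ι (polyIterate f n))⁻¹ := by
  refine summable_of_degLE fun n => (degEq_polyIterate hf n).inv.le ?_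
  have := (Nat.lt_pow_self hf : n < f.natDegree ^ n).le
  have : (n : ℤ) ≤ (f.natDegree : ℤ) ^ n := by exact_mod_cast this
  omega

theorem degLE_sub_sum_range {f : ℤ[X]} (hf : 1 < f.natDegree) {α : K}
    (hα : HasSum (fun n => (ι (polyIterate f n))⁻¹) α) (N : ℕ) :
    DegLE (α - ∑ i ∈ Finset.range N, (ι (polyIterate f i))⁻¹) (-(f.natDegree : ℤ) ^ N) := by
  have h1 : ∀ M, DegLE (∑ i ∈ Finset.range (N + M), (ι (polyIterate f i))⁻¹ -
      ∑ i ∈ Finset.range N, (ι (polyIterate f i))⁻¹) (-(f.natDegree : ℤ) ^ N) := by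
    intro M
    induction M with
    | zero => simpa using degLE_zero _
    | succ M ih =>
      rw [← add_assoc, Finset.sum_range_succ, add_sub_right_comm]
      refine ih.add ((degEq_polyIterate hf _).inv.le ?_)
      have : (f.natDegree : ℤ) ^ N ≤ (f.natDegree : ℤ) ^ (N + M) :=
        pow_le_pow_right₀ (by omega) (by omega)
      omega
  obtain ⟨M, hM, hM'⟩ := ((tendsto_iff_degLE.1 hα.tendsto_sum_nat
    (-(f.natDegree : ℤ) ^ N)).and (eventually_ge_atTop N)).exists
  obtain ⟨k, rfl⟩ := Nat.exists_eq_add_of_le hM'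
  have := (h1 k).sub hM
  simpa using this

/-- If all partial sums are values of finite continued fractions over `ℤ[x]`, their limit
belongs to the closure of the set of these values. -/
theorem mem_closure_of_uni {f : ℤ[X]} {α : K}
    (hα : HasSum (fun n => (ι (polyIterate f n))⁻¹) α)
    (h : ∀ n, ∃ p q, Uni p q ∧ q ≠ 0 ∧
      ∑ i ∈ Finset.range n, (ι (polyIterate f i))⁻¹ = ι p / ι q) :
    α ∈ closure cfValues :=
  mem_closure_of_tendsto hα.tendsto_sum_nat (Eventually.of_forall h)

/-! ### The symmetry `x ↦ -x` -/

/-- The polynomial `-f(-x)`, conjugate to `f` under `x ↦ -x`. -/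
noncomputable def negConj (f : ℤ[X]) : ℤ[X] := -f.comp (-X)

theorem negConj_negConj (f : ℤ[X]) : negConj (negConj f) = f := by
  simp [negConj, comp_assoc]

theorem natDegree_comp_neg_X (p : ℤ[X]) : (p.comp (-X)).natDegree = p.natDegree := by
  rw [natDegree_comp, natDegree_neg, natDegree_X, mul_one]

theorem natDegree_negConj (f : ℤ[X]) : (negConj f).natDegree = f.natDegree := by
  rw [negConj, natDegree_neg, natDegree_comp_neg_X]

theorem polyIterate_negConj (f : ℤ[X]) (n : ℕ) :
    polyIterate (negConj f) n = negConj (polyIterate f n) := by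
  induction n with
  | zero => simp [polyIterate, negConj]
  | succ n ih =>
    rw [polyIterate_succ', ih, polyIterate_succ']
    simp [negConj, comp_assoc]

theorem comp_neg_X_ne_zero {p : ℤ[X]} (hp : p ≠ 0) : p.comp (-X) ≠ 0 := by
  intro h
  apply hp
  have := congrArg (fun r => r.comp (-X)) h
  simpa [comp_assoc] using this

theorem DegLE.comp_neg_X {p : ℤ[X]} {n : ℤ} (h : DegLE (ι p) n) : DegLE (ι (p.comp (-X))) n := by
  by_cases hp : p = 0
  · subst hp; simpa using h
  · exact degLE_toLaurentInv (by
      rw [natDegree_comp_neg_X]; exact (degEq_toLaurentInv hp).le_of_degLE h)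

/-- Degrees of differences of fractions are invariant under `x ↦ -x`. -/
theorem DegLE.div_sub_div_comp_neg_X {p q r s : ℤ[X]} {n : ℤ} (hq : q ≠ 0) (hs : s ≠ 0)
    (h : DegLE (ι p / ι q - ι r / ι s) n) :
    DegLE (ι (p.comp (-X)) / ι (q.comp (-X)) - ι (r.comp (-X)) / ι (s.comp (-X))) n := by
  have key : ∀ {p q r s : ℤ[X]}, q ≠ 0 → s ≠ 0 →
      ι p / ι q - ι r / ι s = ι (p * s - q * r) / ι (q * s) := by
    intro p q r s hq hs
    have := toLaurentInv_ne_zero hq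
    have := toLaurentInv_ne_zero hs
    simp only [map_sub, map_mul]
    field_simp
  have hq' := comp_neg_X_ne_zero hq
  have hs' := comp_neg_X_ne_zero hs
  have hqs := mul_ne_zero hq hs
  rw [key hq hs] at h
  rw [key hq' hs', ← mul_comp, ← mul_comp, ← mul_comp, ← sub_comp]
  have hD := degEq_toLaurentInv hqs
  have h1 := h.mul (hD.le le_rfl)
  rw [div_mul_cancel₀ _ (toLaurentInv_ne_zero hqs)] at h1
  have hD' := degEq_toLaurentInv (comp_neg_X_ne_zero hqs)
  rw [natDegree_comp_neg_X] at hD'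
  exact (h1.comp_neg_X.div hD').mono (by omega)

theorem exists_sum_range_eq {f : ℤ[X]} (hf : 1 < f.natDegree) (N : ℕ) :
    ∃ P Q : ℤ[X], Q ≠ 0 ∧ ∑ i ∈ Finset.range N, (ι (polyIterate f i))⁻¹ = ι P / ι Q ∧
      ∑ i ∈ Finset.range N, (ι (polyIterate (negConj f) i))⁻¹ =
        -(ι (P.comp (-X)) / ι (Q.comp (-X))) := by
  induction N with
  | zero => exact ⟨0, 1, one_ne_zero, by simp, by simp⟩
  | succ N ih =>
    obtain ⟨P, Q, hQ, h1, h2⟩ := ih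
    have hF := polyIterate_ne_zero hf N
    refine ⟨P * polyIterate f N + Q, Q * polyIterate f N, mul_ne_zero hQ hF, ?_, ?_⟩
    · rw [Finset.sum_range_succ, h1]
      have := toLaurentInv_ne_zero hQ
      have := toLaurentInv_ne_zero hF
      simp only [map_add, map_mul]
      field_simp
    · rw [Finset.sum_range_succ, h2, polyIterate_negConj, negConj]
      have := toLaurentInv_ne_zero (comp_neg_X_ne_zero hQ)
      have := toLaurentInv_ne_zero (comp_neg_X_ne_zero hF)
      simp only [mul_comp, add_comp, map_add, map_mul, map_neg]
      field_simp
      ring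

theorem mem_closure_negConj {f : ℤ[X]} (hf : 1 < f.natDegree) {α β : K}
    (hα : HasSum (fun n => (ι (polyIterate f n))⁻¹) α)
    (hβ : HasSum (fun n => (ι (polyIterate (negConj f) n))⁻¹) β)
    (h : α ∈ closure cfValues) : β ∈ closure cfValues := by
  rw [mem_closure_iff_degLE] at h ⊢
  intro n
  obtain ⟨γ, ⟨p, q, hU, hq, rfl⟩, hγ⟩ := h n
  have hf' : 1 < (negConj f).natDegree := by rwa [natDegree_negConj]
  have hN : -(f.natDegree : ℤ) ^ (-n).toNat ≤ n := by
    have := (Nat.lt_pow_self hf : (-n).toNat < f.natDegree ^ (-n).toNat).le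
    have : ((-n).toNat : ℤ) ≤ (f.natDegree : ℤ) ^ (-n).toNat := by exact_mod_cast this
    omega
  set N := (-n).toNat
  obtain ⟨P, Q, hQ, h1, h2⟩ := exists_sum_range_eq hf N
  have e1 := (degLE_sub_sum_range hf hα N).mono hN
  have e2 := (degLE_sub_sum_range hf' hβ N)
  rw [natDegree_negConj] at e2
  replace e2 := e2.mono hN
  rw [h1] at e1
  rw [h2] at e2
  refine ⟨ι (-p.comp (-X)) / ι (q.comp (-X)),
    ⟨_, _, (hU.comp _).neg_left, comp_neg_X_ne_zero hq, rfl⟩, ?_⟩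
  have e3 := hγ.add e1
  rw [sub_add_sub_cancel] at e3
  have e4 := (e3.div_sub_div_comp_neg_X hq hQ).neg.sub e2
  convert e4 using 1
  rw [map_neg]
  ring

/-! ### Sufficiency: folding patterns along the partial sums -/

theorem polyIterate_succ_of_eq {f g : ℤ[X]} (h : f = g) (n : ℕ) :
    polyIterate f (n + 1) = g.comp (polyIterate f n) := by
  rw [polyIterate_succ', h]

theorem sum_range_succ_eq {f : ℤ[X]} (hf : 1 < f.natDegree) {n : ℕ} {p q p' q' : ℤ[X]}
    (h : ∑ i ∈ Finset.range n, (ι (polyIterate f i))⁻¹ = ι p / ι q) (hq : q ≠ 0) (hq' : q' ≠ 0)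
    (hp' : p' * (q * polyIterate f n) = q' * (p * polyIterate f n + q)) :
    ∑ i ∈ Finset.range (n + 1), (ι (polyIterate f i))⁻¹ = ι p' / ι q' := by
  have h1 := toLaurentInv_ne_zero hq
  have h2 := toLaurentInv_ne_zero hq'
  have h3 := toLaurentInv_ne_zero (polyIterate_ne_zero hf n)
  have h4 := congrArg toLaurentInv hp'
  simp only [map_mul, map_add] at h4
  rw [Finset.sum_range_succ, h]
  field_simp
  linear_combination -h4

/-- Adding `1 / F` to `p / q`: the tail relative to `p / q` has the denominator `q ^ 2`. -/
theorem Uni.prod_step {p q s t F : ℤ[X]} (h : Uni p q) (hst : p * s - q * t = 1)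
    (hF : Uni (F + s * q) (q ^ 2)) : Uni (p * F + q) (q * F) := by
  rw [h.tail_iff hst]
  have e1 : s * (p * F + q) - t * (q * F) = F + s * q := by linear_combination F * hst
  have e2 : p * (q * F) - q * (p * F + q) = -q ^ 2 := by ring
  rw [e1, e2]
  exact hF.neg_right

/-- If `x² ∣ f`, then `fⁿ` is divisible by the square of the denominator of the partial sum, and
each step is a folding. -/
theorem uni_sum_of_sq_dvd {f m : ℤ[X]} (hf : 1 < f.natDegree) (hm : f = X ^ 2 * m) (n : ℕ) :
    ∃ p q h, Uni p q ∧ q ≠ 0 ∧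
      ∑ i ∈ Finset.range n, (ι (polyIterate f i))⁻¹ = ι p / ι q ∧
      polyIterate f n = h * q ^ 2 := by
  induction n with
  | zero => exact ⟨0, 1, X, Uni.zero_one, one_ne_zero, by simp, by simp [polyIterate]⟩
  | succ n ih =>
    obtain ⟨p, q, h, hU, hq, hs, hF⟩ := ih
    have hF0 := polyIterate_ne_zero hf n
    refine ⟨1 + h * p * q, h * q ^ 2, m.comp (polyIterate f n), hU.fold h, hF ▸ hF0,
      sum_range_succ_eq hf hs hq (hF ▸ hF0) (by rw [hF]; ring), ?_⟩
    rw [polyIterate_succ_of_eq hm, ← hF]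
    simp only [mul_comp, pow_comp, X_comp]
    ring

/-- If `f ≡ -x (mod x²)`, the partial sums are consecutive convergents of one continued
fraction. -/
theorem uni_sum_of_neg_X {f m : ℤ[X]} (hf : 1 < f.natDegree) (hm : f = -X + X ^ 2 * m) (n : ℕ) :
    ∃ p q p' q', Uni p q ∧ q ≠ 0 ∧
      ∑ i ∈ Finset.range n, (ι (polyIterate f i))⁻¹ = ι p / ι q ∧
      Uni p' q' ∧ p' * q - q' * p = 1 ∧ polyIterate f n = q * q' := by
  induction n with
  | zero =>
    exact ⟨0, 1, 1, X, Uni.zero_one, one_ne_zero, by simp, Uni.one_left _, by ring,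
      by simp [polyIterate]⟩
  | succ n ih =>
    obtain ⟨p, q, p', q', hU, hq, hs, hU', hd, hF⟩ := ih
    have hF0 := polyIterate_ne_zero hf n
    have hq' : q' ≠ 0 := by
      rintro rfl
      exact hF0 (by rw [hF, mul_zero])
    set c := q ^ 2 * m.comp (polyIterate f n) with hc
    refine ⟨p', q', p' * c + p * (-1), q' * c + q * (-1), hU', hq',
      sum_range_succ_eq hf hs hq hq' (by rw [hF]; linear_combination q * q' * hd),
      (hU'.mul_iff hd).1 (Uni.one_right c).neg_right, by linear_combination hd, ?_⟩
    rw [polyIterate_succ_of_eq hm]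
    simp only [mul_comp, pow_comp, X_comp, add_comp, neg_comp]
    rw [hc]
    generalize m.comp (polyIterate f n) = M
    rw [hF]
    ring

/-- If `f ≡ 1 (mod x² (x - 1))`, then `fⁿ ≡ 1` modulo the square of `q = x f ⋯ fⁿ⁻¹`, and each
step folds the reversed continued fraction with the unit `1`. -/
theorem uni_sum_of_one {f m : ℤ[X]} (hf : 1 < f.natDegree) (hm : f = 1 + X ^ 2 * (X - 1) * m)
    (n : ℕ) : ∃ p q h, Uni p q ∧ q ≠ 0 ∧
      ∑ i ∈ Finset.range n, (ι (polyIterate f i))⁻¹ = ι p / ι q ∧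
      polyIterate f n = 1 + q ^ 2 * h := by
  induction n with
  | zero =>
    exact ⟨0, 1, X - 1, Uni.zero_one, one_ne_zero, by simp, by simp [polyIterate]⟩
  | succ n ih =>
    obtain ⟨p, q, h, hU, hq, hs, hF⟩ := ih
    have hF0 := polyIterate_ne_zero hf n
    obtain ⟨s, t, hst⟩ := hU.exists_inverse
    refine ⟨p * polyIterate f n + q, q * polyIterate f n, h * m.comp (polyIterate f n),
      hU.prod_step hst ?_, mul_ne_zero hq hF0,
      sum_range_succ_eq hf hs hq (mul_ne_zero hq hF0) (by ring), ?_⟩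
    · have := ((hU.reverse hst).fold 1).add_mul h
      rw [hF]
      convert this using 1 <;> ring
    · rw [polyIterate_succ_of_eq hm]
      simp only [mul_comp, pow_comp, X_comp, add_comp, sub_comp, one_comp]
      linear_combination (polyIterate f n) ^ 2 * m.comp (polyIterate f n) * hF

/-- If `f ≡ -x³ + 3x² - 2x + 1 (mod x² (x - 1)²)`, then `fⁿ ≡ 1 - 2 s q (mod q²)` with `s`
inverse to the numerator `p` modulo the denominator `q` of the partial sum. -/
theorem uni_sum_of_two_mul_reverse {f m : ℤ[X]} (hf : 1 < f.natDegree)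
    (hm : f = -X ^ 3 + 3 * X ^ 2 - 2 * X + 1 + X ^ 2 * (X - 1) ^ 2 * m)
    (n : ℕ) : ∃ p q e r, Uni p q ∧ q ≠ 0 ∧
      ∑ i ∈ Finset.range n, (ι (polyIterate f i))⁻¹ = ι p / ι q ∧
      polyIterate f n = 1 + q * e ∧ e * p + 2 = q * r := by
  induction n with
  | zero =>
    exact ⟨0, 1, X - 1, 2, Uni.zero_one, one_ne_zero, by simp, by simp [polyIterate], by ring⟩
  | succ n ih =>
    obtain ⟨p, q, e, r, hU, hq, hs, hF, hr⟩ := ih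
    have hF0 := polyIterate_ne_zero hf n
    obtain ⟨s, t, hst⟩ := hU.exists_inverse
    refine ⟨p * polyIterate f n + q, q * polyIterate f n,
      -e * (polyIterate f n - 2) +
        q * polyIterate f n * (e ^ 2 * m.comp (polyIterate f n)),
      -r * (polyIterate f n - 2) + 1 * e +
        e ^ 2 * m.comp (polyIterate f n) * (p * polyIterate f n + q),
      hU.prod_step hst ?_, mul_ne_zero hq hF0,
      sum_range_succ_eq hf hs hq (mul_ne_zero hq hF0) (by ring), ?_, ?_⟩
    · have := ((hU.reverse hst).fold (-1)).neg_right.add_mul (r * s - e * t)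
      rw [hF]
      convert this using 1
      · linear_combination (-e * q) * hst + s * q * hr
      · ring
    · rw [polyIterate_succ_of_eq hm]
      simp only [mul_comp, pow_comp, X_comp, add_comp, sub_comp, one_comp, neg_comp, ofNat_comp]
      generalize m.comp (polyIterate f n) = M
      rw [hF]
      ring
    · generalize m.comp (polyIterate f n) = M
      rw [hF]
      linear_combination (1 + q * e) * (1 - q * e) * hr

/-- If `f ≡ x² - x + 1 (mod x² (x - 1)²)`, then `fⁿ ≡ 1 - s q (mod q²)` with `s` inverse to the
numerator `p` modulo the denominator `q` of the partial sum. -/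
theorem uni_sum_of_reverse {f m : ℤ[X]} (hf : 1 < f.natDegree)
    (hm : f = X ^ 2 - X + 1 + X ^ 2 * (X - 1) ^ 2 * m)
    (n : ℕ) : ∃ p q e r, Uni p q ∧ q ≠ 0 ∧
      ∑ i ∈ Finset.range n, (ι (polyIterate f i))⁻¹ = ι p / ι q ∧
      polyIterate f n = 1 + q * e ∧ e * p + 1 = q * r := by
  induction n with
  | zero =>
    exact ⟨0, 1, X - 1, 1, Uni.zero_one, one_ne_zero, by simp, by simp [polyIterate], by ring⟩
  | succ n ih =>
    obtain ⟨p, q, e, r, hU, hq, hs, hF, hr⟩ := ih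
    have hF0 := polyIterate_ne_zero hf n
    obtain ⟨s, t, hst⟩ := hU.exists_inverse
    refine ⟨p * polyIterate f n + q, q * polyIterate f n,
      e + q * polyIterate f n * (e ^ 2 * m.comp (polyIterate f n)),
      r + e ^ 2 * m.comp (polyIterate f n) * (p * polyIterate f n + q),
      hU.prod_step hst ?_, mul_ne_zero hq hF0,
      sum_range_succ_eq hf hs hq (mul_ne_zero hq hF0) (by ring), ?_, ?_⟩
    · have := (Uni.one_left (q ^ 2)).add_mul (r * s - e * t)
      rw [hF]
      convert this using 1
      linear_combination (-e * q) * hst + s * q * hr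
    · rw [polyIterate_succ_of_eq hm]
      simp only [mul_comp, pow_comp, X_comp, add_comp, sub_comp, one_comp]
      generalize m.comp (polyIterate f n) = M
      rw [hF]
      ring
    · generalize m.comp (polyIterate f n) = M
      rw [hF]
      linear_combination (1 + q * e) * hr

/-- If `f ≡ -x³ + 2x² - x + 1 (mod x² (x - 1)²)`, the step from one partial sum to the next
folds the reversed continued fraction of the preceding partial sum with the centre `(fⁿ⁻¹)²`. -/
theorem uni_sum_of_prev_reverse {f m : ℤ[X]} (hf : 1 < f.natDegree)
    (hm : f = -X ^ 3 + 2 * X ^ 2 - X + 1 + X ^ 2 * (X - 1) ^ 2 * m)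
    (n : ℕ) : ∃ p q e s t, Uni p q ∧ q ≠ 0 ∧
      ∑ i ∈ Finset.range n, (ι (polyIterate f i))⁻¹ = ι p / ι q ∧
      polyIterate f n = 1 + q * e ∧ p * s - q * t = 1 ∧
      Uni (polyIterate f n + s * q) (q ^ 2) := by
  induction n with
  | zero =>
    exact ⟨0, 1, X - 1, 0, -1, Uni.zero_one, one_ne_zero, by simp, by simp [polyIterate], by ring,
      by simpa using Uni.one_right _⟩
  | succ n ih =>
    obtain ⟨p, q, e, s, t, hU, hq, hs, hF, hst, hn⟩ := ih
    have hF0 := polyIterate_ne_zero hf n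
    have hsucc : polyIterate f (n + 1) = 1 - q ^ 2 * e ^ 2 * polyIterate f n +
        (polyIterate f n) ^ 2 * (q ^ 2 * e ^ 2) * m.comp (polyIterate f n) := by
      rw [polyIterate_succ_of_eq hm]
      simp only [mul_comp, pow_comp, X_comp, add_comp, sub_comp, one_comp, neg_comp, ofNat_comp]
      generalize m.comp (polyIterate f n) = M
      rw [hF]
      ring
    refine ⟨p * polyIterate f n + q, q * polyIterate f n,
      -q * e ^ 2 + polyIterate f n * q * e ^ 2 * m.comp (polyIterate f n),
      s * polyIterate f n + q * e ^ 2,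
      2 * e + t * polyIterate f n + p * e ^ 2 + s,
      hU.prod_step hst hn, mul_ne_zero hq hF0,
      sum_range_succ_eq hf hs hq (mul_ne_zero hq hF0) (by ring), ?_, ?_, ?_⟩
    · rw [hsucc]; ring
    · rw [hF]
      linear_combination (1 + q * e) ^ 2 * hst
    · rw [hsucc]
      have := ((hU.reverse hst).fold ((polyIterate f n) ^ 2)).add_mul
        (e ^ 2 * m.comp (polyIterate f n))
      convert this using 1 <;> ring

/-! ### Sufficiency when `0 ↦ 1 ↦ 0` -/

/-- The data attached to `f = (x - 1)² (1 + ε x + x² m)`: the sequence `1, 1, x, f, f², …` of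
iterates, together with the quotients `u n` of `F (n + 1) - 1` by `F n` and `h n` of
`F (n + 2)` by `(F n)²`, and the numerators `p n` of the partial sums over the denominators
`F n * F (n + 1)`. -/
structure TwoStep (ε : ℤ[X]) where
  F : ℕ → ℤ[X]
  u : ℕ → ℤ[X]
  h : ℕ → ℤ[X]
  m : ℕ → ℤ[X]
  p : ℕ → ℤ[X]
  F_zero : F 0 = 1
  F_one : F 1 = 1
  F_two : F 2 = X
  u_one : u 1 = X - 1
  p_zero : p 0 = 0
  F_succ : ∀ n, F (n + 1) = 1 + F n * u n
  F_add_two : ∀ n, F (n + 2) = F n ^ 2 * h n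
  h_succ : ∀ n, h (n + 1) = u (n + 1) ^ 2 * (1 + ε * F (n + 2) + F (n + 2) ^ 2 * m (n + 2))
  u_add_two : ∀ n, u (n + 2) =
    F (n + 2) - 2 + ε * (F (n + 2) - 1) ^ 2 + F (n + 2) * m (n + 2) * (F (n + 2) - 1) ^ 2
  p_succ : ∀ n, p (n + 1) = p n * F n * h n + F (n + 1)

namespace TwoStep

variable {ε : ℤ[X]} (D : TwoStep ε)

/-- The inverse of `p (n + 1)` modulo `F (n + 1) * F (n + 2)`. -/
noncomputable def s (n : ℕ) : ℤ[X] := ε * D.F (n + 2) - D.u (n + 1) - D.F n * D.h n * D.p n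

theorem p_one : D.p 1 = 1 := by
  rw [D.p_succ, D.p_zero, D.F_one]; ring

theorem uni_zero : Uni (D.p 0) (D.F 0 * D.F 1) := by
  rw [D.p_zero, D.F_zero, D.F_one, mul_one]
  exact Uni.zero_one

theorem uni_one : Uni (D.p 1) (D.F 1 * D.F 2) := by
  rw [D.p_one, D.F_one, D.F_two, one_mul]
  exact Uni.one_left _

/-- Reduction of a partial sum with respect to the preceding one. -/
theorem uni_succ_iff {n : ℕ} {s t : ℤ[X]} (hU : Uni (D.p n) (D.F n * D.F (n + 1)))
    (hst : D.p n * s - D.F n * D.F (n + 1) * t = 1)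
    (hV : Uni (D.h n * D.F n + s * D.F (n + 1)) (D.F n * D.F (n + 1) ^ 2)) :
    Uni (D.p (n + 1)) (D.F (n + 1) * D.F (n + 2)) := by
  rw [hU.tail_iff hst]
  have e1 : s * D.p (n + 1) - t * (D.F (n + 1) * D.F (n + 2)) =
      D.h n * D.F n + s * D.F (n + 1) := by
    rw [D.p_succ, D.F_add_two]
    linear_combination D.F n * D.h n * hst
  have e2 : D.p n * (D.F (n + 1) * D.F (n + 2)) - D.F n * D.F (n + 1) * D.p (n + 1) =
      -(D.F n * D.F (n + 1) ^ 2) := by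
    rw [D.p_succ, D.F_add_two]; ring
  rw [e1, e2]
  exact hV.neg_right

end TwoStep

/-! #### The case `ε = 0` -/

namespace TwoStep

variable (D : TwoStep 0)

theorem exists_inverse_zero (n : ℕ) :
    ∃ t, D.p (n + 1) * D.s n - D.F (n + 1) * D.F (n + 2) * t = 1 := by
  cases n with
  | zero =>
    refine ⟨-1, ?_⟩
    simp only [s, zero_add, D.p_one, D.p_zero, D.F_one, D.F_two, D.u_one]
    ring
  | succ k =>
    have h1 := D.F_succ (k + 1)
    have h2 := D.F_add_two k
    have h3 := D.h_succ k
    have h4 := D.u_add_two k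
    have h5 := D.p_succ (k + 1)
    have h6 := D.p_succ k
    have h7 := D.F_succ (k + 2)
    simp only [s]
    simp only [show k + 1 + 1 = k + 2 from rfl, show k + 1 + 2 = k + 3 from rfl] at *
    refine ⟨-D.F (k + 2) - 2 * (D.p k * D.F k * D.h k) * D.u (k + 1) -
      D.p k ^ 2 * D.h k * D.u (k + 1) ^ 2 -
      D.p (k + 1) ^ 2 * D.u (k + 1) ^ 2 * D.F (k + 2) * D.m (k + 2) -
      D.p (k + 1) * D.u (k + 1) * D.m (k + 2) * (D.F (k + 2) - 1), ?_⟩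
    rw [h5, h6, h7, h3, h4]
    clear h3 h4 h5 h6 h7
    generalize D.F (k + 2) = l at *
    generalize D.p k = p2 at *
    generalize D.F k = l2 at *
    generalize D.h k = g2 at *
    generalize D.m (k + 2) = m at *
    generalize D.F (k + 1) = l1 at *
    generalize D.u (k + 1) = u1 at *
    subst h1
    linear_combination ((l1 * u1) ^ 2 * (1 + (1 + l1 * u1) ^ 2 * m)) * p2 ^ 2 * g2 * u1 ^ 2 * h2

/-- The column of `S (n - 1) + u n / (F n * F (n + 1) ^ 2)`, where `S (n - 1)` is the partial sum
with numerator `p (n - 1)`, for the index `n + 1` in place of `n`. -/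
def UniV (n : ℕ) : Prop :=
  Uni (D.u (n + 1) + D.F n * D.h n * D.p n * D.F (n + 2)) (D.F (n + 1) * D.F (n + 2) ^ 2)

theorem uni_succ_of_uniV {n : ℕ} (hU : Uni (D.p (n + 1)) (D.F (n + 1) * D.F (n + 2)))
    (hV : D.UniV n) : Uni (D.p (n + 2)) (D.F (n + 2) * D.F (n + 3)) := by
  obtain ⟨t, ht⟩ := D.exists_inverse_zero n
  refine D.uni_succ_iff hU ht ?_
  have := hV.neg_left.add_mul (D.u (n + 1) ^ 2 * D.m (n + 2))
  convert this using 1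
  have h1 := D.F_succ (n + 1)
  have h2 := D.h_succ n
  simp only [s, show n + 1 + 1 = n + 2 from rfl] at *
  rw [h2]
  linear_combination -D.u (n + 1) * h1

theorem uniV_zero : D.UniV 0 := by
  have := (Uni.one_right (X - 1)).add_mul' (X + 1)
  simp only [UniV, zero_add, D.p_zero, D.F_one, D.F_two, D.u_one]
  convert this using 1 <;> ring

/-- The passage from `UniV n` to `UniV (n + 1)`: five changes of base, with respect to the partial
sums with numerators `p n` and `p (n + 1)`. -/
theorem uniV_succ {n : ℕ} (hU0 : Uni (D.p n) (D.F n * D.F (n + 1)))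
    (hU1 : Uni (D.p (n + 1)) (D.F (n + 1) * D.F (n + 2))) (hV : D.UniV n) : D.UniV (n + 1) := by
  obtain ⟨t1, ht1⟩ := D.exists_inverse_zero n
  obtain ⟨s2, t2, ht2⟩ := hU0.exists_inverse
  have h1 := D.F_succ (n + 1)
  have h2 := D.F_add_two n
  have h2' := D.F_add_two (n + 1)
  have h3 := D.h_succ n
  have h4 := D.u_add_two n
  have h7 := D.F_succ (n + 2)
  simp only [UniV, s, show n + 1 + 1 = n + 2 from rfl, show n + 1 + 2 = n + 3 from rfl] at *
  generalize D.p n = p2 at *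
  generalize D.F n = l2 at *
  generalize D.h n = g2 at *
  generalize D.m (n + 2) = m at *
  generalize D.F (n + 1) = l1 at *
  generalize D.u (n + 1) = u1 at *
  generalize D.F (n + 2) = l at *
  generalize D.F (n + 3) = a at *
  generalize D.u (n + 2) = u at *
  generalize D.h (n + 1) = g1 at *
  generalize D.p (n + 1) = p1 at *
  -- the tail of `V n` with respect to the older partial sum, simplified by `l ≡ 1 (mod l1)`
  have hinner : Uni (l2 * g2 + s2 * u1) (l2 * l1 * u1) := by
    have := (((hU0.tail_iff ht2 _ _).1 hV).neg_right).add_mul (-g2)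
    convert this using 1
    · linear_combination (-l2 * g2 * l) * ht2 - l2 * g2 * h1 + (t2 * l1 * l - g2 * p2 * l1 * l) * h2
    · linear_combination l1 * p2 * l * h2
  have hflip : Uni (p2 * l2 * g2 + u1) (l * l1) := by
    rw [hU0.tail_iff ht2]
    convert hinner.neg_right using 1
    · linear_combination l2 * g2 * ht2 - t2 * l1 * h2
    · linear_combination l1 * p2 * h2
  obtain ⟨w, hw⟩ : ∃ w, w = u1 * (1 + l * m * (l - 1)) := ⟨_, rfl⟩
  have hw1 : l1 * w = 1 + u := by
    rw [hw, h4]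
    linear_combination (-(1 + l * m * (l - 1))) * h1
  have hshift : Uni (p2 * l2 * g2 + w) (l * l1) := by
    convert hflip.add_mul (u1 ^ 2 * m) using 1
    rw [hw]
    linear_combination u1 * l * m * h1
  have hdual : Uni (l2 * g2 + s2 * w) (l2 * l1 * w) := by
    have hd : s2 * p2 - l2 * l1 * t2 = 1 := by linear_combination ht2
    rw [(hU0.reverse ht2).tail_iff hd]
    convert hshift.neg_right using 1
    · linear_combination w * ht2
    · linear_combination l1 * h2
  have hswap : Uni (u * l2 * g2 * p2 - w) (l * l1 * u) := by
    rw [hU0.tail_iff ht2]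
    convert hdual.neg_left.add_mul g2 using 1
    · linear_combination u * l2 * g2 * ht2 - t2 * l1 * u * h2 - l2 * g2 * hw1
    · linear_combination p2 * l1 * u * h2
  rw [hU1.tail_iff ht1]
  convert (hswap.neg_left.add_mul g1).neg_right using 1
  · rw [hw]
    linear_combination (l1 * g1 * a) * ht1 - t1 * l * a * h2' + l1 * g1 * h7 + l1 * h3 - u1 * h4 -
      u1 * (1 + l ^ 2 * m) * h1
  · linear_combination p1 * l * a * h2'

theorem uni_all_zero (n : ℕ) : Uni (D.p n) (D.F n * D.F (n + 1)) := by
  have key : ∀ k, Uni (D.p k) (D.F k * D.F (k + 1)) ∧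
      Uni (D.p (k + 1)) (D.F (k + 1) * D.F (k + 2)) ∧ D.UniV k := by
    intro k
    induction k with
    | zero => exact ⟨D.uni_zero, D.uni_one, D.uniV_zero⟩
    | succ k ih =>
      obtain ⟨h0, h1, hV⟩ := ih
      exact ⟨h1, D.uni_succ_of_uniV h1 hV, D.uniV_succ h0 h1 hV⟩
  exact (key n).1

end TwoStep

/-! #### The case `ε = 1` -/

namespace TwoStep

variable (D : TwoStep 1)

theorem exists_inverse_one (n : ℕ) :
    ∃ t, D.p (n + 1) * D.s n - D.F (n + 1) * D.F (n + 2) * t = 1 := by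
  cases n with
  | zero =>
    refine ⟨0, ?_⟩
    simp only [s, zero_add, D.p_one, D.p_zero, D.F_two, D.u_one]
    ring
  | succ k =>
    have h1 := D.F_succ (k + 1)
    have h2 := D.F_add_two k
    have h3 := D.h_succ k
    have h4 := D.u_add_two k
    have h5 := D.p_succ (k + 1)
    have h6 := D.p_succ k
    have h7 := D.F_succ (k + 2)
    simp only [s]
    simp only [show k + 1 + 1 = k + 2 from rfl, show k + 1 + 2 = k + 3 from rfl] at *
    refine ⟨-D.F (k + 2) - 2 * (D.p k * D.F k * D.h k) * D.u (k + 1) -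
      D.p k ^ 2 * D.h k * D.u (k + 1) ^ 2 + 1 +
      D.p (k + 1) * D.u (k + 1) * D.F (k + 2) * (1 + D.m (k + 2) * (D.F (k + 2) - 1)) -
      D.p (k + 1) ^ 2 * D.u (k + 1) ^ 2 * (1 + D.F (k + 2) * D.m (k + 2)) -
      D.p (k + 1) * D.u (k + 1) * (1 + D.m (k + 2) * (D.F (k + 2) - 1)), ?_⟩
    rw [h5, h6, h7, h3, h4]
    clear h3 h4 h5 h6 h7
    generalize D.F (k + 2) = l at *
    generalize D.p k = p2 at *
    generalize D.F k = l2 at *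
    generalize D.h k = g2 at *
    generalize D.m (k + 2) = m at *
    generalize D.F (k + 1) = l1 at *
    generalize D.u (k + 1) = u1 at *
    subst h1
    linear_combination ((l1 * u1) ^ 2 * (1 + (1 + l1 * u1) + (1 + l1 * u1) ^ 2 * m)) * p2 ^ 2 *
      g2 * u1 ^ 2 * h2

theorem exists_u_add_one (n : ℕ) : ∃ g, D.u (n + 1) + 1 = D.F (n + 1) * D.F n * g := by
  cases n with
  | zero => exact ⟨X, by simp only [zero_add, D.u_one, D.F_one, D.F_zero]; ring⟩
  | succ n =>
    refine ⟨D.u (n + 1) * (1 + D.m (n + 2) * (D.F (n + 2) - 1)), ?_⟩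
    have h1 := D.F_succ (n + 1)
    have h4 := D.u_add_two n
    simp only [show n + 1 + 1 = n + 2 from rfl] at *
    rw [h4]
    linear_combination D.F (n + 2) * (1 + D.m (n + 2) * (D.F (n + 2) - 1)) * h1

/-- The column of `S (n - 1) + u n * (F (n + 1) + 1) / (F n * F (n + 1) ^ 2)`, for the index
`n + 1` in place of `n`. -/
def UniY (n : ℕ) : Prop :=
  Uni (D.p n * D.F (n + 2) * D.F n * D.h n + D.u (n + 1) * (D.F (n + 2) + 1))
    (D.F (n + 1) * D.F (n + 2) ^ 2)

/-- The column of `S (n - 1) + 1 / F n ^ 2`, for the index `n + 1` in place of `n`. -/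
def UniW (n : ℕ) : Prop :=
  Uni (D.p n * D.F (n + 1) + D.F n) (D.F (n + 1) ^ 2 * D.F n)

theorem uniY_zero : D.UniY 0 := by
  have h2 : Uni (-1 : ℤ[X]) (X ^ 2) := (Uni.one_left (X ^ 2)).neg_left
  simp only [UniY, zero_add, D.p_zero, D.F_one, D.F_two, D.u_one]
  convert h2.add_mul 1 using 1 <;> ring

theorem uniW_one : D.UniW 1 := by
  simp only [UniW, D.p_one, D.F_one, D.F_two, show 1 + 1 = 2 from rfl]
  have h3 : Uni (X + 1 : ℤ[X]) 1 := Uni.one_right _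
  convert h3.add_mul' (X - 1) using 1 <;> ring

theorem uni_succ_of_uniY {n : ℕ} (hU : Uni (D.p (n + 1)) (D.F (n + 1) * D.F (n + 2)))
    (hY : D.UniY n) : Uni (D.p (n + 2)) (D.F (n + 2) * D.F (n + 3)) := by
  obtain ⟨t, ht⟩ := D.exists_inverse_one n
  obtain ⟨g, hg⟩ := D.exists_u_add_one n
  refine D.uni_succ_iff hU ht ?_
  convert hY.neg_left.add_mul (D.F n * g + D.u (n + 1) ^ 2 * D.m (n + 2)) using 1
  have h1 := D.F_succ (n + 1)
  have h2 := D.h_succ n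
  simp only [s, show n + 1 + 1 = n + 2 from rfl] at *
  rw [h2]
  linear_combination -D.u (n + 1) * (1 + D.F (n + 2)) * h1 + D.F (n + 2) ^ 2 * hg

/-- With respect to the partial sum `S (n - 1)`, the column of `S (n - 1) + 1 / F n ^ 2` is
obtained by folding `S (n - 3)`. -/
theorem uniW_add_two {n : ℕ} (hU0 : Uni (D.p n) (D.F n * D.F (n + 1)))
    (hU2 : Uni (D.p (n + 2)) (D.F (n + 2) * D.F (n + 3))) : D.UniW (n + 2) := by
  obtain ⟨t, ht⟩ := D.exists_inverse_one (n + 1)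
  have h1 := D.F_succ (n + 2)
  have h2 := D.F_add_two n
  have h2' := D.F_add_two (n + 1)
  have h5 := D.p_succ n
  simp only [UniW, s, show n + 1 + 1 = n + 2 from rfl, show n + 1 + 2 = n + 3 from rfl] at *
  rw [hU2.tail_iff ht]
  convert hU0.fold (-(D.F (n + 2) * D.h (n + 1) * D.h n)) using 1
  · rw [h5]
    linear_combination D.F (n + 3) * ht + h1 + D.F (n + 2) * h2' +
      D.F (n + 3) * D.F (n + 1) * D.h (n + 1) * D.p (n + 2) * h5
  · linear_combination -D.F (n + 2) ^ 2 * h2' -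
      D.F (n + 2) * D.F (n + 1) ^ 2 * D.h (n + 1) * h2

/-- The column in `UniY` is that of minus the reversal of `S (n - 1)`, relative to
`S (n - 1) + 1 / F n ^ 2`. -/
theorem uniY_succ {n : ℕ} (hW : D.UniW (n + 1))
    (hU : Uni (D.p (n + 1)) (D.F (n + 1) * D.F (n + 2))) : D.UniY (n + 1) := by
  obtain ⟨t, ht⟩ := D.exists_inverse_one n
  obtain ⟨g1, hg1⟩ := D.exists_u_add_one n
  obtain ⟨g, hg⟩ := D.exists_u_add_one (n + 1)
  have h1 := D.F_succ (n + 1)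
  have h2 := D.F_add_two n
  have h2' := D.F_add_two (n + 1)
  have h3 := D.h_succ n
  have h5 := D.p_succ n
  have h7 := D.F_succ (n + 2)
  have hR := hU.reverse ht
  simp only [UniY, UniW, s, show n + 1 + 1 = n + 2 from rfl, show n + 1 + 2 = n + 3 from rfl] at *
  generalize D.p n = p2 at *
  generalize D.F n = l2 at *
  generalize D.h n = g2 at *
  generalize D.m (n + 2) = m at *
  generalize D.F (n + 1) = l1 at *
  generalize D.u (n + 1) = u1 at *
  generalize D.F (n + 2) = l at *
  generalize D.F (n + 3) = a at *
  generalize D.u (n + 2) = u at *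
  generalize D.h (n + 1) = k1 at *
  generalize D.p (n + 1) = p1 at *
  obtain ⟨s', hs'⟩ : ∃ s', s' = 1 * l - u1 - l2 * g2 * p2 := ⟨_, rfl⟩
  rw [← hs'] at ht hR
  obtain ⟨v, hv⟩ : ∃ v, v = l * t + p1 * k1 * u + p1 * u1 ^ 2 * (1 + l * m) +
      p2 * l1 * g1 * (u1 - 1) + u1 + 1 + 2 * g - 2 * l * g + l ^ 2 * l1 * g ^ 2 := ⟨_, rfl⟩
  have hY : p1 * a * l1 * k1 + u * (a + 1) = -((p1 * l + l1) * s') + v * (l * l1) := by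
    have hu : u = l * l1 * g - 1 := by linear_combination hg
    have hk : k1 = u1 ^ 2 * (1 + l + l ^ 2 * m) := by linear_combination h3
    rw [hv, h7, hk, hu]
    rw [h5] at ht ⊢
    linear_combination l * ht + p2 * l2 * g2 * l1 * (u1 - 1) * hg1 -
      l1 ^ 2 * g1 * (u1 - 1) * p2 * h2 - (l1 * u1 - 2) * h1 + l1 * hs'
  have hd : (p1 * l + l1) * (s' * l + a * l1 * k1) - l ^ 2 * l1 * v = 1 := by
    linear_combination l * hY + (a + 1) * h7 - a * h2'
  rw [hW.tail_iff hd]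
  convert hR.neg_left using 1
  · linear_combination (s' * l + a * l1 * k1) * hY - s' * hd - v * l * a * h2'
  · linear_combination l * l1 * hd + (p1 * l + l1) * l * a * h2' - l ^ 2 * l1 * hY

theorem uni_all_one (n : ℕ) : Uni (D.p n) (D.F n * D.F (n + 1)) := by
  induction n using Nat.strong_induction_on with
  | _ n ih =>
    match n with
    | 0 => exact D.uni_zero
    | 1 => exact D.uni_one
    | 2 => exact D.uni_succ_of_uniY D.uni_one D.uniY_zero
    | 3 => exact D.uni_succ_of_uniY (ih 2 (by lia)) (D.uniY_succ D.uniW_one (ih 1 (by lia)))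
    | k + 4 =>
      exact D.uni_succ_of_uniY (ih (k + 3) (by lia))
        (D.uniY_succ (D.uniW_add_two (ih k (by lia)) (ih (k + 2) (by lia))) (ih (k + 2) (by lia)))

end TwoStep

/-! #### The iterates of `f` -/

/-- The sequence `1, 1, x, f, f², …`. -/
noncomputable def preIterate (f : ℤ[X]) : ℕ → ℤ[X]
  | 0 => 1
  | 1 => 1
  | n + 2 => polyIterate f n

/-- The quotients of `preIterate f (n + 1) - 1` by `preIterate f n`, for
`f = (x - 1)² (1 + ε x + x² m)`. -/
noncomputable def preIterateU (ε f m : ℤ[X]) : ℕ → ℤ[X]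
  | 0 => 0
  | 1 => X - 1
  | n + 2 => (X - 2 + ε * (X - 1) ^ 2 + X * m * (X - 1) ^ 2).comp (polyIterate f n)

/-- The quotients of `preIterate f (n + 2)` by the square of `preIterate f n`, for
`f = (x - 1)² (1 + ε x + x² m)`. -/
noncomputable def preIterateH (ε f m : ℤ[X]) : ℕ → ℤ[X]
  | 0 => X
  | n + 1 => preIterateU ε f m (n + 1) ^ 2 * (1 + ε * X + X ^ 2 * m).comp (polyIterate f n)

/-- The numerator of the `n`-th partial sum over the denominator
`preIterate f n * preIterate f (n + 1)`. -/
noncomputable def preIterateP (ε f m : ℤ[X]) : ℕ → ℤ[X]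
  | 0 => 0
  | n + 1 => preIterateP ε f m n * preIterate f n * preIterateH ε f m n + preIterate f (n + 1)

theorem preIterate_succ {ε f m : ℤ[X]} (hε : ∀ g, ε.comp g = ε)
    (hm : f = (X - 1) ^ 2 * (1 + ε * X + X ^ 2 * m)) (n : ℕ) :
    preIterate f (n + 1) = 1 + preIterate f n * preIterateU ε f m n := by
  match n with
  | 0 => simp [preIterate, preIterateU]
  | 1 => simp [preIterate, preIterateU, polyIterate]
  | n + 2 =>
    simp only [preIterate, preIterateU]
    rw [polyIterate_succ_of_eq hm]
    simp only [mul_comp, pow_comp, X_comp, add_comp, sub_comp, one_comp, hε, ofNat_comp]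
    ring

theorem preIterate_add_two {ε f m : ℤ[X]} (hε : ∀ g, ε.comp g = ε)
    (hm : f = (X - 1) ^ 2 * (1 + ε * X + X ^ 2 * m)) (n : ℕ) :
    preIterate f (n + 2) = preIterate f n ^ 2 * preIterateH ε f m n := by
  match n with
  | 0 => simp [preIterate, preIterateH, polyIterate]
  | n + 1 =>
    have h := preIterate_succ hε hm (n + 1)
    have h' : preIterate f (n + 3) = (preIterate f (n + 2) - 1) ^ 2 *
        (1 + ε * X + X ^ 2 * m).comp (polyIterate f n) := by
      simp only [preIterate]
      rw [polyIterate_succ_of_eq hm]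
      simp only [mul_comp, pow_comp, X_comp, add_comp, sub_comp, one_comp, hε]
    rw [show n + 1 + 2 = n + 3 from rfl, h', preIterateH, show n + 2 = n + 1 + 1 from rfl, h]
    ring

/-- The `TwoStep` data of a polynomial `f = (x - 1)² (1 + ε x + x² m)` with constant `ε`. -/
noncomputable def twoStep {ε f m : ℤ[X]} (hε : ∀ g, ε.comp g = ε)
    (hm : f = (X - 1) ^ 2 * (1 + ε * X + X ^ 2 * m)) : TwoStep ε where
  F := preIterate f
  u := preIterateU ε f m
  h := preIterateH ε f m
  m n := m.comp (preIterate f n)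
  p := preIterateP ε f m
  F_zero := rfl
  F_one := rfl
  F_two := rfl
  u_one := rfl
  p_zero := rfl
  F_succ := preIterate_succ hε hm
  F_add_two := preIterate_add_two hε hm
  h_succ n := by
    simp only [preIterateH, preIterate, mul_comp, pow_comp, X_comp, add_comp, one_comp, hε]
  u_add_two n := by
    simp only [preIterateU, preIterate, mul_comp, pow_comp, X_comp, add_comp, sub_comp, one_comp,
      hε, ofNat_comp]
    ring
  p_succ n := rfl

theorem sum_range_eq_preIterateP {ε f m : ℤ[X]} (hε : ∀ g, ε.comp g = ε)
    (hm : f = (X - 1) ^ 2 * (1 + ε * X + X ^ 2 * m))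
    (hf : 1 < f.natDegree) (n : ℕ) :
    preIterate f n * preIterate f (n + 1) ≠ 0 ∧
    ∑ i ∈ Finset.range n, (ι (polyIterate f i))⁻¹ =
      ι (preIterateP ε f m n) / ι (preIterate f n * preIterate f (n + 1)) := by
  have h0 : ∀ n, preIterate f n ≠ 0 := by
    intro n
    match n with
    | 0 => exact one_ne_zero
    | 1 => exact one_ne_zero
    | n + 2 => exact polyIterate_ne_zero hf n
  have h1 : ∀ n, preIterate f n * preIterate f (n + 1) ≠ 0 := fun n => mul_ne_zero (h0 _) (h0 _)
  refine ⟨h1 n, ?_⟩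
  induction n with
  | zero => simp [preIterateP]
  | succ n ih =>
    refine sum_range_succ_eq hf ih (h1 n) (h1 _) ?_
    have h2 := preIterate_add_two hε hm n
    rw [preIterateP, show polyIterate f n = preIterate f (n + 2) from rfl, h2]
    ring

theorem uni_sum_of_sub_one_sq_mul {ε f m : ℤ[X]} (hε : ε = 0 ∨ ε = 1) (hf : 1 < f.natDegree)
    (hm : f = (X - 1) ^ 2 * (1 + ε * X + X ^ 2 * m)) (n : ℕ) :
    ∃ p q, Uni p q ∧ q ≠ 0 ∧
      ∑ i ∈ Finset.range n, (ι (polyIterate f i))⁻¹ = ι p / ι q := by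
  rcases hε with rfl | rfl
  · obtain ⟨h1, h2⟩ := sum_range_eq_preIterateP (fun _ => zero_comp) hm hf n
    exact ⟨_, _, (twoStep (fun _ => zero_comp) hm).uni_all_zero n, h1, h2⟩
  · obtain ⟨h1, h2⟩ := sum_range_eq_preIterateP (fun _ => one_comp) hm hf n
    exact ⟨_, _, (twoStep (fun _ => one_comp) hm).uni_all_one n, h1, h2⟩

/-! ### The fourteen congruences -/

/-- The congruences among the fourteen for which `f 0` is `0` or `1`; the other six are their
images under `negConj`. -/
def NonnegCongruences (f : ℤ[X]) : Prop :=
  X ^ 2 ∣ f ∨ X ^ 2 ∣ f + X ∨ X ^ 2 * (X - 1) ∣ f - 1 ∨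
  X ^ 2 * (X - 1) ^ 2 ∣ f - (X ^ 3 - X ^ 2 - X + 1) ∨
  X ^ 2 * (X - 1) ^ 2 ∣ f - (-X ^ 3 + 2 * X ^ 2 - X + 1) ∨
  X ^ 2 * (X - 1) ^ 2 ∣ f - (-X ^ 3 + 3 * X ^ 2 - 2 * X + 1) ∨
  X ^ 2 * (X - 1) ^ 2 ∣ f - (X ^ 2 - X + 1) ∨
  X ^ 2 * (X - 1) ^ 2 ∣ f - (X ^ 2 - 2 * X + 1)

theorem mem_closure_of_nonnegCongruences {f : ℤ[X]} (hf : 1 < f.natDegree) {α : K}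
    (hα : HasSum (fun n => (ι (polyIterate f n))⁻¹) α) (h : NonnegCongruences f) :
    α ∈ closure cfValues := by
  refine mem_closure_of_uni hα fun n => ?_
  rcases h with ⟨m, h⟩ | ⟨m, h⟩ | ⟨m, h⟩ | ⟨m, h⟩ | ⟨m, h⟩ | ⟨m, h⟩ | ⟨m, h⟩ | ⟨m, h⟩
  · obtain ⟨p, q, _, hU, hq, hs, _⟩ := uni_sum_of_sq_dvd hf h n
    exact ⟨p, q, hU, hq, hs⟩
  · obtain ⟨p, q, _, _, hU, hq, hs, _⟩ :=
      uni_sum_of_neg_X hf (m := m) (by linear_combination h) n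
    exact ⟨p, q, hU, hq, hs⟩
  · obtain ⟨p, q, _, hU, hq, hs, _⟩ := uni_sum_of_one hf (m := m) (by linear_combination h) n
    exact ⟨p, q, hU, hq, hs⟩
  · exact uni_sum_of_sub_one_sq_mul (ε := 1) (m := m) (Or.inr rfl) hf (by linear_combination h) n
  · obtain ⟨p, q, _, _, _, hU, hq, hs, _⟩ :=
      uni_sum_of_prev_reverse hf (m := m) (by linear_combination h) n
    exact ⟨p, q, hU, hq, hs⟩
  · obtain ⟨p, q, _, _, hU, hq, hs, _⟩ :=
      uni_sum_of_two_mul_reverse hf (m := m) (by linear_combination h) n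
    exact ⟨p, q, hU, hq, hs⟩
  · obtain ⟨p, q, _, _, hU, hq, hs, _⟩ :=
      uni_sum_of_reverse hf (m := m) (by linear_combination h) n
    exact ⟨p, q, hU, hq, hs⟩
  · exact uni_sum_of_sub_one_sq_mul (ε := 0) (m := m) (Or.inl rfl) hf (by linear_combination h) n

theorem dvd_negConj_sub {f d r : ℤ[X]} (h : d ∣ f - r) :
    d.comp (-X) ∣ negConj f - negConj r := by
  obtain ⟨m, hm⟩ := h
  refine ⟨-m.comp (-X), ?_⟩
  have := congrArg (fun p => p.comp (-X)) hm
  simp only [sub_comp, mul_comp] at this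
  rw [negConj, negConj]
  linear_combination -this

theorem dvd_negConj_sub_iff {f d d' r r' : ℤ[X]} (hd : d' = d.comp (-X)) (hr : r' = negConj r) :
    d' ∣ negConj f - r' ↔ d ∣ f - r := by
  subst hd hr
  refine ⟨fun h => ?_, dvd_negConj_sub⟩
  have := dvd_negConj_sub h
  rwa [negConj_negConj, negConj_negConj, comp_assoc, neg_comp, X_comp, neg_neg, comp_X] at this

/-- Up to `negConj`, the fourteen congruences are the eight with `f 0` in `{0, 1}`. -/
theorem fourteenCongruences_iff {f : ℤ[X]} :
    FourteenCongruences f ↔ NonnegCongruences f ∨ NonnegCongruences (negConj f) := by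
  have e2 : ((-X : ℤ[X]) + 1) = -(X - 1) := by ring
  have d1 : (X ^ 2 * (X - 1) ^ 2 : ℤ[X]) = (X ^ 2 * (X + 1) ^ 2 : ℤ[X]).comp (-X) := by
    simp [e2, -neg_sub]
  have d2 : (X ^ 2 * (X - 1) : ℤ[X]) ∣ negConj f - 1 ↔ X ^ 2 * (X + 1) ∣ f - (-1) := by
    rw [← dvd_negConj_sub_iff (f := f) (d := X ^ 2 * (X + 1)) rfl rfl]
    simp only [negConj, neg_comp, one_comp, neg_neg, mul_comp, pow_comp, add_comp, X_comp, e2]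
    rw [mul_neg, neg_dvd, neg_sq]
  have d3 : (X : ℤ[X]) ^ 2 ∣ negConj f ↔ X ^ 2 ∣ f := by
    simpa using dvd_negConj_sub_iff (f := f) (d := X ^ 2) (d' := X ^ 2) (r := 0) (r' := 0)
      (by simp) (by simp [negConj])
  have d4 : (X : ℤ[X]) ^ 2 ∣ negConj f + X ↔ X ^ 2 ∣ f + X := by
    simpa using dvd_negConj_sub_iff (f := f) (d := X ^ 2) (d' := X ^ 2) (r := -X) (r' := -X)
      (by simp) (by simp [negConj])
  unfold FourteenCongruences NonnegCongruences
  rw [d2, d3, d4,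
    dvd_negConj_sub_iff (r := X ^ 3 + X ^ 2 - X - 1) d1 (by simp [negConj]; ring),
    dvd_negConj_sub_iff (r := -X ^ 3 - 2 * X ^ 2 - X - 1) d1 (by simp [negConj]; ring),
    dvd_negConj_sub_iff (r := -X ^ 3 - 3 * X ^ 2 - 2 * X - 1) d1 (by simp [negConj]; ring),
    dvd_negConj_sub_iff (r := -X ^ 2 - X - 1) d1 (by simp [negConj]; ring),
    dvd_negConj_sub_iff (r := -X ^ 2 - 2 * X - 1) d1 (by simp [negConj]; ring),
    sub_zero, sub_neg_eq_add f X]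
  constructor
  · rintro (h | h | h | h | h | h | h | h | h | h | h | h | h | h) <;>
      simp only [h, true_or, or_true]
  · rintro ((h | h | h | h | h | h | h | h) | (h | h | h | h | h | h | h | h)) <;>
      simp only [h, true_or, or_true]

/-! ### Necessity: rational approximations and their tails -/

/-- `Approx P Q e` says that some limit of values of continued fractions over `ℤ[x]` agrees with
`P / Q` up to degree `-(2 deg Q + e)`. The normalization makes `e` invariant under the passage to
a tail of the continued fraction. The fraction `P / Q` need not be reduced. -/
def Approx (P Q : ℤ[X]) (e : ℤ) : Prop :=
  Q ≠ 0 ∧ ∃ y ∈ closure cfValues, DegLE (y - ι P / ι Q) (-(2 * Q.natDegree + e))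

namespace Approx

variable {P Q : ℤ[X]} {e : ℤ}

theorem tail (h : Approx P Q e) {p q s t P' Q' : ℤ[X]} (hu : Uni p q) (hst : p * s - q * t = 1)
    (hP : s * P - t * Q = P') (hQ : p * Q - q * P = Q') (hQ0 : Q' ≠ 0)
    (hd : (q.natDegree : ℤ) < Q'.natDegree + Q.natDegree + e) : Approx P' Q' e := by
  obtain ⟨hQ1, y, hy, hyd⟩ := h
  have i1 := toLaurentInv_ne_zero hQ1
  have d1 := degEq_toLaurentInv hQ1
  have d2 := degEq_toLaurentInv hQ0
  have e1 : ι p - ι q * (ι P / ι Q) = ι Q' / ι Q := by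
    rw [← hQ, map_sub, map_mul, map_mul]
    field_simp
  have d3 : DegEq (ι p - ι q * (ι P / ι Q)) (Q'.natDegree - Q.natDegree) := e1 ▸ d2.div d1
  have d4 : DegEq (ι p - ι q * y) (Q'.natDegree - Q.natDegree) := by
    have : ι p - ι q * y = (ι p - ι q * (ι P / ι Q)) - ι q * (y - ι P / ι Q) := by ring
    rw [this]
    exact d3.sub_right ((degLE_toLaurentInv le_rfl).mul hyd) (by lia)
  refine ⟨hQ0, _, cf_mobius_mem hy hu hst d4.ne_zero, ?_⟩
  have i2 := toLaurentInv_ne_zero hQ0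
  have e2 : (ι s * y - ι t) / (ι p - ι q * y) - ι P' / ι Q' =
      (y - ι P / ι Q) / ((ι p - ι q * y) * (ι p - ι q * (ι P / ι Q))) := by
    have i3 := d4.ne_zero
    have hst' := congrArg toLaurentInv hst
    rw [e1, ← hP]
    have hQ' := congrArg toLaurentInv hQ
    simp only [map_sub, map_mul, map_one] at hst' hQ' ⊢
    generalize hD : ι p - ι q * y = D at *
    field_simp
    rw [← hD, ← hQ']
    linear_combination (ι Q * y - ι P) * hst'
  rw [e2]
  exact (hyd.div (d4.mul d3)).mono (by lia)

theorem neg (h : Approx P Q e) : Approx (-P) Q e := by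
  obtain ⟨hQ, y, hy, hd⟩ := h
  refine ⟨hQ, -y, cf_neg_mem hy, ?_⟩
  have : -y - ι (-P) / ι Q = -(y - ι P / ι Q) := by rw [map_neg]; ring
  exact this ▸ hd.neg

theorem add_mul (h : Approx P Q e) (a : ℤ[X]) : Approx (P + a * Q) Q e := by
  obtain ⟨hQ, y, hy, hd⟩ := h
  refine ⟨hQ, y + ι a, cf_add_mem hy a, ?_⟩
  have hQ' := toLaurentInv_ne_zero hQ
  have : y + ι a - ι (P + a * Q) / ι Q = y - ι P / ι Q := by
    rw [map_add, map_mul]; field_simp; ring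
  exact this ▸ hd

theorem neg_den (h : Approx P (-Q) e) : Approx P Q e := by
  obtain ⟨hQ, y, hy, hd⟩ := h
  have h' : Approx (-P) Q e := by
    refine ⟨neg_ne_zero.1 hQ, y, hy, ?_⟩
    rw [natDegree_neg] at hd
    have : ι (-P) / ι Q = ι P / ι (-Q) := by
      rw [map_neg, map_neg]
      ring
    rwa [this]
  simpa using h'.neg

/-- One step of the Euclidean algorithm. -/
theorem step (h : Approx P Q e) (a : ℤ[X]) {R : ℤ[X]} (hR : P = a * Q + R) (hR0 : R ≠ 0)
    (hd : 0 < (R.natDegree : ℤ) + Q.natDegree + e) : Approx Q R e := by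
  have h1 : Approx R Q e := by
    have := h.add_mul (-a)
    rwa [show P + -a * Q = R by rw [hR]; ring] at this
  exact (h1.tail (p := 0) (q := 1) (s := 0) (t := -1) (P' := Q) (Q' := -R) Uni.zero_one
    (by ring) (by ring) (by ring) (neg_ne_zero.2 hR0)
      (by rw [natDegree_neg, natDegree_one]; exact_mod_cast hd)).neg_den

theorem inv (h : Approx P Q e) (hP : P ≠ 0) (hd : 0 < (P.natDegree : ℤ) + Q.natDegree + e) :
    Approx Q P e :=
  h.step 0 (by ring) hP hd

theorem change (h : Approx P Q e) {P' Q' R S : ℤ[X]} {e' : ℤ} (hQ' : Q' ≠ 0) (hS : S ≠ 0)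
    (hR : S * (P * Q' - P' * Q) = R * (Q * Q'))
    (hd : 2 * (Q'.natDegree : ℤ) + e' ≤ 2 * Q.natDegree + e)
    (hRd : (R.natDegree : ℤ) + 2 * Q'.natDegree + e' ≤ S.natDegree) : Approx P' Q' e' := by
  obtain ⟨hQ, y, hy, hyd⟩ := h
  refine ⟨hQ', y, hy, ?_⟩
  have i1 := toLaurentInv_ne_zero hQ
  have i2 := toLaurentInv_ne_zero hQ'
  have i3 := toLaurentInv_ne_zero hS
  have hR' := congrArg toLaurentInv hR
  have : y - ι P' / ι Q' = (y - ι P / ι Q) + ι R / ι S := by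
    simp only [map_sub, map_mul] at hR'
    field_simp
    linear_combination hR'
  rw [this]
  refine (hyd.mono (by lia)).add ?_
  exact ((degLE_toLaurentInv (le_refl (R.natDegree : ℤ))).div (degEq_toLaurentInv hS)).mono
    (by lia)

theorem dvd_coeff {k : ℤ} (h : Approx P (C k) e) (he : 0 ≤ e) {i : ℕ} (hi : i ≠ 0) :
    k ∣ P.coeff i := by
  obtain ⟨hQ, y, hy, hd⟩ := h
  refine dvd_coeff_of_mem hy ?_ hi
  have i1 := toLaurentInv_ne_zero hQ
  have : (k : K) * y - ι P = ι (C k) * (y - ι P / ι (C k)) := by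
    have : ι (C k) = (k : K) := by simp
    rw [this] at i1 ⊢
    field_simp
  rw [this]
  rw [natDegree_C] at hd
  exact ((degLE_toLaurentInv (n := 0) (by simp)).mul hd).mono (by push_cast; lia)

/-- A limit of values of continued fractions close to `(c + k x) / x²` has small `c` and `k`:
otherwise its first partial quotients are not integral. -/
theorem small_coeffs {c k : ℤ} (h : Approx (C c + C k * X) (X ^ 2) e) (he : 0 ≤ e) :
    (c = 0 ∨ c = 1 ∨ c = -1) ∧ (k = 0 ∨ k = 1 ∨ k = -1) := by
  have hk : k = 0 ∨ k = 1 ∨ k = -1 := by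
    by_cases hk : k = 0
    · exact Or.inl hk
    right
    have h1 : Approx (C k) X 0 := by
      refine h.change (R := C c) (S := X ^ 2) X_ne_zero (pow_ne_zero _ X_ne_zero) (by ring) ?_ ?_
      · simp; lia
      · simp
    have h2 := (h1.inv (C_ne_zero.2 hk) (by simp)).dvd_coeff le_rfl one_ne_zero
    rw [coeff_X_one] at h2
    exact Int.isUnit_iff.1 (isUnit_of_dvd_one h2)
  refine ⟨?_, hk⟩
  by_cases hc : c = 0
  · exact Or.inl hc
  right
  by_cases hk0 : k = 0
  · subst hk0
    rw [C_0, zero_mul, add_zero] at h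
    have h2 := (h.inv (C_ne_zero.2 hc) (by simp; lia)).dvd_coeff he two_ne_zero
    rw [coeff_X_pow_self] at h2
    exact Int.isUnit_iff.1 (isUnit_of_dvd_one h2)
  · have hk2 : k ^ 2 = 1 := by rcases hk with rfl | rfl | rfl <;> simp at hk0 ⊢
    have hd : (C c + C k * X).natDegree = 1 := by
      rw [add_comm]; exact natDegree_linear hk0
    have h0 : C c + C k * X ≠ 0 := fun h => by rw [h, natDegree_zero] at hd; exact zero_ne_one hd
    have h1 := h.inv h0 (by rw [hd]; simp; lia)
    have h2 := (h1.step (R := C (c ^ 2)) (C k * X - C c) (by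
      have : (C k : ℤ[X]) ^ 2 = 1 := by rw [← C_pow, hk2, C_1]
      rw [C_pow]
      linear_combination -X ^ 2 * this) (C_ne_zero.2 (pow_ne_zero _ hc))
      (by rw [hd]; simp; lia)).dvd_coeff he one_ne_zero
    have h3 : c ^ 2 ∣ k := by
      rwa [coeff_add, coeff_C_of_ne_zero one_ne_zero, coeff_C_mul_X, if_pos rfl, zero_add] at h2
    have h4 : c ∣ 1 := by
      rw [← hk2]
      exact (dvd_pow_self c two_ne_zero).trans (h3.trans (dvd_pow_self k two_ne_zero))
    exact Int.isUnit_iff.1 (isUnit_of_dvd_one h4)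

end Approx

theorem uni_linear_X_sq {a b : ℤ} (ha : a = 1 ∨ a = -1) (hb : b = 0 ∨ b = 1 ∨ b = -1) :
    Uni (C a + C b * X) (X ^ 2) := by
  have h1 : Uni (1 : ℤ[X]) (X ^ 2) := Uni.one_left _
  have key : ∀ b : ℤ, (b = 0 ∨ b = 1 ∨ b = -1) → Uni (1 + C b * X) (X ^ 2) := by
    rintro b (rfl | rfl | rfl)
    · simpa using h1
    · convert (Uni.one_right (1 + X : ℤ[X])).add_mul' (X - 1) using 1
      · simp
      · ring
    · convert (Uni.one_right (1 - X : ℤ[X])).add_mul' (-X - 1) using 1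
      · simp; ring
      · ring
  rcases ha with rfl | rfl
  · simpa using key b hb
  · have := (key (-b) (by lia)).neg_left
    convert this using 1
    simp
    ring

/-! ### Necessity: degree at least three -/

/-- The numerators of the partial sums `1/x + 1/f + ⋯` over the common denominator
`x f f² ⋯`. -/
noncomputable def sumNum (f : ℤ[X]) : ℕ → ℤ[X]
  | 0 => 0
  | n + 1 => sumNum f n * polyIterate f n + ∏ i ∈ Finset.range n, polyIterate f i

theorem sum_range_eq_sumNum {f : ℤ[X]} (hf : 1 < f.natDegree) (n : ℕ) :
    ∑ i ∈ Finset.range n, (ι (polyIterate f i))⁻¹ =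
      ι (sumNum f n) / ι (∏ i ∈ Finset.range n, polyIterate f i) := by
  have h0 : ∀ n, ∏ i ∈ Finset.range n, polyIterate f i ≠ 0 := fun n =>
    Finset.prod_ne_zero_iff.2 fun i _ => polyIterate_ne_zero hf i
  induction n with
  | zero => simp [sumNum]
  | succ n ih =>
    refine sum_range_succ_eq hf ih (h0 n) (h0 (n + 1)) ?_
    rw [sumNum, Finset.prod_range_succ]
    ring

theorem approx_of_sum {f : ℤ[X]} (hf : 1 < f.natDegree) {α : K}
    (hα : HasSum (fun n => (ι (polyIterate f n))⁻¹) α) (hm : α ∈ closure cfValues) (n : ℕ)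
    {P Q : ℤ[X]} {e : ℤ} (hQ : Q ≠ 0)
    (hPQ : sumNum f n * Q = P * ∏ i ∈ Finset.range n, polyIterate f i)
    (he : 2 * (Q.natDegree : ℤ) + e ≤ (f.natDegree : ℤ) ^ n) : Approx P Q e := by
  refine ⟨hQ, α, hm, ?_⟩
  have h0 : ∏ i ∈ Finset.range n, polyIterate f i ≠ 0 :=
    Finset.prod_ne_zero_iff.2 fun i _ => polyIterate_ne_zero hf i
  have i1 := toLaurentInv_ne_zero hQ
  have i2 := toLaurentInv_ne_zero h0
  have h1 : ∑ i ∈ Finset.range n, (ι (polyIterate f i))⁻¹ = ι P / ι Q := by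
    have := congrArg toLaurentInv hPQ
    rw [map_mul, map_mul] at this
    rw [sum_range_eq_sumNum hf, div_eq_div_iff i2 i1, this]
  rw [← h1]
  exact (degLE_sub_sum_range hf hα n).mono (by lia)

theorem approx_two {f : ℤ[X]} (hf : 1 < f.natDegree) {α : K}
    (hα : HasSum (fun n => (ι (polyIterate f n))⁻¹) α) (hm : α ∈ closure cfValues) {e : ℤ}
    (he : 2 * (1 + f.natDegree : ℤ) + e ≤ (f.natDegree : ℤ) ^ 2) :
    Approx (X + f) (X * f) e := by
  have h0 : f ≠ 0 := fun h => by simp [h] at hf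
  refine approx_of_sum hf hα hm 2 (mul_ne_zero X_ne_zero h0) ?_ ?_
  · simp only [sumNum, Finset.prod_range_succ, Finset.prod_range_zero, polyIterate, comp_X]
    ring
  · rw [natDegree_mul X_ne_zero h0, natDegree_X]
    exact_mod_cast he

theorem natDegree_prod_three {f : ℤ[X]} (hf : 1 < f.natDegree) :
    X * f * f.comp f ≠ 0 ∧ (X * f * f.comp f).natDegree = 1 + f.natDegree + f.natDegree ^ 2 := by
  have h0 : f ≠ 0 := fun h => by simp [h] at hf
  have h1 : f.comp f ≠ 0 := by
    have := polyIterate_ne_zero hf 2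
    simpa only [polyIterate, comp_X] using this
  refine ⟨mul_ne_zero (mul_ne_zero X_ne_zero h0) h1, ?_⟩
  rw [natDegree_mul (mul_ne_zero X_ne_zero h0) h1, natDegree_mul X_ne_zero h0, natDegree_X,
    natDegree_comp, sq]

theorem approx_three {f : ℤ[X]} (hf : 1 < f.natDegree) {α : K}
    (hα : HasSum (fun n => (ι (polyIterate f n))⁻¹) α) (hm : α ∈ closure cfValues) {e : ℤ}
    (he : 2 * (1 + f.natDegree + (f.natDegree : ℤ) ^ 2) + e ≤ (f.natDegree : ℤ) ^ 3) :
    Approx ((X + f) * f.comp f + X * f) (X * f * f.comp f) e := by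
  obtain ⟨h0, h1⟩ := natDegree_prod_three hf
  refine approx_of_sum hf hα hm 3 h0 ?_ ?_
  · simp only [sumNum, Finset.prod_range_succ, Finset.prod_range_zero, polyIterate, comp_X]
    ring
  · rw [h1]
    exact_mod_cast he

theorem approx_four {f : ℤ[X]} (hf : 1 < f.natDegree) {α : K}
    (hα : HasSum (fun n => (ι (polyIterate f n))⁻¹) α) (hm : α ∈ closure cfValues) {e : ℤ}
    (he : 2 * (1 + f.natDegree + (f.natDegree : ℤ) ^ 2 + (f.natDegree : ℤ) ^ 3) + e ≤
      (f.natDegree : ℤ) ^ 4) :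
    Approx (((X + f) * f.comp f + X * f) * f.comp (f.comp f) + X * f * f.comp f)
      (X * f * f.comp f * f.comp (f.comp f)) e := by
  obtain ⟨h0, h1⟩ := natDegree_prod_three hf
  have h2 : f.comp (f.comp f) ≠ 0 := by
    have := polyIterate_ne_zero hf 3
    simpa only [polyIterate, comp_X] using this
  refine approx_of_sum hf hα hm 4 (mul_ne_zero h0 h2) ?_ ?_
  · simp only [sumNum, Finset.prod_range_succ, Finset.prod_range_zero, polyIterate, comp_X]
    ring
  · rw [natDegree_mul h0 h2, h1, natDegree_comp, natDegree_comp]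
    push_cast
    linarith

/-- The tail relative to `1 / x` is close to `(c + k x) / x²`. -/
theorem small_of_mem {f g : ℤ[X]} {c k : ℤ} (hf : 2 < f.natDegree)
    (hfg : f = C c + C (k - 1) * X + X ^ 2 * g) {α : K}
    (hα : HasSum (fun n => (ι (polyIterate f n))⁻¹) α) (hm : α ∈ closure cfValues) :
    (c = 0 ∨ c = 1 ∨ c = -1) ∧ (k = 0 ∨ k = 1 ∨ k = -1) := by
  have hf1 : 1 < f.natDegree := by lia
  obtain ⟨j, hj⟩ : ∃ j : ℕ, f.natDegree = 3 + j := ⟨f.natDegree - 3, by lia⟩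
  have h1 := approx_two hf1 hα hm (e := 0) (by rw [hj]; push_cast; nlinarith)
  have h2 := h1.tail (p := 1) (q := X) (s := 1) (t := 0) (P' := X + f) (Q' := -X ^ 2)
    (Uni.one_left _) (by ring) (by ring) (by ring) (neg_ne_zero.2 (pow_ne_zero _ X_ne_zero))
    (by simp; lia)
  have h3 := h2.neg_den.add_mul (-g)
  have e : X + f + -g * X ^ 2 = C c + C k * X := by
    rw [hfg]; simp; ring
  rw [e] at h3
  exact h3.small_coeffs le_rfl

section

variable {f g m : ℤ[X]} {k a b : ℤ}

theorem comp_eq_of_expansions (hfg : f = 1 + C (k - 1) * X + X ^ 2 * g)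
    (hg : g = C a + C b * (X - 1) + (X - 1) ^ 2 * m) (h : ℤ[X]) :
    f.comp h = 1 + C (k - 1) * h + h ^ 2 * (C a + C b * (h - 1) + (h - 1) ^ 2 * m.comp h) := by
  rw [hfg, hg]
  simp only [add_comp, mul_comp, pow_comp, X_comp, sub_comp, one_comp, C_comp]

/-- The tail relative to `1 / x + 1 / f`. -/
theorem approx_tail_two_terms (hfg : f = 1 + C (k - 1) * X + X ^ 2 * g)
    (hg : g = C a + C b * (X - 1) + (X - 1) ^ 2 * m) (hf : 2 < f.natDegree)
    (hk : k = 0 ∨ k = 1 ∨ k = -1) {α : K}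
    (hα : HasSum (fun n => (ι (polyIterate f n))⁻¹) α) (hm : α ∈ closure cfValues) :
    Approx (1 + C k * f + f ^ 2 * (C (a - 1) + C (k + (k - 1) * b) * X)) (X ^ 2 * f ^ 2) 0 := by
  have hf1 : 1 < f.natDegree := by lia
  have h0 : f ≠ 0 := fun h => by simp [h] at hf
  obtain ⟨j, hj⟩ : ∃ j : ℕ, f.natDegree = 3 + j := ⟨f.natDegree - 3, by lia⟩
  have h1 := approx_three hf1 hα hm (e := 0) (by
    rw [hj]; push_cast
    have : (0 : ℤ) ≤ (j : ℤ) ^ 3 + 7 * (j : ℤ) ^ 2 + 13 * j := by positivity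
    linarith)
  have hU : Uni (X + f) (X * f) := by
    rw [(Uni.one_left X).tail_iff (s := 1) (t := 0) (by ring)]
    have := ((uni_linear_X_sq (a := 1) (Or.inl rfl) hk).add_mul g).neg_right
    convert this using 1
    · nth_rewrite 1 [hfg]; simp; ring
    · ring
  have hF := comp_eq_of_expansions hfg hg f
  have hk1 : (C (k - 1) : ℤ[X]) = C k - 1 := by simp
  have ha1 : (C (a - 1) : ℤ[X]) = C a - 1 := by simp
  have hb1 : (C (k + (k - 1) * b) : ℤ[X]) = C k + (C k - 1) * C b := by simp
  obtain ⟨u, hu⟩ : ∃ u : ℤ[X], u = C k - 1 + X * g := ⟨_, rfl⟩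
  have hfu : f = 1 + X * u := by rw [hu, ← hk1]; linear_combination hfg
  have hst : (X + f) * (-u + C k * f) - X * f * (C k * u - g + C k) = 1 := by
    linear_combination (1 + C k * f) * hfu - f * hu
  obtain ⟨hd0, hd1⟩ := natDegree_prod_three hf1
  have h2 := h1.tail (P' := f.comp f + (-u + C k * f) * (X * f)) (Q' := -(X ^ 2 * f ^ 2)) hU hst
    (by linear_combination (f.comp f) * hst) (by ring)
    (neg_ne_zero.2 (mul_ne_zero (pow_ne_zero _ X_ne_zero) (pow_ne_zero _ h0)))
    (by
      have : (0 : ℤ) < (f.natDegree : ℤ) ^ 2 := pow_pos (by lia) 2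
      rw [hd1, natDegree_mul X_ne_zero h0, natDegree_X]
      push_cast
      lia)
  have h3 := h2.neg_den.add_mul (-(C b * g + u ^ 2 * m.comp f))
  convert h3 using 1
  rw [hF, hk1, ha1, hb1]
  linear_combination (-f - C b * f ^ 2 - f ^ 2 * m.comp f * (f - 1 + X * u)) * hfu -
    C b * f ^ 2 * X * hu

theorem one_add_C_mul_ne_zero (hf : 0 < f.natDegree) (k : ℤ) : 1 + C k * f ≠ 0 := by
  intro h
  by_cases hk : k = 0
  · simp [hk] at h
  · have h1 : C k * f = -1 := by linear_combination h
    have h2 := congrArg natDegree h1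
    rw [natDegree_C_mul hk, natDegree_neg, natDegree_one] at h2
    lia

theorem natDegree_one_add_C_mul (hk : k ≠ 0) : (1 + C k * f).natDegree = f.natDegree := by
  rw [← C_1, natDegree_C_add, natDegree_C_mul hk]

/-- The tail in `approx_tail_two_terms` is close to `(A + B x) / x²`. -/
theorem small_of_tail_two_terms {A B : ℤ} (hf : 2 < f.natDegree)
    (h : Approx (1 + C k * f + f ^ 2 * (C A + C B * X)) (X ^ 2 * f ^ 2) 0) :
    (A = 0 ∨ A = 1 ∨ A = -1) ∧ (B = 0 ∨ B = 1 ∨ B = -1) := by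
  have h0 : f ≠ 0 := fun h => by simp [h] at hf
  have hd : (X ^ 2 * f ^ 2).natDegree = 2 + 2 * f.natDegree := by
    rw [natDegree_mul (pow_ne_zero _ X_ne_zero) (pow_ne_zero _ h0), natDegree_pow, natDegree_pow,
      natDegree_X, mul_one]
  have hd' : (1 + C k * f).natDegree ≤ f.natDegree := by
    by_cases hk : k = 0
    · simp [hk]
    · exact (natDegree_one_add_C_mul hk).le
  have h1 : Approx (C A + C B * X) (X ^ 2) 0 := by
    refine h.change (R := 1 + C k * f) (S := X ^ 2 * f ^ 2) (pow_ne_zero _ X_ne_zero)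
      (mul_ne_zero (pow_ne_zero _ X_ne_zero) (pow_ne_zero _ h0)) (by ring) ?_ ?_
    · rw [hd, natDegree_X_pow]; push_cast; lia
    · rw [hd, natDegree_X_pow]; push_cast; lia
  exact h1.small_coeffs le_rfl

/-- The tail relative to `(A + B x) / x²`, when `A` is a unit. -/
theorem approx_tail_unit {A B : ℤ} (hf : 2 < f.natDegree) (hA : A = 1 ∨ A = -1)
    (hB : B = 0 ∨ B = 1 ∨ B = -1)
    (h : Approx (1 + C k * f + f ^ 2 * (C A + C B * X)) (X ^ 2 * f ^ 2) 0) :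
    Approx ((C A - C B * X) * (1 + C k * f) + f ^ 2) (X ^ 2 * (1 + C k * f)) 0 := by
  have h0 : f ≠ 0 := fun h => by simp [h] at hf
  have hA2 : (C A : ℤ[X]) ^ 2 = 1 := by rcases hA with rfl | rfl <;> simp
  have h1 := one_add_C_mul_ne_zero (f := f) (by lia) k
  refine (h.tail (uni_linear_X_sq hA hB) (s := C A - C B * X) (t := -C B ^ 2) ?_ ?_
    (Q' := -(X ^ 2 * (1 + C k * f))) ?_ (neg_ne_zero.2 (mul_ne_zero (pow_ne_zero _ X_ne_zero) h1))
    ?_).neg_den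
  · linear_combination hA2
  · linear_combination f ^ 2 * hA2
  · ring
  · rw [natDegree_mul (pow_ne_zero _ X_ne_zero) (pow_ne_zero _ h0), natDegree_pow, natDegree_pow,
      natDegree_X]
    push_cast
    lia

/-- For `k = 0`, the tail in `approx_tail_unit` is a polynomial plus `(1 + A - (2 + B) x) / x²`. -/
theorem eq_of_unit_of_zero {A B : ℤ} (hfg : f = 1 + C (0 - 1) * X + X ^ 2 * g)
    (hf : 2 < f.natDegree) (hA : A = 1 ∨ A = -1) (hB : B = 0 ∨ B = 1 ∨ B = -1)
    (h : Approx (1 + C 0 * f + f ^ 2 * (C A + C B * X)) (X ^ 2 * f ^ 2) 0) : A = -1 ∧ B = -1 := by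
  have h1 := (approx_tail_unit hf hA hB h).add_mul (-(1 + 2 * (1 - X) * g + X ^ 2 * g ^ 2))
  have h2 : Approx (C (A + 1) + C (-B - 2) * X) (X ^ 2) 0 := by
    convert h1 using 1
    · have : f = 1 - X + X ^ 2 * g := by rw [hfg]; simp; ring
      rw [this]
      simp
      ring
    · simp
  have := h2.small_coeffs le_rfl
  lia

/-- For `k = 1` and `k = -1`, the square of `f` is reduced modulo `1 + k f`. -/
theorem approx_tail_unit_reduced {A B : ℤ} (hfg : f = 1 + C (k - 1) * X + X ^ 2 * g)
    (hk : k = 1 ∨ k = -1)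
    (h : Approx ((C A - C B * X) * (1 + C k * f) + f ^ 2) (X ^ 2 * (1 + C k * f)) 0) :
    Approx ((C (k - 1 + A) + C (1 - k - B) * X) * (1 + C k * f) + 1) (X ^ 2 * (1 + C k * f)) 0 := by
  have hk2 : (C k : ℤ[X]) ^ 2 = 1 := by rcases hk with rfl | rfl <;> simp
  have hk1 : (C (k - 1) : ℤ[X]) = C k - 1 := by simp
  convert h.add_mul (-C k * g) using 1
  rw [hk1] at hfg
  have e1 : C (k - 1 + A) = C k - 1 + C A := by simp
  have e2 : C (1 - k - B) = 1 - C k - C B := by simp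
  rw [e1, e2]
  linear_combination -C k * (1 + C k * f) * hfg + (f ^ 2 - X * (1 + C k * f)) * hk2

theorem small_of_tail_unit {A B : ℤ} (hf : 2 < f.natDegree) (hk : k = 1 ∨ k = -1)
    (h : Approx ((C A + C B * X) * (1 + C k * f) + 1) (X ^ 2 * (1 + C k * f)) 0) :
    (A = 0 ∨ A = 1 ∨ A = -1) ∧ (B = 0 ∨ B = 1 ∨ B = -1) := by
  have h1 := one_add_C_mul_ne_zero (f := f) (by lia) k
  have hd : (X ^ 2 * (1 + C k * f)).natDegree = 2 + f.natDegree := by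
    rw [natDegree_mul (pow_ne_zero _ X_ne_zero) h1, natDegree_X_pow,
      natDegree_one_add_C_mul (by lia)]
  have h1 : Approx (C A + C B * X) (X ^ 2) 0 := by
    refine h.change (R := 1) (S := X ^ 2 * (1 + C k * f)) (pow_ne_zero _ X_ne_zero)
      (mul_ne_zero (pow_ne_zero _ X_ne_zero) h1) (by ring) ?_ ?_
    · rw [hd, natDegree_X_pow]; push_cast; lia
    · rw [hd, natDegree_X_pow, natDegree_one]; push_cast; lia
  exact h1.small_coeffs le_rfl

/-- For `k = A = B = 1`, one more tail, relative to `(1 - x) / x²`, is `(3 + x) / x²` plus a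
polynomial. -/
theorem not_approx_one_one (hfg : f = 1 + C (1 - 1) * X + X ^ 2 * g) (hf : 2 < f.natDegree)
    (h : Approx ((C 1 + C (-1) * X) * (1 + C 1 * f) + 1) (X ^ 2 * (1 + C 1 * f)) 0) : False := by
  have h1 := one_add_C_mul_ne_zero (f := f) (by lia) 1
  have hd : (X ^ 2 * (1 + C 1 * f)).natDegree = 2 + f.natDegree := by
    rw [natDegree_mul (pow_ne_zero _ X_ne_zero) h1, natDegree_X_pow,
      natDegree_one_add_C_mul (by lia)]
  have h2 := (h.tail (uni_linear_X_sq (a := 1) (b := -1) (by lia) (by lia)) (s := 1 + X) (t := -1)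
    (P' := 2 + X + f) (Q' := -X ^ 2) (by simp; ring) (by simp; ring) (by simp; ring)
    (neg_ne_zero.2 (pow_ne_zero _ X_ne_zero))
    (by rw [hd, natDegree_X_pow]; push_cast; lia)).neg_den.add_mul (-g)
  have h3 : Approx (C 3 + C 1 * X) (X ^ 2) 0 := by
    convert h2 using 1
    have : f = 1 + X ^ 2 * g := by rw [hfg]; simp
    nth_rewrite 1 [this]
    have : (C 3 : ℤ[X]) = 3 := by simp
    rw [this, C_1]
    ring
  have := h3.small_coeffs le_rfl
  lia

/-- For `A = 0` and `B` a unit, two successive tails relative to `B / x` lead to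
`(1 + k + (k (k - 1) + B) x) / x²` plus a polynomial. -/
theorem eq_of_zero_of_unit {B : ℤ} (hfg : f = 1 + C (k - 1) * X + X ^ 2 * g)
    (hf : 2 < f.natDegree) (hk : k = 1 ∨ k = -1) (hB : B = 1 ∨ B = -1)
    (h : Approx (1 + C k * f + f ^ 2 * (C 0 + C B * X)) (X ^ 2 * f ^ 2) 0) : k = -1 ∧ B = -1 := by
  have h0 : f ≠ 0 := fun h => by simp [h] at hf
  have h1 := one_add_C_mul_ne_zero (f := f) (by lia) k
  have hB2 : (C B : ℤ[X]) ^ 2 = 1 := by rcases hB with rfl | rfl <;> simp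
  have hk2 : (C k : ℤ[X]) ^ 2 = 1 := by rcases hk with rfl | rfl <;> simp
  have hk1 : (C (k - 1) : ℤ[X]) = C k - 1 := by simp
  have hU : Uni (C B) X := by
    rcases hB with rfl | rfl
    · simpa using Uni.one_left X
    · simpa using (Uni.one_left X).neg_left
  have h2 := (h.tail hU (s := C B) (t := 0) (P' := C B * (1 + C k * f) + f ^ 2 * X)
    (Q' := -(X * (1 + C k * f))) (by linear_combination hB2)
    (by rw [C_0]; linear_combination f ^ 2 * X * hB2)
    (by rw [C_0]; ring) (neg_ne_zero.2 (mul_ne_zero X_ne_zero h1))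
    (by
      rw [natDegree_mul (pow_ne_zero _ X_ne_zero) (pow_ne_zero _ h0), natDegree_X_pow, natDegree_X]
      push_cast
      lia)).neg_den.add_mul (-(C k * f - 1))
  have h3 := (h2.tail hU (s := C B) (t := 0) (P' := 1 + C k * f + C B * X)
    (Q' := -X ^ 2) (by linear_combination hB2)
    (by linear_combination (1 + C k * f) * hB2 - C B * f ^ 2 * X * hk2)
    (by linear_combination X ^ 2 * f ^ 2 * hk2) (neg_ne_zero.2 (pow_ne_zero _ X_ne_zero))
    (by
      rw [natDegree_mul X_ne_zero h1, natDegree_neg, natDegree_X_pow, natDegree_X]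
      push_cast
      lia)).neg_den.add_mul (-C k * g)
  have h4 : Approx (C (1 + k) + C (k * (k - 1) + B) * X) (X ^ 2) 0 := by
    convert h3 using 1
    rw [hk1] at hfg
    nth_rewrite 1 [hfg]
    simp
    ring
  have := h4.small_coeffs le_rfl
  rcases hk with rfl | rfl <;> lia

/-- For `f = x³ - x + 1 + x² (x - 1)² m`, the tail relative to the third partial sum. -/
theorem approx_tail_three_terms (hfg : f = 1 - X + X ^ 2 * g) (hg : g = X + (X - 1) ^ 2 * m)
    (hf : 2 < f.natDegree) {α : K}
    (hα : HasSum (fun n => (ι (polyIterate f n))⁻¹) α) (hm : α ∈ closure cfValues) :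
    Approx ((1 - 2 * X) * f ^ 2 * f.comp f ^ 2 - f * f.comp f ^ 2 + 1)
      ((X * f * f.comp f) ^ 2) 0 := by
  have hf1 : 1 < f.natDegree := by lia
  have h0 : f ≠ 0 := fun h => by simp [h] at hf
  obtain ⟨j, hj⟩ : ∃ j : ℕ, f.natDegree = 3 + j := ⟨f.natDegree - 3, by lia⟩
  have h1 := approx_four hf1 hα hm (e := 0) (by
    rw [hj]; push_cast
    have : (0 : ℤ) ≤ (j : ℤ) ^ 4 + 10 * (j : ℤ) ^ 3 + 34 * (j : ℤ) ^ 2 + 40 * j := by positivity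
    nlinarith)
  have hcomp : ∀ h : ℤ[X], f.comp h = 1 - h + h ^ 2 * (h + (h - 1) ^ 2 * m.comp h) := by
    intro h
    rw [hfg, hg]
    simp only [add_comp, mul_comp, pow_comp, X_comp, sub_comp, one_comp]
  have hF2 := hcomp f
  have hF3 := hcomp (f.comp f)
  obtain ⟨hd0, hd1⟩ := natDegree_prod_three hf1
  have hF30 : f.comp (f.comp f) ≠ 0 := by
    have := polyIterate_ne_zero hf1 3
    simpa only [polyIterate, comp_X] using this
  have hd2 : (X * f * f.comp f * f.comp (f.comp f)).natDegree =
      1 + f.natDegree + f.natDegree ^ 2 + (f.comp (f.comp f)).natDegree := by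
    rw [natDegree_mul hd0 hF30, hd1]
  have hd3 : ((X * f * f.comp f) ^ 2).natDegree = 2 * (1 + f.natDegree + f.natDegree ^ 2) := by
    rw [natDegree_pow, hd1]
  rw [← hd1] at hd3 hd2
  have hd4 : 0 < (X * f * f.comp f).natDegree := by rw [hd1]; lia
  generalize m.comp f = M at *
  generalize m.comp (f.comp f) = M2 at *
  generalize f.comp (f.comp f) = F3 at *
  generalize f.comp f = F2 at *
  obtain ⟨s, hs⟩ : ∃ s : ℤ[X], s = 1 - X * g := ⟨_, rfl⟩
  have hfs : f = 1 - X * s := by rw [hs]; linear_combination hfg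
  obtain ⟨w, hw⟩ : ∃ w : ℤ[X], w = g + s ^ 2 * M := ⟨_, rfl⟩
  have hF2' : F2 = 1 - X * f ^ 2 + X ^ 2 * f ^ 2 * w - X * f * s := by
    rw [hw]
    linear_combination hF2 + (f ^ 2 * M * (f - 1 - X * s) + f) * hfs + f ^ 2 * hfg
  have hdet : (X + f) * s + X * f * g = 1 := by
    linear_combination f * hs + hfs
  -- the inverse of `F2 + s * (X * f)` modulo `(X * f) ^ 2` is `1 + X * f ^ 2`
  obtain ⟨s', hs'⟩ : ∃ s' : ℤ[X], s' = X * f * (f ^ 2 - w * (1 + X * f ^ 2)) +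
    s * (1 + X * f ^ 2) := ⟨_, rfl⟩
  obtain ⟨t', ht'⟩ : ∃ t' : ℤ[X], t' = (X + f) * (f ^ 2 - w * (1 + X * f ^ 2)) -
    g * (1 + X * f ^ 2) := ⟨_, rfl⟩
  have ha : s' * (X * f) = 1 - F2 * (1 + X * f ^ 2) := by rw [hs', hF2']; ring
  have ha' : X * f * t' - (X + f) * s' = -(1 + X * f ^ 2) := by
    rw [hs', ht']
    linear_combination -(1 + X * f ^ 2) * hdet
  have hdet' : ((X + f) * F2 + X * f) * s' - X * f * F2 * t' = 1 := by
    linear_combination ha - F2 * ha'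
  have hU : Uni ((X + f) * F2 + X * f) (X * f * F2) := by
    have hU1 : Uni (X + f) (X * f) := by
      rw [(Uni.one_left X).tail_iff (s := 1) (t := 0) (by ring)]
      convert ((Uni.one_left (X ^ 2)).add_mul g).neg_right using 1
      · nth_rewrite 1 [hfg]; ring
      · ring
    refine hU1.prod_step (s := s) (t := -g) (by linear_combination hdet) ?_
    convert (((Uni.one_left X).neg_left).fold (f ^ 2)).add_mul w using 1
    · rw [hF2']; ring
    · ring
  have h2 := h1.tail (P' := F3 + s' * (X * f * F2)) (Q' := -(X * f * F2) ^ 2) hU hdet'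
    (by linear_combination F3 * hdet') (by ring) (neg_ne_zero.2 (pow_ne_zero _ hd0))
    (by rw [natDegree_neg, hd3]; push_cast; lia)
  have h3 := h2.neg_den.add_mul (-(w + (-f - s + X * f * w) ^ 2 * M2))
  convert h3 using 1
  have hb : -(1 + X * f ^ 2) + F2 - (1 - 2 * X) * f ^ 2 + f = X ^ 2 * f ^ 2 * w := by
    rw [hF2']; linear_combination -f * hfs
  have hc : F2 - 1 = X * f * (-f - s + X * f * w) := by rw [hF2']; ring
  rw [hF3]
  linear_combination -F2 * ha - F2 ^ 2 * hb - F2 ^ 2 * M2 *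
    (F2 - 1 + X * f * (-f - s + X * f * w)) * hc

/-- The tail in `approx_tail_three_terms` is close to `(1 - 2 x) / x²`. -/
theorem not_mem_of_cube_sub_add_one (hfg : f = 1 - X + X ^ 2 * g) (hg : g = X + (X - 1) ^ 2 * m)
    (hf : 2 < f.natDegree) {α : K}
    (hα : HasSum (fun n => (ι (polyIterate f n))⁻¹) α) : α ∉ closure cfValues := by
  intro hm
  have h := approx_tail_three_terms hfg hg hf hα hm
  have h0 : f ≠ 0 := fun h => by simp [h] at hf
  obtain ⟨hd0, hd1⟩ := natDegree_prod_three (f := f) (by lia)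
  have hd3 : ((X * f * f.comp f) ^ 2).natDegree = 2 * (1 + f.natDegree + f.natDegree ^ 2) := by
    rw [natDegree_pow, hd1]
  have hd4 : (1 - f * f.comp f ^ 2).natDegree ≤ f.natDegree + 2 * f.natDegree ^ 2 := by
    refine (natDegree_sub_le _ _).trans (max_le (by simp) ?_)
    refine natDegree_mul_le.trans ?_
    have : (f.comp f ^ 2).natDegree ≤ 2 * f.natDegree ^ 2 := by
      rw [natDegree_pow, natDegree_comp, sq]
    lia
  have h1 : Approx (C 1 + C (-2) * X) (X ^ 2) 0 := by
    refine h.change (R := 1 - f * f.comp f ^ 2) (S := (X * f * f.comp f) ^ 2)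
      (pow_ne_zero _ X_ne_zero) (pow_ne_zero _ hd0) (by simp; ring) ?_ ?_
    · rw [hd3, natDegree_X_pow]; push_cast; nlinarith
    · rw [hd3, natDegree_X_pow]; push_cast; lia
  have := h1.small_coeffs le_rfl
  lia

end

theorem exists_expansion_zero (f : ℤ[X]) :
    ∃ g, f = C (f.coeff 0) + C (f.coeff 1) * X + X ^ 2 * g := by
  refine ⟨f.divX.divX, ?_⟩
  have h1 := f.divX_mul_X_add
  have h2 := f.divX.divX_mul_X_add
  rw [coeff_divX] at h2
  nth_rewrite 1 [← h1, ← h2]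
  ring

theorem exists_expansion_one (g : ℤ[X]) :
    ∃ a b m, g = C a + C b * (X - 1) + (X - 1) ^ 2 * m := by
  obtain ⟨g1, h1⟩ := X_sub_C_dvd_sub_C_eval (p := g) (a := (1 : ℤ))
  obtain ⟨m, h2⟩ := X_sub_C_dvd_sub_C_eval (p := g1) (a := (1 : ℤ))
  rw [C_1] at h1 h2
  exact ⟨g.eval 1, g1.eval 1, m, by linear_combination h1 + (X - 1) * h2⟩

/-- With `A = a - 1` and `B = k + (k - 1) b`, the surviving triples `(k, A, B)` are `(1, -1, B)`,
`(0, 0, 0)`, `(0, 0, 1)`, `(0, -1, -1)`, `(-1, 1, 1)` and `(-1, 0, -1)`. -/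
theorem nonnegCongruences_of_mem_of_coeff_zero_eq_one {f : ℤ[X]} (hf : 2 < f.natDegree) {α : K}
    (hα : HasSum (fun n => (ι (polyIterate f n))⁻¹) α) (hm : α ∈ closure cfValues)
    (h0 : f.coeff 0 = 1) : NonnegCongruences f := by
  obtain ⟨g, hfg⟩ := exists_expansion_zero f
  obtain ⟨k, hk⟩ : ∃ k, f.coeff 1 = k - 1 := ⟨f.coeff 1 + 1, by ring⟩
  obtain ⟨a, b, m, hg⟩ := exists_expansion_one g
  rw [h0, hk] at hfg
  have hk3 := (small_of_mem hf hfg hα hm).2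
  rw [C_1] at hfg
  have h1 := approx_tail_two_terms hfg hg hf hk3 hα hm
  obtain ⟨hA, hB⟩ := small_of_tail_two_terms hf h1
  unfold NonnegCongruences
  by_cases hA0 : a = 1
  · subst hA0
    rw [sub_self] at h1
    by_cases hk0 : k = 0
    · subst hk0
      rcases (by lia : b = 0 ∨ b = -1 ∨ b = 1) with rfl | rfl | rfl
      · iterate 6 right
        left
        exact ⟨m, by rw [hfg, hg]; simp; ring⟩
      · iterate 4 right
        left
        exact ⟨m, by rw [hfg, hg]; simp; ring⟩
      · exact absurd hm (not_mem_of_cube_sub_add_one (g := g) (m := m) (by rw [hfg]; simp; ring)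
          (by rw [hg]; simp) hf hα)
    · have hB' : k + (k - 1) * b = 1 ∨ k + (k - 1) * b = -1 := by
        rcases hk3 with rfl | rfl | rfl <;> lia
      obtain ⟨rfl, hb⟩ := eq_of_zero_of_unit hfg hf (by lia) hB' h1
      obtain rfl : b = 0 := by lia
      iterate 7 right
      exact ⟨m, by rw [hfg, hg]; simp; ring⟩
  · have hA' : a - 1 = 1 ∨ a - 1 = -1 := by lia
    by_cases hk0 : k = 0
    · subst hk0
      obtain ⟨h2, h3⟩ := eq_of_unit_of_zero hfg hf hA' hB h1
      obtain rfl : a = 0 := by lia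
      obtain rfl : b = 1 := by lia
      iterate 3 right
      left
      exact ⟨m, by rw [hfg, hg]; simp; ring⟩
    · have h2 := approx_tail_unit_reduced hfg (by lia) (approx_tail_unit hf hA' hB h1)
      have h3 := small_of_tail_unit hf (by lia) h2
      rcases (by lia : k = 1 ∨ k = -1) with rfl | rfl
      · rcases hA' with ha | ha
        · rw [ha] at h2
          have : (1 : ℤ) - 1 - (1 + (1 - 1) * b) = -1 := by ring
          rw [this] at h2
          exact (not_approx_one_one hfg hf h2).elim
        · obtain rfl : a = 0 := by lia
          iterate 2 right
          left
          exact ⟨C b + (X - 1) * m, by rw [hfg, hg]; simp; ring⟩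
      · obtain rfl : a = 2 := by lia
        obtain rfl : b = -1 := by lia
        iterate 5 right
        left
        exact ⟨m, by rw [hfg, hg]; simp; ring⟩

/-- If `f ≡ -2x (mod x²)`, the continued fraction has a tail close to `3 / x`. -/
theorem not_mem_of_neg_two {f g : ℤ[X]} (hf : 1 < f.natDegree) (hfg : f = -2 * X + X ^ 2 * g)
    {α : K} (hα : HasSum (fun n => (ι (polyIterate f n))⁻¹) α) : α ∉ closure cfValues := by
  intro hm
  obtain ⟨w, hw⟩ : ∃ w : ℤ[X], w = -2 + X * g := ⟨_, rfl⟩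
  obtain ⟨v, hv⟩ : ∃ v : ℤ[X], v = -2 + f * g.comp f := ⟨_, rfl⟩
  have hfw : f = X * w := by rw [hw, hfg]; ring
  have hfv : f.comp f = f * v := by
    rw [hv]
    nth_rewrite 1 [hfg]
    simp only [add_comp, mul_comp, pow_comp, X_comp, neg_comp, ofNat_comp]
    ring
  have hf0 : f ≠ 0 := fun h => by simp [h] at hf
  have hff0 : f.comp f ≠ 0 := by
    have := polyIterate_ne_zero hf 2
    simpa only [polyIterate, comp_X] using this
  have hw0 : w ≠ 0 := fun h => hf0 (by rw [hfw, h, mul_zero])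
  have hv0 : v ≠ 0 := fun h => hff0 (by rw [hfv, h, mul_zero])
  have dw : f.natDegree = 1 + w.natDegree := by rw [hfw, natDegree_X_mul hw0, add_comm]
  have dv : f.natDegree ^ 2 = f.natDegree + v.natDegree := by
    rw [← natDegree_mul hf0 hv0, ← hfv, natDegree_comp, sq]
  have dwv : w.natDegree < v.natDegree := by nlinarith
  have hw1 : w - 1 ≠ 0 := fun h => by
    rw [sub_eq_zero.1 h, natDegree_one] at dw
    lia
  have hv1 : v + 1 ≠ 0 := fun h => by
    rw [eq_neg_of_add_eq_zero_left h, natDegree_neg, natDegree_one] at dwv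
    lia
  have hwv1 : v + w + 1 ≠ 0 := fun h => by
    have h1 : v = -(w + 1) := by linear_combination h
    rw [h1, natDegree_neg, ← C_1, natDegree_add_C] at dwv
    exact lt_irrefl _ dwv
  have h1 : Approx (w * v + v + 1) (X * w * v) 0 := by
    refine approx_of_sum hf hα hm 3 (mul_ne_zero (mul_ne_zero X_ne_zero hw0) hv0) ?_ ?_
    · simp only [sumNum, Finset.prod_range_succ, Finset.prod_range_zero, polyIterate, comp_X]
      rw [hfv, hfw]
      ring
    · have : (X * w * v).natDegree = f.natDegree ^ 2 := by
        rw [natDegree_mul (mul_ne_zero X_ne_zero hw0) hv0, natDegree_X_mul hw0, dv, dw]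
        ring
      rw [this]
      have : 2 * f.natDegree ^ 2 ≤ f.natDegree ^ 3 := by
        rw [pow_succ' _ 2]
        exact Nat.mul_le_mul_right _ hf
      push_cast
      exact_mod_cast this
  have h2 := (h1.tail (Uni.one_left X) (s := 1) (t := 0) (P' := w * v + v + 1)
    (Q' := -(X * (v + 1))) (by ring) (by ring) (by ring) (neg_ne_zero.2 (mul_ne_zero X_ne_zero hv1))
    (by
      rw [natDegree_neg, natDegree_X_mul hv1, natDegree_X,
        natDegree_mul (mul_ne_zero X_ne_zero hw0) hv0]
      push_cast
      lia)).neg_den.add_mul (-g)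
  have h3 := h2.neg
  rw [show -(w * v + v + 1 + -g * (X * (v + 1))) = v + w + 1 by
    linear_combination -(v + 1) * hw] at h3
  have h4 := ((h3.inv hwv1 (by rw [natDegree_X_mul hv1]; push_cast; lia)).step X (R := -(X * w))
    (by ring) (neg_ne_zero.2 (mul_ne_zero X_ne_zero hw0))
    (by rw [natDegree_neg, natDegree_X_mul hw0]; push_cast; lia)).neg_den.add_mul (-g.comp f)
  rw [show v + w + 1 + -g.comp f * (X * w) = w - 1 by
    linear_combination hv + g.comp f * hfw] at h4
  have h5 := ((h4.inv hw1 (by rw [natDegree_X_mul hw0]; push_cast; lia)).step X (R := X)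
    (by ring) X_ne_zero (by rw [natDegree_X]; push_cast; lia)).add_mul (-g)
  have h6 : Approx (C (-3)) X 0 := by
    convert h5 using 1
    rw [hw]
    simp
    ring
  have h7 := (h6.inv (C_ne_zero.2 (by norm_num)) (by simp)).dvd_coeff le_rfl one_ne_zero
  rw [coeff_X_one] at h7
  norm_num at h7

/-! ### Necessity: degree two -/

theorem natDegree_prod_polyIterate {f : ℤ[X]} (hf : 1 < f.natDegree) (n : ℕ) :
    (∏ i ∈ Finset.range n, polyIterate f i).natDegree =
      ∑ i ∈ Finset.range n, f.natDegree ^ i := by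
  rw [natDegree_prod _ _ fun i _ => polyIterate_ne_zero hf i]
  simp only [natDegree_polyIterate]

/-- An approximation of a partial sum that is good enough to approximate the whole series. -/
theorem approx_of_sum_sub {f : ℤ[X]} (hf : f.natDegree = 2) {α : K}
    (hα : HasSum (fun n => (ι (polyIterate f n))⁻¹) α) (hm : α ∈ closure cfValues) (n d r : ℕ)
    {P Q R : ℤ[X]} {z : ℤ} (hQ : Q.eval z ≠ 0)
    (hR : sumNum f n * Q - P * ∏ i ∈ Finset.range n, polyIterate f i = R)
    (hQd : Q.natDegree ≤ d) (hRr : R.natDegree ≤ r) (hr : r + d + 2 ≤ 2 ^ n)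
    (hd : 2 * d + 1 ≤ 2 ^ n) : Approx P Q 1 := by
  have hf1 : 1 < f.natDegree := by lia
  have hQ0 : Q ≠ 0 := fun h => hQ (by rw [h, eval_zero])
  have h0 : ∏ i ∈ Finset.range n, polyIterate f i ≠ 0 :=
    Finset.prod_ne_zero_iff.2 fun i _ => polyIterate_ne_zero hf1 i
  have hD : (∏ i ∈ Finset.range n, polyIterate f i).natDegree + 1 = 2 ^ n := by
    rw [natDegree_prod_polyIterate hf1, hf, Nat.geomSum_eq le_rfl]
    have := Nat.one_le_two_pow (n := n)
    lia
  have h1 := approx_of_sum hf1 hα hm n h0 (P := sumNum f n) rfl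
    (e := 2 ^ n - 2 * (∏ i ∈ Finset.range n, polyIterate f i).natDegree) (by rw [hf]; simp)
  have h2 : ((2 ^ n : ℕ) : ℤ) = 2 ^ n := by push_cast; rfl
  refine h1.change (R := R) (S := (∏ i ∈ Finset.range n, polyIterate f i) * Q) hQ0
    (mul_ne_zero h0 hQ0) (by rw [hR]; ring) (by lia) ?_
  rw [natDegree_mul h0 hQ0]
  push_cast
  lia

namespace Approx

variable {P Q : ℤ[X]}

theorem step_one (h : Approx P Q 1) (a R : ℤ[X]) (z : ℤ) (hR : P = a * Q + R)
    (hz : R.eval z ≠ 0) : Approx Q R 1 :=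
  h.step a hR (fun h => hz (by rw [h, eval_zero])) (by positivity)

theorem inv_one (h : Approx P Q 1) (z : ℤ) (hz : P.eval z ≠ 0) : Approx Q P 1 :=
  h.step_one 0 P z (by ring) hz

theorem dvd_of_linear {a b k : ℤ} (h : Approx (C a * X + C b) (C k) 1) : k ∣ a := by
  have h1 := h.dvd_coeff zero_le_one one_ne_zero
  rwa [coeff_add, coeff_C_of_ne_zero one_ne_zero, coeff_C_mul_X, if_pos rfl, add_zero] at h1

end Approx

/-! The polynomials below satisfy the bounds of `small_of_mem_quadratic`. For each, `P / Q` is a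
convergent of the continued fraction of the series over `ℚ[x]`. The Euclidean algorithm for `P / Q`,
with partial quotients in `ℤ[x]` as long as possible, leads to a linear polynomial divided by an
integer that does not divide its leading coefficient. -/

theorem not_mem_sq_add_one {α : K}
    (hα : HasSum (fun n => (ι (polyIterate (X ^ 2 + 1 : ℤ[X]) n))⁻¹) α) :
    α ∉ closure cfValues := by
  intro hm
  have hs : ∀ n, polyIterate (X ^ 2 + 1 : ℤ[X]) (n + 1) =
      (polyIterate (X ^ 2 + 1) n) ^ 2 + 1 := by
    intro n
    simp [polyIterate]
  have h := approx_of_sum_sub (by compute_degree!) hα hm 5 9 21 (z := 0)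
    (P := -9 * X ^ 8 - 8 * X ^ 7 - 32 * X ^ 6 - 29 * X ^ 5 - 56 * X ^ 4 - 43 * X ^ 3 - 41 * X ^ 2 -
      26 * X - 19)
    (Q := -9 * X ^ 9 + X ^ 8 - 33 * X ^ 7 + 4 * X ^ 6 - 60 * X ^ 5 + 8 * X ^ 4 - 48 * X ^ 3 +
      7 * X ^ 2 - 24 * X + 3)
    (R := X ^ 21 + 12 * X ^ 20 + 10 * X ^ 19 + 120 * X ^ 18 + 50 * X ^ 17 + 609 * X ^ 16 +
      159 * X ^ 15 + 1980 * X ^ 14 + 356 * X ^ 13 + 4551 * X ^ 12 + 586 * X ^ 11 +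
      7698 * X ^ 10 + 725 * X ^ 9 + 9780 * X ^ 8 + 670 * X ^ 7 + 9264 * X ^ 6 + 453 * X ^ 5 +
      6390 * X ^ 4 + 206 * X ^ 3 + 2940 * X ^ 2 + 56 * X + 780)
    (by simp) (by
      simp only [sumNum, Finset.prod_range_succ, Finset.prod_range_zero, hs]
      simp only [polyIterate]
      ring) (by compute_degree) (by compute_degree) (by norm_num) (by norm_num)
  replace h := h.inv_one 0 (by simp)
  replace h := h.step_one (X - 1)
    (-9 * X ^ 7 + X ^ 6 - 33 * X ^ 5 - 5 * X ^ 4 - 50 * X ^ 3 - 8 * X ^ 2 - 31 * X - 16) 0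
    (by ring) (by simp)
  replace h := h.step_one (X + 1) (9 * X ^ 5 - X ^ 4 + 15 * X ^ 3 - 2 * X ^ 2 + 21 * X - 3) 0
    (by ring) (by simp)
  replace h := h.step_one (-X ^ 2 - 2) (-9 * X ^ 4 + X ^ 3 - 15 * X ^ 2 + 11 * X - 22) 0
    (by ring) (by simp)
  replace h := h.step_one (-X) (9 * X ^ 2 - X - 3) 0 (by ring) (by simp)
  replace h := h.step_one (-X ^ 2 - 2) (C 9 * X + C (-28)) 0 (by simp; ring) (by simp)
  replace h := h.step_one (X + 3) (C 81) 0 (by simp; ring) (by simp)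
  have h1 := h.dvd_of_linear
  norm_num at h1

theorem not_mem_sq_add_two {α : K}
    (hα : HasSum (fun n => (ι (polyIterate (X ^ 2 + 2 : ℤ[X]) n))⁻¹) α) :
    α ∉ closure cfValues := by
  intro hm
  have hs : ∀ n, polyIterate (X ^ 2 + 2 : ℤ[X]) (n + 1) =
      (polyIterate (X ^ 2 + 2) n) ^ 2 + 2 := by
    intro n
    simp [polyIterate]
  have h := approx_of_sum_sub (by compute_degree!) hα hm 4 5 9 (z := 0)
    (P := 9 * X ^ 4 + 8 * X ^ 3 + 23 * X ^ 2 + 12 * X + 25)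
    (Q := 9 * X ^ 5 - X ^ 4 + 24 * X ^ 3 - 3 * X ^ 2 + 27 * X - 3)
    (R := -X ^ 9 - 39 * X ^ 8 - 7 * X ^ 7 - 282 * X ^ 6 - 24 * X ^ 5 - 972 * X ^ 4 - 40 * X ^ 3 -
      1632 * X ^ 2 - 36 * X - 1368)
    (by simp) (by
      simp only [sumNum, Finset.prod_range_succ, Finset.prod_range_zero, hs]
      simp only [polyIterate]
      ring) (by compute_degree) (by compute_degree) (by norm_num) (by norm_num)
  replace h := h.inv_one 0 (by simp)
  replace h := h.step_one (X - 1) (9 * X ^ 3 + 8 * X ^ 2 + 14 * X + 22) 0 (by ring) (by simp)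
  replace h := h.step_one X (9 * X ^ 2 - 10 * X + 25) 0 (by ring) (by simp)
  replace h := h.step_one (X + 2) (C 9 * X + C (-28)) 0 (by simp; ring) (by simp)
  replace h := h.step_one (X + 2) (C 81) 0 (by simp; ring) (by simp)
  have h1 := h.dvd_of_linear
  norm_num at h1

theorem not_mem_sq_sub_add_two {α : K}
    (hα : HasSum (fun n => (ι (polyIterate (X ^ 2 - X + 2 : ℤ[X]) n))⁻¹) α) :
    α ∉ closure cfValues := by
  intro hm
  have hs : ∀ n, polyIterate (X ^ 2 - X + 2 : ℤ[X]) (n + 1) =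
      (polyIterate (X ^ 2 - X + 2) n) ^ 2 - (polyIterate (X ^ 2 - X + 2) n) + 2 := by
    intro n
    simp [polyIterate]
  have h := approx_of_sum_sub (by compute_degree!) hα hm 4 6 8 (z := 0)
    (P := -2 * X ^ 5 + X ^ 4 - 6 * X ^ 3 - 6 * X ^ 2 - 2 * X - 4)
    (Q := -2 * X ^ 6 + 3 * X ^ 5 - 7 * X ^ 4 - 2 * X ^ 3 + 5 * X ^ 2 - 6 * X - 3)
    (R := -18 * X ^ 8 + 72 * X ^ 7 - 216 * X ^ 6 + 400 * X ^ 5 - 650 * X ^ 4 + 728 * X ^ 3 -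
      724 * X ^ 2 + 424 * X - 336)
    (by simp) (by
      simp only [sumNum, Finset.prod_range_succ, Finset.prod_range_zero, hs]
      simp only [polyIterate]
      ring) (by compute_degree) (by compute_degree) (by norm_num) (by norm_num)
  replace h := h.inv_one 0 (by simp)
  replace h := h.step_one (X - 1) (-2 * X ^ 3 + X ^ 2 - 4 * X - 7) 0 (by ring) (by simp)
  replace h := h.step_one (X ^ 2 + 1) (C 2 * X + C 3) 0 (by simp; ring) (by simp)
  replace h := h.step_one (-X ^ 2 + 2 * X - 5) (C 8) 0 (by simp; ring) (by simp)
  have h1 := h.dvd_of_linear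
  norm_num at h1

theorem not_mem_sq_sub_two_mul_add_two {α : K}
    (hα : HasSum (fun n => (ι (polyIterate (X ^ 2 - 2 * X + 2 : ℤ[X]) n))⁻¹) α) :
    α ∉ closure cfValues := by
  intro hm
  have hs : ∀ n, polyIterate (X ^ 2 - 2 * X + 2 : ℤ[X]) (n + 1) =
      (polyIterate (X ^ 2 - 2 * X + 2) n) ^ 2 - 2 * (polyIterate (X ^ 2 - 2 * X + 2) n) + 2 := by
    intro n
    simp [polyIterate]
  have h := approx_of_sum_sub (by compute_degree!) hα hm 4 4 10 (z := 0)
    (P := -3 * X ^ 3 + 8 * X ^ 2 - 12 * X + 8)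
    (Q := -3 * X ^ 4 + 11 * X ^ 3 - 17 * X ^ 2 + 12 * X + 1)
    (R := X ^ 10 - 7 * X ^ 9 + 22 * X ^ 8 - 47 * X ^ 7 + 88 * X ^ 6 - 146 * X ^ 5 + 184 * X ^ 4 -
      152 * X ^ 3 + 76 * X ^ 2 - 12 * X + 8)
    (by simp) (by
      simp only [sumNum, Finset.prod_range_succ, Finset.prod_range_zero, hs]
      simp only [polyIterate]
      ring) (by compute_degree) (by compute_degree) (by norm_num) (by norm_num)
  replace h := h.inv_one 0 (by simp)
  replace h := h.step_one (X - 1) (3 * X ^ 2 - 8 * X + 9) 0 (by ring) (by simp)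
  replace h := h.step_one (-X) (C (-3) * X + C 8) 0 (by simp; ring) (by simp)
  replace h := h.step_one (-X) (C 9) 0 (by simp; ring) (by simp)
  have h1 := h.dvd_of_linear
  norm_num at h1

theorem not_mem_two_mul_sq_add_one {α : K}
    (hα : HasSum (fun n => (ι (polyIterate (2 * X ^ 2 + 1 : ℤ[X]) n))⁻¹) α) :
    α ∉ closure cfValues := by
  intro hm
  have hs : ∀ n, polyIterate (2 * X ^ 2 + 1 : ℤ[X]) (n + 1) =
      2 * (polyIterate (2 * X ^ 2 + 1) n) ^ 2 + 1 := by
    intro n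
    simp [polyIterate]
  have h := approx_of_sum_sub (by compute_degree!) hα hm 4 5 9 (z := 0)
    (P := 288 * X ^ 4 + 128 * X ^ 3 + 184 * X ^ 2 + 48 * X + 50)
    (Q := 288 * X ^ 5 - 16 * X ^ 4 + 192 * X ^ 3 - 12 * X ^ 2 + 54 * X - 3)
    (R := -64 * X ^ 9 - 1248 * X ^ 8 - 112 * X ^ 7 - 2256 * X ^ 6 - 96 * X ^ 5 - 1944 * X ^ 4 -
      40 * X ^ 3 - 816 * X ^ 2 - 9 * X - 171)
    (by simp) (by
      simp only [sumNum, Finset.prod_range_succ, Finset.prod_range_zero, hs]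
      simp only [polyIterate]
      ring) (by compute_degree) (by compute_degree) (by norm_num) (by norm_num)
  replace h := h.inv_one 0 (by simp)
  replace h := h.step_one (X - 1) (144 * X ^ 4 + 136 * X ^ 3 + 124 * X ^ 2 + 52 * X + 47) 0
    (by ring) (by simp)
  replace h := h.step_one 2 (-144 * X ^ 3 - 64 * X ^ 2 - 56 * X - 44) 0 (by ring) (by simp)
  replace h := h.step_one (-X - 1) (-72 * X ^ 3 + 4 * X ^ 2 - 48 * X + 3) 0 (by ring) (by simp)
  replace h := h.step_one 2 (-72 * X ^ 2 + 40 * X - 50) 0 (by ring) (by simp)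
  replace h := h.step_one X (-36 * X ^ 2 + 2 * X + 3) 0 (by ring) (by simp)
  replace h := h.step_one 2 (36 * X - 56) 0 (by ring) (by simp)
  replace h := h.step_one (-X - 2) (C 18 * X + C (-109)) 0 (by simp; ring) (by simp)
  replace h := h.step_one 2 (C 162) 0 (by simp; ring) (by simp)
  have h1 := h.dvd_of_linear
  norm_num at h1

theorem not_mem_two_mul_sq_sub_add_one {α : K}
    (hα : HasSum (fun n => (ι (polyIterate (2 * X ^ 2 - X + 1 : ℤ[X]) n))⁻¹) α) :
    α ∉ closure cfValues := by
  intro hm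
  have hs : ∀ n, polyIterate (2 * X ^ 2 - X + 1 : ℤ[X]) (n + 1) =
      2 * (polyIterate (2 * X ^ 2 - X + 1) n) ^ 2 - (polyIterate (2 * X ^ 2 - X + 1) n) + 1 := by
    intro n
    simp [polyIterate]
  have h := approx_of_sum_sub (by compute_degree!) hα hm 4 6 8 (z := 0)
    (P := 128 * X ^ 5 - 32 * X ^ 4 + 96 * X ^ 3 + 48 * X ^ 2 + 8 * X + 8)
    (Q := 128 * X ^ 6 - 96 * X ^ 5 + 112 * X ^ 4 + 16 * X ^ 3 - 20 * X ^ 2 + 12 * X + 3)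
    (R := 576 * X ^ 8 - 1152 * X ^ 7 + 1728 * X ^ 6 - 1600 * X ^ 5 + 1300 * X ^ 4 - 728 * X ^ 3 +
      362 * X ^ 2 - 106 * X + 42)
    (by simp) (by
      simp only [sumNum, Finset.prod_range_succ, Finset.prod_range_zero, hs]
      simp only [polyIterate]
      ring) (by compute_degree) (by compute_degree) (by norm_num) (by norm_num)
  replace h := h.inv_one 0 (by simp)
  replace h := h.step_one (X - 1)
    (64 * X ^ 5 - 16 * X ^ 4 + 64 * X ^ 3 + 20 * X ^ 2 + 12 * X + 11) 0
    (by ring) (by simp)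
  replace h := h.step_one 2 (-32 * X ^ 3 + 8 * X ^ 2 - 16 * X - 14) 0 (by ring) (by simp)
  replace h := h.step_one (-2 * X ^ 2 - 1) (C (-4) * X + C (-3)) 0 (by simp; ring) (by simp)
  replace h := h.step_one (8 * X ^ 2 - 8 * X + 10) (C 16) 0 (by simp; ring) (by simp)
  have h1 := h.dvd_of_linear
  norm_num at h1

theorem not_mem_two_mul_sq_sub_two_mul_add_one {α : K}
    (hα : HasSum (fun n => (ι (polyIterate (2 * X ^ 2 - 2 * X + 1 : ℤ[X]) n))⁻¹) α) :
    α ∉ closure cfValues := by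
  intro hm
  have hs : ∀ n, polyIterate (2 * X ^ 2 - 2 * X + 1 : ℤ[X]) (n + 1) =
      2 * (polyIterate (2 * X ^ 2 - 2 * X + 1) n) ^ 2 -
        2 * (polyIterate (2 * X ^ 2 - 2 * X + 1) n) + 1 := by
    intro n
    simp [polyIterate]
  have h := approx_of_sum_sub (by compute_degree!) hα hm 4 4 10 (z := 0)
    (P := -48 * X ^ 3 + 64 * X ^ 2 - 48 * X + 16)
    (Q := -48 * X ^ 4 + 88 * X ^ 3 - 68 * X ^ 2 + 24 * X + 1)
    (R := 128 * X ^ 10 - 448 * X ^ 9 + 704 * X ^ 8 - 752 * X ^ 7 + 704 * X ^ 6 - 584 * X ^ 5 +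
      368 * X ^ 4 - 152 * X ^ 3 + 38 * X ^ 2 - 3 * X + 1)
    (by simp) (by
      simp only [sumNum, Finset.prod_range_succ, Finset.prod_range_zero, hs]
      simp only [polyIterate]
      ring) (by compute_degree) (by compute_degree) (by norm_num) (by norm_num)
  replace h := h.inv_one 0 (by simp)
  replace h := h.step_one (X - 1) (-24 * X ^ 3 + 44 * X ^ 2 - 40 * X + 17) 0 (by ring) (by simp)
  replace h := h.step_one 2 (-24 * X ^ 2 + 32 * X - 18) 0 (by ring) (by simp)
  replace h := h.step_one (X - 1) (-12 * X ^ 2 + 10 * X - 1) 0 (by ring) (by simp)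
  replace h := h.step_one 2 (12 * X - 16) 0 (by ring) (by simp)
  replace h := h.step_one (-X - 1) (C 6 * X + C (-17)) 0 (by simp; ring) (by simp)
  replace h := h.step_one 2 (C 18) 0 (by simp; ring) (by simp)
  have h1 := h.dvd_of_linear
  norm_num at h1

/-- The analogue of `Approx.small_coeffs` for `(b + a k x) / (a x²)`, where `b ≡ -1 (mod a)`. -/
theorem Approx.small_coeffs_quadratic {a b c k : ℤ} (ha : a ≠ 0) (hb : a * c - b = 1)
    (h : Approx (C b + C (a * k) * X) (C a * X ^ 2) 0) :
    (b = 0 ∨ b = 1 ∨ b = -1) ∧ (k = 0 ∨ k = 1 ∨ k = -1) := by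
  have hQ : (C a * X ^ 2 : ℤ[X]) ≠ 0 := mul_ne_zero (C_ne_zero.2 ha) (pow_ne_zero _ X_ne_zero)
  have hd : (C a * X ^ 2 : ℤ[X]).natDegree = 2 := natDegree_C_mul_X_pow 2 a ha
  have hk : k = 0 ∨ k = 1 ∨ k = -1 := by
    by_cases hk : k = 0
    · exact Or.inl hk
    right
    have h1 : Approx (C k) X 0 := by
      refine h.change (R := C b) (S := C a * X ^ 2) X_ne_zero hQ (by rw [C_mul]; ring) ?_ ?_
      · rw [hd]; simp
      · rw [hd]; simp
    have h2 := (h1.inv (C_ne_zero.2 hk) (by simp)).dvd_coeff le_rfl one_ne_zero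
    rw [coeff_X_one] at h2
    exact Int.isUnit_iff.1 (isUnit_of_dvd_one h2)
  refine ⟨?_, hk⟩
  by_cases hb0 : b = 0
  · exact Or.inl hb0
  right
  by_cases hk0 : k = 0
  · subst hk0
    rw [mul_zero, C_0, zero_mul, add_zero] at h
    have h2 := (h.inv (C_ne_zero.2 hb0) (by rw [hd]; simp)).dvd_coeff le_rfl two_ne_zero
    rw [coeff_C_mul_X_pow, if_pos rfl] at h2
    refine Int.isUnit_iff.1 (isUnit_of_dvd_one ?_)
    rw [← hb]
    exact dvd_sub (h2.mul_right c) dvd_rfl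
  · have hk2 : k ^ 2 = 1 := by rcases hk with rfl | rfl | rfl <;> simp at hk0 ⊢
    have hk2' : (C k : ℤ[X]) ^ 2 = 1 := by rw [← C_pow, hk2, C_1]
    have hb' : (C a * C c - C b : ℤ[X]) = 1 := by rw [← C_mul, ← C_sub, hb, C_1]
    have hU : Uni (C a) (C a * C k * X - C b) := by
      convert (Uni.one_right (C a)).add_mul' (C k * X - C c) using 1
      linear_combination hb'
    have h1 := h.tail hU (s := C c - C k * X) (t := -1) (P' := C k * X + C (b * c))
      (Q' := C (b ^ 2)) (by linear_combination hb')
      (by rw [C_mul, C_mul]; linear_combination C k * X * hb' - C a * X ^ 2 * hk2')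
      (by rw [C_mul, C_pow]; linear_combination -C a ^ 2 * X ^ 2 * hk2')
      (C_ne_zero.2 (pow_ne_zero _ hb0)) (by
        have : (C a * C k * X - C b).natDegree ≤ 1 := by compute_degree
        rw [hd, natDegree_C]
        push_cast
        lia)
    have h2 := h1.dvd_coeff le_rfl one_ne_zero
    rw [coeff_add, coeff_C_of_ne_zero one_ne_zero, coeff_C_mul_X, if_pos rfl, add_zero] at h2
    have h4 : b ∣ 1 := by
      rw [← hk2]
      exact (dvd_pow_self b two_ne_zero).trans (h2.trans (dvd_pow_self k two_ne_zero))
    exact Int.isUnit_iff.1 (isUnit_of_dvd_one h4)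

/-- In degree two the next term of the series contributes to the tail relative to `1 / x`, which is
close to `(a c - 1 + a k x) / (a x²)`. -/
theorem small_of_mem_quadratic {f : ℤ[X]} {a c k : ℤ} (ha : a ≠ 0)
    (hfg : f = C c + C (k - 1) * X + C a * X ^ 2) {α : K}
    (hα : HasSum (fun n => (ι (polyIterate f n))⁻¹) α) (hm : α ∈ closure cfValues) :
    (a * c = 0 ∨ a * c = 1 ∨ a * c = 2) ∧ (k = 0 ∨ k = 1 ∨ k = -1) := by
  have hd : f.natDegree = 2 := by
    rw [hfg]
    compute_degree!
  have hf : 1 < f.natDegree := by lia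
  have h1 := approx_three hf hα hm (e := -6) (by rw [hd]; norm_num)
  obtain ⟨hd0, hd1⟩ := natDegree_prod_three hf
  rw [hd] at hd1
  have hdc : (f.comp f).natDegree = 4 := by rw [natDegree_comp, hd]
  have hds : (f + f.comp f).natDegree = 4 := by
    rw [natDegree_add_eq_right_of_natDegree_lt (by lia), hdc]
  have hs0 : f + f.comp f ≠ 0 := fun h => by simp [h] at hds
  have hD0 : X ^ 2 * (f + f.comp f) ≠ 0 := mul_ne_zero (pow_ne_zero _ X_ne_zero) hs0
  have hD : (X ^ 2 * (f + f.comp f)).natDegree = 6 := by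
    rw [natDegree_mul (pow_ne_zero _ X_ne_zero) hs0, hds, natDegree_X_pow]
  have hcomp : f.comp f = C c + C (k - 1) * f + C a * f ^ 2 := by
    nth_rewrite 1 [hfg]
    simp only [add_comp, mul_comp, pow_comp, X_comp, C_comp]
  have h2 := (h1.tail (Uni.one_left X) (s := 1) (t := 0) (P' := (X + f) * f.comp f + X * f)
    (Q' := -(X ^ 2 * (f + f.comp f))) (by ring) (by ring) (by ring) (neg_ne_zero.2 hD0)
    (by rw [natDegree_neg, hD, hd1, natDegree_X]; norm_num)).neg_den.add_mul (-C a)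
  have hk1 : (C (k - 1) : ℤ[X]) = C k - 1 := by simp
  have h3 : Approx (C (a * c - 1) + C (a * k) * X) (C a * X ^ 2) 0 := by
    have hQ : (C a * X ^ 2 : ℤ[X]) ≠ 0 := mul_ne_zero (C_ne_zero.2 ha) (pow_ne_zero _ X_ne_zero)
    have hQd : (C a * X ^ 2 : ℤ[X]).natDegree = 2 := natDegree_C_mul_X_pow 2 a ha
    refine h2.change (R := C k * f + C c) (S := C a * (X ^ 2 * (f + f.comp f))) hQ
      (mul_ne_zero (C_ne_zero.2 ha) hD0) ?_ ?_ ?_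
    · rw [hk1] at hfg hcomp
      simp only [C_mul, C_sub, C_1]
      have e : ((X + f) * f.comp f + X * f + -C a * (X ^ 2 * (f + f.comp f))) * C a -
          (C a * C c - 1 + C a * C k * X) * (f + f.comp f) = C k * f + C c := by
        linear_combination hcomp + C a * (f + f.comp f) * hfg
      linear_combination (C a * (X ^ 2 * (f + f.comp f))) * X ^ 2 * e
    · rw [hQd, hD]; norm_num
    · have : (C k * f + C c).natDegree ≤ 2 := by
        rw [natDegree_add_C]
        exact (natDegree_C_mul_le _ _).trans hd.le
      rw [hQd, natDegree_C_mul ha, hD]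
      push_cast
      lia
  have := h3.small_coeffs_quadratic ha (c := c) (by ring)
  lia

theorem nonnegCongruences_of_mem_quadratic {f : ℤ[X]} (hf : f.natDegree = 2) {α : K}
    (hα : HasSum (fun n => (ι (polyIterate f n))⁻¹) α) (hm : α ∈ closure cfValues)
    (h0 : 0 ≤ f.coeff 0) : NonnegCongruences f := by
  obtain ⟨c, hc⟩ : ∃ c, c = f.coeff 0 := ⟨_, rfl⟩
  obtain ⟨k, hk⟩ : ∃ k, f.coeff 1 = k - 1 := ⟨f.coeff 1 + 1, by ring⟩
  obtain ⟨a, ha⟩ : ∃ a, a = f.coeff 2 := ⟨_, rfl⟩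
  have hfg : f = C c + C (k - 1) * X + C a * X ^ 2 := by
    rw [ha, hc, ← hk]
    conv_lhs => rw [f.as_sum_range' 3 (by lia)]
    simp [Finset.sum_range_succ, ← C_mul_X_pow_eq_monomial]
  have ha0 : a ≠ 0 := by
    rw [ha, ← hf]
    exact leadingCoeff_ne_zero.2 fun h => by simp [h] at hf
  rw [← hc] at h0
  obtain ⟨h1, h2⟩ := small_of_mem_quadratic ha0 hfg hα hm
  clear hc ha hk hf
  subst hfg
  unfold NonnegCongruences
  by_cases hc0 : c = 0
  · subst hc0
    rcases h2 with rfl | rfl | rfl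
    · right; left
      exact ⟨C a, by simp; ring⟩
    · left
      exact ⟨C a, by simp; ring⟩
    · exact absurd hm (not_mem_of_neg_two (g := C a) (by
        have : (C 0 + C (-1 - 1) * X + C a * X ^ 2 : ℤ[X]).natDegree = 2 := by compute_degree!
        lia) (by simp; ring) hα)
  · have hac : (a = 1 ∧ c = 1) ∨ (a = 1 ∧ c = 2) ∨ (a = 2 ∧ c = 1) := by
      have hc1 : 0 < c := by lia
      have ha1 : 0 < a := by
        rcases h1 with h1 | h1 | h1
        · exact absurd h1 (mul_ne_zero ha0 hc0)
        · exact pos_of_mul_pos_left (by lia) hc1.le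
        · exact pos_of_mul_pos_left (by lia) hc1.le
      have hac : a * c ≤ 2 := by lia
      have h3 : a ≤ 2 := by nlinarith
      have h4 : c ≤ 2 := by nlinarith
      interval_cases a <;> interval_cases c <;> lia
    rcases hac with ⟨rfl, rfl⟩ | ⟨rfl, rfl⟩ | ⟨rfl, rfl⟩ <;> rcases h2 with rfl | rfl | rfl
    · iterate 6 right
      left
      exact ⟨0, by simp; ring⟩
    · exact absurd hm (not_mem_sq_add_one (by convert hα using 5; simp; ring))
    · iterate 7 right
      exact ⟨0, by simp; ring⟩
    · exact absurd hm (not_mem_sq_sub_add_two (by convert hα using 5; simp; ring))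
    · exact absurd hm (not_mem_sq_add_two (by convert hα using 5; simp; ring))
    · exact absurd hm (not_mem_sq_sub_two_mul_add_two (by convert hα using 5; simp; ring))
    · exact absurd hm (not_mem_two_mul_sq_sub_add_one (by convert hα using 5; simp; ring))
    · exact absurd hm (not_mem_two_mul_sq_add_one (by convert hα using 5; simp; ring))
    · exact absurd hm (not_mem_two_mul_sq_sub_two_mul_add_one (by convert hα using 5; simp; ring))

/-! ### The criterion -/

theorem nonnegCongruences_of_mem {f : ℤ[X]} (hf : 1 < f.natDegree) {α : K}
    (hα : HasSum (fun n => (ι (polyIterate f n))⁻¹) α) (hm : α ∈ closure cfValues)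
    (h0 : 0 ≤ f.coeff 0) : NonnegCongruences f := by
  rcases (by lia : f.natDegree = 2 ∨ 2 < f.natDegree) with hd | hd
  · exact nonnegCongruences_of_mem_quadratic hd hα hm h0
  · obtain ⟨g, hfg⟩ := exists_expansion_zero f
    obtain ⟨k, hk⟩ : ∃ k, f.coeff 1 = k - 1 := ⟨f.coeff 1 + 1, by ring⟩
    rw [hk] at hfg
    obtain ⟨hc, hk3⟩ := small_of_mem hd hfg hα hm
    rcases (by lia : f.coeff 0 = 0 ∨ f.coeff 0 = 1) with h | h
    · rw [h] at hfg
      unfold NonnegCongruences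
      rcases hk3 with rfl | rfl | rfl
      · right; left
        exact ⟨g, by rw [hfg]; simp⟩
      · left
        exact ⟨g, by rw [hfg]; simp⟩
      · exact absurd hm (not_mem_of_neg_two (g := g) hf (by rw [hfg]; simp) hα)
    · exact nonnegCongruences_of_mem_of_coeff_zero_eq_one hd hα hm h

theorem fourteenCongruences_of_mem {f : ℤ[X]} (hf : 1 < f.natDegree) {α : K}
    (hα : HasSum (fun n => (ι (polyIterate f n))⁻¹) α) (hm : α ∈ closure cfValues) :
    FourteenCongruences f := by
  rw [fourteenCongruences_iff]
  rcases le_total 0 (f.coeff 0) with h | h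
  · exact Or.inl (nonnegCongruences_of_mem hf hα hm h)
  · right
    have hf' : 1 < (negConj f).natDegree := by rwa [natDegree_negConj]
    obtain ⟨β, hβ⟩ := summable_inv_polyIterate hf'
    refine nonnegCongruences_of_mem hf' hβ (mem_closure_negConj hf hα hβ hm) ?_
    rw [negConj, coeff_neg, coeff_zero_eq_eval_zero, eval_comp, eval_neg, eval_X, neg_zero,
      ← coeff_zero_eq_eval_zero]
    lia

theorem mem_of_fourteenCongruences {f : ℤ[X]} (hf : 1 < f.natDegree) {α : K}
    (hα : HasSum (fun n => (ι (polyIterate f n))⁻¹) α) (h : FourteenCongruences f) :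
    α ∈ closure cfValues := by
  rcases fourteenCongruences_iff.1 h with h | h
  · exact mem_closure_of_nonnegCongruences hf hα h
  · have hf' : 1 < (negConj f).natDegree := by rwa [natDegree_negConj]
    obtain ⟨β, hβ⟩ := summable_inv_polyIterate hf'
    refine mem_closure_negConj hf' hβ ?_ (mem_closure_of_nonnegCongruences hf' hβ h)
    rwa [negConj_negConj]

theorem mainTheorem1 (f : ℤ[X]) (hf : 1 < f.natDegree) :
    ∃ α : LaurentSeries ℚ,
      HasSum (fun n : ℕ => (toLaurentInv (polyIterate f n))⁻¹) α ∧
      (HasSpecializableCF α ↔ FourteenCongruences f) := by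
  obtain ⟨α, hα⟩ := summable_inv_polyIterate hf
  refine ⟨α, hα, fun h => ?_, fun h => ?_⟩
  · exact fourteenCongruences_of_mem hf hα (mem_closure_of_hasSpecializableCF h)
  · exact hasSpecializableCF_of_mem_closure (mem_of_fourteenCongruences hf hα h)
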